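/- **Setting.** Let $m,n\in\mathbb N$ be fixed, $q\in(0,\infty]$, $\alpha\in(\frac13,\frac12]$, $\beta\in(0,\infty)$, $T\in(0,\infty)$. For $b>0$ let $\Phi_b$ be the Young function $\Phi_b=E_b-E_b(0)$ on $[0,\infty)$, where $E_b(x)=\mathrm e^{x^b}-1$ for $x\ge x_b$ and $E_b$ is the tangent line of $\mathrm e^{x^b}-1$ at $x_b$ for $0\le x<x_b$, with $x_b=(\frac{1-b}{b})^{1/b}$ if $b<1$ and $x_b=0$ if $b\ge1$. Let $\|f\|_{\Phi_b(D)}=\inf\{\lambda>0:\int_D\Phi_b(|f_r|/\lambda)\,\mathrm dr\le1\}$. Write $\delta f_{s,t}=f_t-f_s$ and $\delta\Xi_{s,u,t}=\Xi_{s,t}-\Xi_{s,u}-\Xi_{u,t}$. For measurable maps $\Xi$ of two variables ($0\le s\le t\le T$), resp. three variables ($0\le s\le u\le t\le T$), and $a>0$, $r\in(0,\infty]$, let $$\|\Xi\|_{B^{a;2}_{\Phi_b,r}}=\Big\|\tau^{-a}\sup_{0\le h\le\tau}\|\Xi_{\cdot,\cdot+h}\|_{\Phi_b([0,T-h])}\Big\|_{L^r([0,T],\frac{\mathrm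 d\tau}\tau)},\quad \|\Xi\|_{B^{a;3}_{\Phi_b,r}}=\Big\|\tau^{-a}\sup_{0\le\theta\le1}\sup_{0\le h\le\tau}\|\Xi_{\cdot,\cdot+\theta h,\cdot+h}\|_{\Phi_b([0,T-h])}\Big\|_{L^r([0,T],\frac{\mathrm d\tau}\tau)},$$ and let $B^{a;2}_{\Phi_b,r}$ be the space of measurable two-parameter maps with finite (quasi)norm. Put $[f]=\|\delta f\|_{B^{\alpha;2}_{\Phi_\beta,q}}$ and let $B^\alpha_{\Phi_\beta,q}$ be the space of paths $f$ on $[0,T]$ with $\|f\|_{\Phi_\beta([0,T])}<\infty$ and $[f]<\infty$, identified with their continuous representatives. Vectors carry the Euclidean norm, matrices the Hilbert–Schmidt norm, and $\mathcal L(\cdot;\cdot)$ the operator norm. A *Besov–Orlicz rough path* is a pair $\mathbf X=(X,\mathbb X)$ with $X\in B^\alpha_{\Phi_\beta,q}([0,T];\mathbb R^n)$, $\mathbb X\in B^{2\alpha;2}_{\Phi_{\beta/2},q/2}([0,T];\mathbb R^{n\times n})$ and $\delta\mathbb X_{s,u,t}=\delta X_{s,u}(\delta X_{u,t})^\top$ for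 $0\le s\le u\le t\le T$; put $|||\mathbf X|||=[X]+\|\mathbb X\|^{1/2}_{B^{2\alpha;2}_{\Phi_{\beta/2},q/2}}$. For a finite-dimensional normed space $V$, the space $\mathscr D^X(V)$ of *controlled paths* consists of the pairs $(Y,Y')$ with $Y\in B^\alpha_{\Phi_\beta,q}([0,T];V)$, $Y'\in B^\alpha_{\Phi_\beta,q}([0,T];\mathcal L(\mathbb R^n;V))$ and $R^Y_{s,t}=\delta Y_{s,t}-Y'_s\delta X_{s,t}$ in $B^{2\alpha;2}_{\Phi_{\beta/2},q/2}([0,T];V)$; put $[(Y,Y')]=[Y']+\|R^Y\|_{B^{2\alpha;2}_{\Phi_{\beta/2},q/2}}$. For a partition $\pi=\{0=t_0<\dots<t_N=1\}$ of norm $\max_i(t_{i+1}-t_i)$ let $(I^\pi\Xi)_{s,t}=\sum_{i<N}\Xi_{s+t_i(t-s),\,s+t_{i+1}(t-s)}$. **Theorem.** Let $\mathbf X$ be a Besov–Orlicz rough path. For $(Y,Y')\in\mathscr D^X(\mathbb R^{m\times n})$ put $\Xi_{s,t}=Y_s\delta X_{s,t}+Y'_s\mathbb X_{s,t}$, where $Y'_s\in\mathcal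 L(\mathbb R^n;\mathbb R^{m\times n})$ acts on $\mathbb R^{n\times n}$ as the linear map with $ab^\top\mapsto(Y'_sa)b$. There is exactly one continuous $\mathcal I=\mathcal I_{\mathbf X}(Y,Y'):[0,T]\to\mathbb R^m$ with $\mathcal I_0=0$ and $\delta\mathcal I-\Xi\in B^{3\alpha;2}_{\Phi_{\beta/3},q/3}$ (the sewing of $\Xi$). Moreover: 1. $(Y,Y')\mapsto(\mathcal I_{\mathbf X}(Y,Y'),Y)$ is a linear map from $\mathscr D^X(\mathbb R^{m\times n})$ to $\mathscr D^X(\mathbb R^m)$. 2. $\lim_{N\to\infty}\|\delta\mathcal I-I^{\pi_N}\Xi\|_{B^{3\alpha;2}_{\Phi_{\beta/3},\bar q}}=0$ for every $\bar q\in(0,\infty]$ with $\bar q>\frac1{3\alpha}$ and $\bar q\ge\frac q3$ and every sequence $(\pi_N)$ of partitions of $[0,1]$ whose norms tend to $0$. 3. $\|\delta\mathcal I-\Xi\|_{B^{3\alpha;2}_{\Phi_{\beta/3},q/3}}\le C_1\|\delta\Xi\|_{B^{3\alpha;3}_{\Phi_{\beta/3},q/3}}$ and $\|\delta\Xi\|_{B^{3\alpha;3}_{\Phi_{\beta/3},q/3}}\le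 C_2\big(\|R^Y\|_{B^{2\alpha;2}_{\Phi_{\beta/2},q/2}}[X]+[Y']\,\|\mathbb X\|_{B^{2\alpha;2}_{\Phi_{\beta/2},q/2}}\big).$ 4. $[\mathcal I]\le C_3\big((|Y_0|+[Y]+\|R^Y\|_{B^{2\alpha;2}_{\Phi_{\beta/2},q/2}})[X]+(|Y'_0|+[Y'])\,|||\mathbf X|||^2\big).$ 5. For every $p\in(\frac3\alpha,\infty)$, with $R^{\mathcal I}_{s,t}=\delta\mathcal I_{s,t}-Y_s\delta X_{s,t}$, $$\|R^{\mathcal I}\|_{B^{2\alpha;2}_{\Phi_{\beta/2},q/2}}\le C_4\Big(|Y'_0|\,\|\mathbb X\|_{B^{2\alpha;2}_{\Phi_{\beta/2},q/2}}+T^{\alpha-\frac1p}\big(|||\mathbf X|||\vee|||\mathbf X|||^2\big)[(Y,Y')]\Big).$$ Here (besides the fixed dimensions $m,n$) $C_1$ depends only on $\alpha,\beta,q,T$, $C_2$ only on $q,T$, $C_3$ only on $\alpha,\beta,q,T$, and $C_4$ only on $\alpha,\beta,p,q,T$; $C_1,C_2,C_4$ are nondecreasing in $T$. -/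

import Mathlib

open MeasureTheory Set Filter Topology
open scoped ENNReal NNReal

namespace BesovOrlicz

noncomputable section

/-- `ℝⁿ` with the Euclidean norm. -/
abbrev Vec (n : ℕ) : Type := EuclideanSpace ℝ (Fin n)

/-- `ℝ^{m × n}` with the Hilbert–Schmidt norm; the entry in row `i`, column `j` of `A` is
`A (i, j)`. -/
abbrev Mat (m n : ℕ) : Type := EuclideanSpace ℝ (Fin m × Fin n)

/-- The matrix `a bᵀ`. -/
def outer {m n : ℕ} (a : Vec m) (b : Vec n) : Mat m n :=
  WithLp.toLp 2 (fun ij => a ij.1 * b ij.2)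

/-! ### The Young functions `Φ_β` and the Luxemburg norm -/

/-- `Ψ_β(x) = exp(x^β) - 1`. -/
def psi (β x : ℝ) : ℝ := Real.exp (x ^ β) - 1

/-- The inflection point `x_β` of `Ψ_β` if `β < 1`, and `0` if `β ≥ 1`. -/
def xcrit (β : ℝ) : ℝ := if β < 1 then ((1 - β) / β) ^ (1 / β) else 0

/-- `E_β`: the function `Ψ_β`, replaced on `[0, x_β)` by its tangent at `x_β`. -/
def expE (β x : ℝ) : ℝ :=
  if xcrit β ≤ x then psi β x
  else psi β (xcrit β) + deriv (psi β) (xcrit β) * (x - xcrit β)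

/-- `Φ_β(x) = E_β(x) - E_β(0)`, used for `x ≥ 0` only. -/
def Phi (β x : ℝ) : ℝ := expE β x - expE β 0

section Spaces

variable {V : Type*} [NormedAddCommGroup V] [NormedSpace ℝ V]

/-- The Luxemburg norm of `f` in the exponential Orlicz space of exponent `β` on `D`
(infinite if `f` does not belong to this space). -/
def luxNorm (β : ℝ) (D : Set ℝ) (f : ℝ → V) : ℝ≥0∞ :=
  ⨅ (l : ℝ) (_ : 0 < l) (_ : ∫⁻ r in D, ENNReal.ofReal (Phi β (‖f r‖ / l)) ≤ 1),
    ENNReal.ofReal l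

/-- The increments `(δf)_{s,t} = f_t - f_s`. -/
def del (f : ℝ → V) : ℝ → ℝ → V := fun s t => f t - f s

/-- `(δΞ)_{s,u,t} = Ξ_{s,t} - Ξ_{s,u} - Ξ_{u,t}`. -/
def del2 (Ξ : ℝ → ℝ → V) : ℝ → ℝ → ℝ → V := fun s u t => Ξ s t - Ξ s u - Ξ u t

/-- The Orlicz modulus of continuity of a two-parameter map. -/
def modulus2 (β T : ℝ) (Ξ : ℝ → ℝ → V) (τ : ℝ) : ℝ≥0∞ :=
  ⨆ h ∈ Icc (0 : ℝ) τ, luxNorm β (Icc 0 (T - h)) (fun r => Ξ r (r + h))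

/-- The Orlicz modulus of continuity of a three-parameter map. -/
def modulus3 (β T : ℝ) (Ξ : ℝ → ℝ → ℝ → V) (τ : ℝ) : ℝ≥0∞ :=
  ⨆ θ ∈ Icc (0 : ℝ) 1, ⨆ h ∈ Icc (0 : ℝ) τ,
    luxNorm β (Icc 0 (T - h)) (fun r => Ξ r (r + θ * h) (r + h))

/-- The measure `dτ / τ` on `(0, T]`. -/
def scaleMeasure (T : ℝ) : Measure ℝ :=
  (volume.restrict (Ioc 0 T)).withDensity (fun τ => ENNReal.ofReal τ⁻¹)

/-- The `L^q([0, T], dτ/τ)` (quasi)norm of `τ ↦ ω(τ) / τ^α`. -/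
def scaleNorm (α : ℝ) (q : ℝ≥0∞) (T : ℝ) (ω : ℝ → ℝ≥0∞) : ℝ≥0∞ :=
  eLpNorm (fun τ => ω τ / ENNReal.ofReal (τ ^ α)) q (scaleMeasure T)

/-- The (quasi)norm of the two-parameter Besov–Orlicz-type space. -/
def boNorm2 (α β : ℝ) (q : ℝ≥0∞) (T : ℝ) (Ξ : ℝ → ℝ → V) : ℝ≥0∞ :=
  scaleNorm α q T (modulus2 β T Ξ)

/-- The (quasi)norm of the three-parameter Besov–Orlicz-type space. -/
def boNorm3 (α β : ℝ) (q : ℝ≥0∞) (T : ℝ) (Ξ : ℝ → ℝ → ℝ → V) : ℝ≥0∞ :=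
  scaleNorm α q T (modulus3 β T Ξ)

/-- The (quasi)seminorm of the univariate Besov–Orlicz space. -/
def boSemi (α β : ℝ) (q : ℝ≥0∞) (T : ℝ) (f : ℝ → V) : ℝ≥0∞ :=
  boNorm2 α β q T (del f)

/-- The simplex `{(s, t) : 0 ≤ s ≤ t ≤ T}`. -/
def simplex2 (T : ℝ) : Set (ℝ × ℝ) := {x | 0 ≤ x.1 ∧ x.1 ≤ x.2 ∧ x.2 ≤ T}

/-- Membership in the two-parameter Besov–Orlicz-type space: Lebesgue measurability on the
simplex and on its sections `t - s = h` (which the norm integrates over), and finite norm. -/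
structure MemBO2 (α β : ℝ) (q : ℝ≥0∞) (T : ℝ) (Ξ : ℝ → ℝ → V) : Prop where
  meas : AEStronglyMeasurable (fun x : ℝ × ℝ => Ξ x.1 x.2) (volume.restrict (simplex2 T))
  meas_section : ∀ h ∈ Icc (0 : ℝ) T,
    AEStronglyMeasurable (fun r => Ξ r (r + h)) (volume.restrict (Icc 0 (T - h)))
  norm_lt_top : boNorm2 α β q T Ξ < ⊤

/-- Membership in the univariate Besov–Orlicz space on `[0, T]`. An element of that space is
identified with its unique continuous representative. -/
structure MemBO (α β : ℝ) (q : ℝ≥0∞) (T : ℝ) (f : ℝ → V) : Prop where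
  cont : ContinuousOn f (Icc 0 T)
  orlicz : luxNorm β (Icc 0 T) f < ⊤
  semi_lt_top : boSemi α β q T f < ⊤

/-! ### Rough paths and controlled paths -/

/-- `(X, 𝕏)` is an exponential Besov–Orlicz rough path over `ℝⁿ` on `[0, T]`. -/
structure IsRoughPath {n : ℕ} (α β : ℝ) (q : ℝ≥0∞) (T : ℝ) (X : ℝ → Vec n)
    (XX : ℝ → ℝ → Mat n n) : Prop where
  mem_fst : MemBO α β q T X
  mem_snd : MemBO2 (2 * α) (β / 2) (q / 2) T XX
  chen : ∀ s u t : ℝ, 0 ≤ s → s ≤ u → u ≤ t → t ≤ T →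
    XX s t - XX s u - XX u t = outer (del X s u) (del X u t)

/-- The rough path norm `[X] + ‖𝕏‖^{1/2}`. -/
def roughNorm {n : ℕ} (α β : ℝ) (q : ℝ≥0∞) (T : ℝ) (X : ℝ → Vec n)
    (XX : ℝ → ℝ → Mat n n) : ℝ≥0∞ :=
  boSemi α β q T X + boNorm2 (2 * α) (β / 2) (q / 2) T XX ^ (1 / 2 : ℝ)

/-- The remainder `R^Y_{s,t} = δY_{s,t} - Y'_s δX_{s,t}`. -/
def remainder {n : ℕ} (X : ℝ → Vec n) (Y : ℝ → V) (Y' : ℝ → Vec n →L[ℝ] V) : ℝ → ℝ → V :=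
  fun s t => del Y s t - Y' s (del X s t)

/-- `(Y, Y')` is a path controlled by `X`. -/
structure IsControlled {n : ℕ} (α β : ℝ) (q : ℝ≥0∞) (T : ℝ) (X : ℝ → Vec n) (Y : ℝ → V)
    (Y' : ℝ → Vec n →L[ℝ] V) : Prop where
  mem_path : MemBO α β q T Y
  mem_deriv : MemBO α β q T Y'
  mem_remainder : MemBO2 (2 * α) (β / 2) (q / 2) T (remainder X Y Y')

/-- The (quasi)seminorm `[Y'] + ‖R^Y‖` of a controlled path. -/
def controlledSemi {n : ℕ} (α β : ℝ) (q : ℝ≥0∞) (T : ℝ) (X : ℝ → Vec n) (Y : ℝ → V)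
    (Y' : ℝ → Vec n →L[ℝ] V) : ℝ≥0∞ :=
  boSemi α β q T Y' + boNorm2 (2 * α) (β / 2) (q / 2) T (remainder X Y Y')

end Spaces

/-! ### The rough integral -/

/-- A matrix as a linear operator `ℝⁿ → ℝᵐ`. -/
def matOp {m n : ℕ} (A : Mat m n) : Vec n →L[ℝ] Vec m :=
  LinearMap.toContinuousLinearMap (Matrix.toEuclideanLin (Matrix.of fun i j => A (i, j)))

/-- The action of `A ∈ L(ℝⁿ; ℝ^{m × n})` on `ℝ^{n × n}`, that is, the linear map
`ℝ^{n × n} → ℝᵐ` with `a bᵀ ↦ (A a) b`. -/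
def tensorAct {m n : ℕ} (A : Vec n →L[ℝ] Mat m n) (M : Mat n n) : Vec m :=
  WithLp.toLp 2 (fun i => ∑ k, ∑ j, A (EuclideanSpace.single k 1) (i, j) * M (k, j))

/-- The local approximation `Ξ_{s,t} = Y_s δX_{s,t} + Y'_s 𝕏_{s,t}`. -/
def roughXi {m n : ℕ} (X : ℝ → Vec n) (XX : ℝ → ℝ → Mat n n) (Y : ℝ → Mat m n)
    (Y' : ℝ → Vec n →L[ℝ] Mat m n) : ℝ → ℝ → Vec m :=
  fun s t => matOp (Y s) (del X s t) + tensorAct (Y' s) (XX s t)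

/-- `I` is the sewing of `Ξ` started from zero: the continuous path on `[0, T]` with `I_0 = 0`
such that `δI - Ξ` has regularity `(3α, β/3, q/3)`. -/
structure IsRoughIntegral {m n : ℕ} (α β : ℝ) (q : ℝ≥0∞) (T : ℝ) (X : ℝ → Vec n)
    (XX : ℝ → ℝ → Mat n n) (Y : ℝ → Mat m n) (Y' : ℝ → Vec n →L[ℝ] Mat m n)
    (I : ℝ → Vec m) : Prop where
  cont : ContinuousOn I (Icc 0 T)
  zero : I 0 = 0
  sewing : MemBO2 (3 * α) (β / 3) (q / 3) T (del I - roughXi X XX Y Y')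

/-- A partition `0 = t_0 < ⋯ < t_N = 1` of `[0, 1]`. -/
structure UnitPartition where
  N : ℕ
  pt : Fin (N + 1) → ℝ
  pt_zero : pt 0 = 0
  pt_last : pt (Fin.last N) = 1
  strictMono : StrictMono pt

/-- The norm `max (t_{i+1} - t_i)` of a partition. -/
def UnitPartition.mesh (π : UnitPartition) : ℝ :=
  ⨆ i : Fin π.N, (π.pt i.succ - π.pt i.castSucc)

/-- The partial sum of `Ξ` over the partition of `[s, t]` obtained by rescaling `π`. -/
def UnitPartition.partialSum {V : Type*} [AddCommGroup V] (π : UnitPartition)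
    (Ξ : ℝ → ℝ → V) : ℝ → ℝ → V :=
  fun s t => ∑ i : Fin π.N,
    Ξ (s + π.pt i.castSucc * (t - s)) (s + π.pt i.succ * (t - s))

end

end BesovOrlicz

open BesovOrlicz

namespace BesovOrlicz

noncomputable section

/-! ### The Young functions in logarithmic scale -/

/-! The theorem is a sewing lemma in which uniform norms are replaced by Luxemburg norms of the
sections `r ↦ Ξ_{r,r+h}`. Chen's relation and the definition of the remainder give `δΞ_{s,u,t} =
-R^Y_{s,u} δX_{u,t} - δY'_{s,u} 𝕏_{u,t}` (`del2_roughXi`). Each product joins a factor of regularity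
`2α` to one of regularity `α`, so the defect has order `3α > 1`, and summing `2 ^ j` defects at
scale `h / 2 ^ j` converges.

Hölder's inequality for the Young functions (`luxNorm_mul_le`) turns exponents `β / 2` and `β` into
`β / 3`. Its constant is `2` for all exponents, because after the substitution `t = x ^ b` the
functions `Φ_b` are ordered in `b` (`youngLog_anti`). Hence `C₂` depends neither on `α` nor on `β`.

Point values of `Ξ` are not controlled by the norms, so the sewing is constructed as the limit of
`ε⁻¹ ∫₀ᵗ Ξ_{r,r+ε} dr` along dyadic `ε` (`exists_sewing_limit`). Its increments are limits of short
window averages of dyadic sums; Jensen's inequality and Fatou's lemma transfer the bounds on dyadic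
sums to it at dyadic scales (`secNorm_sewing_dyadic`), and a greedy dyadic expansion of `h` gives
all scales (`exists_sewing`). Once superlinear decay of `δI - Ξ` is known, this error is bounded by
the dyadic series of defects (`secNorm_le_tsum`). Dilation invariance of `dτ/τ` then sums the series
in the scale norm, also for exponents below one (`exists_boNorm2_del_sub_le`). A path with
superlinear increments is constant, which gives uniqueness and with it linearity.

Hölder's inequality alone places the error only in `Φ_{β/3}`. For the remainder of the integral, in
`Φ_{β/2}`, one factor of each product is bounded uniformly by a Hölder estimate for paths
(`exists_holder_boSemi`); this costs `1 / p` in regularity and produces the power `T ^ (α - 1 / p)`.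
The seminorm of the integral in `Φ_β` follows because the remainder is also bounded, and a bounded
function of exponent `β / 2` has exponent `β`, by `|R| ≤ M ^ (1/2) |R| ^ (1/2)`
(`exists_boSemi_le_of_remainder`).

The error of a partial sum is the partial sum of `δI - Ξ`, since increments telescope. A dilation by
the length `ℓ` of a partition interval contributes `ℓ ^ (3α)`, and sums of powers larger than one of
the lengths vanish with the mesh (`tendsto_boNorm2_partialSum`). -/

/-- `Φ_b` in the scale `t = x ^ b`, with parameter `y = max (1 / b - 1) 0`. -/
def youngLog (y t : ℝ) : ℝ :=
  if y ≤ t then Real.exp t - Real.exp y / (y + 1)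
  else y / (y + 1) * Real.exp y * (t / y) ^ (y + 1)

theorem youngLog_of_le {y t : ℝ} (h : y ≤ t) :
    youngLog y t = Real.exp t - Real.exp y / (y + 1) := if_pos h

theorem youngLog_of_ge {y t : ℝ} (hy : 0 ≤ y) (ht : 0 ≤ t) (h : t ≤ y) :
    youngLog y t = y / (y + 1) * Real.exp y * (t / y) ^ (y + 1) := by
  rcases h.lt_or_eq with h | rfl
  · exact if_neg (not_le.2 h)
  · rw [youngLog_of_le le_rfl]
    rcases hy.lt_or_eq with h0 | rfl
    · rw [div_self h0.ne', Real.one_rpow]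
      field_simp
      ring
    · simp

theorem exp_div_succ_mono {y z : ℝ} (hy : 0 ≤ y) (h : y ≤ z) :
    Real.exp y / (y + 1) ≤ Real.exp z / (z + 1) := by
  rw [div_le_div_iff₀ (by linarith) (by linarith)]
  have h1 : z - y + 1 ≤ Real.exp (z - y) := Real.add_one_le_exp _
  have h2 : Real.exp z = Real.exp y * Real.exp (z - y) := by rw [← Real.exp_add]; ring_nf
  rw [h2, mul_assoc]
  refine mul_le_mul_of_nonneg_left ?_ (Real.exp_pos y).le
  nlinarith

/-- A smaller exponent `b` has a larger parameter. In the common scale `t` the Young function of a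
product therefore lies below those of its factors, and Hölder's inequality gets a constant free of
the exponents. -/
theorem youngLog_anti {y z t : ℝ} (hy : 0 ≤ y) (h : y ≤ z) (ht : 0 ≤ t) :
    youngLog z t ≤ youngLog y t := by
  -- As a function of the parameter `w`, the logarithm of the power branch has derivative `log (t /
  -- w) - 1 / (w + 1)`, negative for `t ≤ w`. The inequality `log x ≤ x - 1` replaces the
  -- differentiation.
  have low : ∀ y z t : ℝ, 0 ≤ y → y ≤ z → 0 ≤ t → t ≤ y → youngLog z t ≤ youngLog y t := by
    intro y z t hy h ht hty
    rw [youngLog_of_ge hy ht hty, youngLog_of_ge (hy.trans h) ht (hty.trans h)]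
    rcases ht.lt_or_eq with ht | rfl
    swap
    · simp [Real.zero_rpow (by linarith : y + 1 ≠ 0), Real.zero_rpow (by linarith : z + 1 ≠ 0)]
    have hy0 : 0 < y := ht.trans_le hty
    have hz0 : 0 < z := hy0.trans_le h
    have key : ∀ w : ℝ, 0 < w → w / (w + 1) * Real.exp w * (t / w) ^ (w + 1) =
        Real.exp (-Real.log (w + 1) + w + (w + 1) * Real.log t - w * Real.log w) := by
      intro w hw
      have : -Real.log (w + 1) + w + (w + 1) * Real.log t - w * Real.log w =
        Real.log (w / (w + 1)) + w + Real.log (t / w) * (w + 1) := by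
        rw [Real.log_div hw.ne' (by linarith), Real.log_div ht.ne' hw.ne']; ring
      rw [this, Real.exp_add, Real.exp_add, Real.exp_log (by positivity),
        Real.rpow_def_of_pos (by positivity)]
    rw [key y hy0, key z hz0, Real.exp_le_exp]
    have h1 : Real.log (y + 1) ≤ Real.log (z + 1) := Real.log_le_log (by linarith) (by linarith)
    have h2 : Real.log t ≤ Real.log y := Real.log_le_log ht hty
    have h3 : Real.log (y / z) ≤ y / z - 1 := Real.log_le_sub_one_of_pos (by positivity)
    rw [Real.log_div hy0.ne' hz0.ne'] at h3
    have h4 : z * (Real.log y - Real.log z) ≤ y - z := by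
      calc _ ≤ z * (y / z - 1) := mul_le_mul_of_nonneg_left h3 hz0.le
        _ = y - z := by field_simp
    nlinarith [mul_le_mul_of_nonneg_left h2 (sub_nonneg.2 h)]
  have high : ∀ y z t : ℝ, 0 ≤ y → y ≤ z → z ≤ t → youngLog z t ≤ youngLog y t := by
    intro y z t hy h ht
    rw [youngLog_of_le ht, youngLog_of_le (h.trans ht)]
    linarith [exp_div_succ_mono hy h]
  rcases le_total t y with h1 | h1
  · exact low y z t hy h ht h1
  rcases le_total z t with h2 | h2
  · exact high y z t hy h h2
  -- The parameter `t` itself sits at the junction of the two branches and links the two cases.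
  · exact (low t z t ht h2 ht le_rfl).trans (high y t t hy h1 le_rfl)

theorem xcrit_pos {b : ℝ} (hb : 0 < b) (h : b < 1) : 0 < xcrit b := by
  have : 0 < (1 - b) / b := div_pos (by linarith) hb
  rw [xcrit, if_pos h]
  positivity

/-- In the scale `t = x ^ b` the point of tangency becomes the parameter of `youngLog`. The maximum
covers `b ≥ 1`, where there is no tangent part. -/
theorem xcrit_rpow {b : ℝ} (hb : 0 < b) : xcrit b ^ b = max (1 / b - 1) 0 := by
  unfold xcrit
  split_ifs with h
  · have : 0 ≤ (1 - b) / b := div_nonneg (by linarith) hb.le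
    rw [← Real.rpow_mul this, one_div_mul_cancel hb.ne', Real.rpow_one, max_eq_left]
    · field_simp
    · rw [sub_nonneg, le_div_iff₀ hb]; linarith
  · rw [Real.zero_rpow hb.ne', max_eq_right]
    rw [sub_nonpos, div_le_iff₀ hb]; linarith

theorem hasDerivAt_psi {b x : ℝ} (hx : 0 < x) :
    HasDerivAt (psi b) (Real.exp (x ^ b) * (b * x ^ (b - 1))) x :=
  ((Real.hasDerivAt_rpow_const (Or.inl hx.ne')).exp).sub_const 1

theorem psi_zero {b : ℝ} (hb : 0 < b) : psi b 0 = 0 := by simp [psi, Real.zero_rpow hb.ne']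

theorem Phi_eq_psi {b : ℝ} (hb : 0 < b) (h : 1 ≤ b) {x : ℝ} (hx : 0 ≤ x) : Phi b x = psi b x := by
  have h0 : xcrit b = 0 := by simp [xcrit, not_lt.2 h]
  simp [Phi, expE, h0, hx, psi_zero hb]

theorem Phi_of_lt {b : ℝ} (hb : 0 < b) (h : b < 1) {x : ℝ} (hx : x < xcrit b) :
    Phi b x = deriv (psi b) (xcrit b) * x := by
  have h0 := xcrit_pos hb h
  rw [Phi, expE, expE, if_neg (not_le.2 hx), if_neg (not_le.2 h0)]
  ring

theorem Phi_of_ge {b : ℝ} (hb : 0 < b) (h : b < 1) {x : ℝ} (hx : xcrit b ≤ x) :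
    Phi b x = psi b x - psi b (xcrit b) + deriv (psi b) (xcrit b) * xcrit b := by
  have h0 := xcrit_pos hb h
  rw [Phi, expE, expE, if_pos hx, if_neg (not_le.2 h0)]
  ring

theorem deriv_psi_mul_xcrit {b : ℝ} (hb : 0 < b) (h : b < 1) :
    deriv (psi b) (xcrit b) * xcrit b = (1 - b) * Real.exp (1 / b - 1) := by
  have h0 := xcrit_pos hb h
  have h1 : xcrit b ^ b = 1 / b - 1 := by
    rw [xcrit_rpow hb, max_eq_left]
    rw [sub_nonneg, le_div_iff₀ hb]; linarith
  rw [(hasDerivAt_psi h0).deriv, h1]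
  have h2 : xcrit b ^ (b - 1) * xcrit b = 1 / b - 1 := by
    rw [← h1, Real.rpow_sub_one h0.ne', div_mul_cancel₀ _ h0.ne']
  calc _ = Real.exp (1 / b - 1) * b * (xcrit b ^ (b - 1) * xcrit b) := by ring
    _ = _ := by rw [h2]; field_simp

/-- A linear function of `x` is a multiple of `t ^ (1 / b) = t ^ (y + 1)`, which explains the power
branch. On the exponential branch only the additive constant has to be identified. -/
theorem Phi_eq_youngLog {b : ℝ} (hb : 0 < b) {x : ℝ} (hx : 0 ≤ x) :
    Phi b x = youngLog (max (1 / b - 1) 0) (x ^ b) := by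
  rcases lt_or_ge b 1 with h | h
  · have h0 := xcrit_pos hb h
    have hc := xcrit_rpow hb
    have hy : 0 < 1 / b - 1 := by
      rw [sub_pos, lt_div_iff₀ hb]; linarith
    rw [max_eq_left hy.le] at hc ⊢
    rcases lt_or_ge x (xcrit b) with h1 | h1
    · rw [Phi_of_lt hb h h1, youngLog_of_ge hy.le (by positivity)
        (by rw [← hc]; exact Real.rpow_le_rpow hx h1.le hb.le)]
      have h2 : x ^ b / (1 / b - 1) = (x / xcrit b) ^ b := by
        rw [Real.div_rpow hx h0.le, hc]
      rw [h2, ← Real.rpow_mul (by positivity)]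
      have h3 : b * (1 / b - 1 + 1) = 1 := by field_simp; ring
      rw [h3, Real.rpow_one]
      have h4 := deriv_psi_mul_xcrit hb h
      have h5 : (1 / b - 1) / (1 / b - 1 + 1) = 1 - b := by field_simp; ring
      rw [h5, ← h4]
      field_simp
    · rw [Phi_of_ge hb h h1, youngLog_of_le
        (by rw [← hc]; exact Real.rpow_le_rpow h0.le h1 hb.le), deriv_psi_mul_xcrit hb h, psi, psi, hc]
      have h5 : Real.exp (1 / b - 1) / (1 / b - 1 + 1) = b * Real.exp (1 / b - 1) := by
        field_simp; ring
      rw [h5]; ring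
  · have h1 : (1 : ℝ) / b - 1 ≤ 0 := by rw [sub_nonpos, div_le_iff₀ hb]; linarith
    rw [Phi_eq_psi hb h hx, max_eq_right h1, youngLog_of_le (by positivity), psi]
    simp

/-! ### Convexity and monotonicity -/

theorem psi_continuous {b : ℝ} (hb : 0 < b) : Continuous (psi b) :=
  (Real.continuous_exp.comp (Real.continuous_rpow_const hb.le)).sub continuous_const

/-- With `u = w ^ b` the derivative is `b * exp (u - (1 / b - 1) * log u)`, and `u - y * log u`
increases for `u ≥ y`. -/
theorem convexOn_psi_Ici_xcrit {b : ℝ} (hb : 0 < b) (h : b < 1) :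
    ConvexOn ℝ (Ici (xcrit b)) (psi b) := by
  have h0 := xcrit_pos hb h
  refine MonotoneOn.convexOn_of_deriv (convex_Ici _) (psi_continuous hb).continuousOn ?_ ?_
  · rw [interior_Ici]
    exact fun x hx => (hasDerivAt_psi (h0.trans hx)).differentiableAt.differentiableWithinAt
  · rw [interior_Ici]
    intro u hu v hv huv
    have hu0 : 0 < u := h0.trans hu
    have hv0 : 0 < v := h0.trans hv
    rw [(hasDerivAt_psi hu0).deriv, (hasDerivAt_psi hv0).deriv]
    have key : ∀ w : ℝ, 0 < w → Real.exp (w ^ b) * (b * w ^ (b - 1)) =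
        b * Real.exp (w ^ b - (1 / b - 1) * Real.log (w ^ b)) := by
      intro w hw
      rw [Real.log_rpow hw, Real.rpow_def_of_pos hw (b - 1), mul_left_comm, ← Real.exp_add]
      congr 2
      field_simp
      ring
    rw [key u hu0, key v hv0]
    refine mul_le_mul_of_nonneg_left (Real.exp_le_exp.2 ?_) hb.le
    have hy : 0 < 1 / b - 1 := by
      rw [sub_pos, lt_div_iff₀ hb]; linarith
    have hc := xcrit_rpow hb
    rw [max_eq_left hy.le] at hc
    have hu1 : 1 / b - 1 ≤ u ^ b := by
      rw [← hc]; exact Real.rpow_le_rpow h0.le (le_of_lt hu) hb.le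
    have huv1 : u ^ b ≤ v ^ b := Real.rpow_le_rpow hu0.le huv hb.le
    have hub : 0 < u ^ b := Real.rpow_pos_of_pos hu0 b
    have hvb : 0 < v ^ b := Real.rpow_pos_of_pos hv0 b
    have hl : Real.log (v ^ b / u ^ b) ≤ v ^ b / u ^ b - 1 :=
      Real.log_le_sub_one_of_pos (by positivity)
    rw [Real.log_div hvb.ne' hub.ne'] at hl
    have h3 : u ^ b * (Real.log (v ^ b) - Real.log (u ^ b)) ≤ v ^ b - u ^ b := by
      calc _ ≤ u ^ b * (v ^ b / u ^ b - 1) := mul_le_mul_of_nonneg_left hl hub.le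
        _ = _ := by field_simp
    have h4 : 0 ≤ Real.log (v ^ b) - Real.log (u ^ b) :=
      sub_nonneg.2 (Real.log_le_log hub huv1)
    nlinarith [mul_le_mul_of_nonneg_right hu1 h4]

theorem Phi_zero {b : ℝ} : Phi b 0 = 0 := by simp [Phi]

theorem deriv_psi_xcrit_pos {b : ℝ} (hb : 0 < b) (h : b < 1) : 0 < deriv (psi b) (xcrit b) := by
  have h0 := xcrit_pos hb h
  rw [(hasDerivAt_psi h0).deriv]
  positivity

theorem Phi_eq_tangent_add {b : ℝ} (hb : 0 < b) (h : b < 1) (x : ℝ) :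
    Phi b x = deriv (psi b) (xcrit b) * x + (psi b (max (xcrit b) x) - psi b (xcrit b) -
      deriv (psi b) (xcrit b) * (max (xcrit b) x - xcrit b)) := by
  rcases lt_or_ge x (xcrit b) with h1 | h1
  · rw [Phi_of_lt hb h h1, max_eq_left h1.le]; ring
  · rw [Phi_of_ge hb h h1, max_eq_right h1]; ring

theorem psi_tangent_le {b : ℝ} (hb : 0 < b) (h : b < 1) {x : ℝ} (hx : xcrit b ≤ x) :
    0 ≤ psi b x - psi b (xcrit b) - deriv (psi b) (xcrit b) * (x - xcrit b) := by
  have h0 := xcrit_pos hb h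
  rcases hx.lt_or_eq with h1 | rfl
  · have := (convexOn_psi_Ici_xcrit hb h).le_slope_of_hasDerivAt (mem_Ici.2 le_rfl)
      (mem_Ici.2 hx) h1 (hasDerivAt_psi h0)
    rw [← (hasDerivAt_psi h0).deriv, slope_def_field, le_div_iff₀ (by linarith)] at this
    linarith
  · simp

theorem convexOn_affine {s : Set ℝ} (hs : Convex ℝ s) (d e : ℝ) :
    ConvexOn ℝ s (fun x => d * x + e) :=
  ⟨hs, fun x _ y _ a b _ _ hab => le_of_eq (by
    simp only [smul_eq_mul]; linear_combination (-e) * hab)⟩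

/-- For `b < 1` the function is its tangent line plus `H (max c x)`, where `H` is the excess of
`psi` over the tangent. Since `H` is convex and increases from `0` on `[c, ∞)`, composing it with
the convex maximum avoids gluing two convex pieces. -/
theorem convexOn_Phi {b : ℝ} (hb : 0 < b) : ConvexOn ℝ (Ici 0) (Phi b) := by
  rcases lt_or_ge b 1 with h | h
  · set d := deriv (psi b) (xcrit b) with hd
    set c := xcrit b with hc
    let H : ℝ → ℝ := fun x => psi b x - psi b c - d * (x - c)
    have hH : ConvexOn ℝ (Ici c) H := by
      have h1 : ConvexOn ℝ (Ici c) (fun x => -d * x + (d * c - psi b c)) :=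
        convexOn_affine (convex_Ici c) _ _
      refine ((convexOn_psi_Ici_xcrit hb h).add h1).congr fun x _ => ?_
      simp only [H, Pi.add_apply]; ring
    have hHm : MonotoneOn H (Ici c) := by
      intro u hu v hv huv
      have hc0 : H c = 0 := by simp [H]
      have : H u ≤ max (H c) (H v) := hH.le_max_of_mem_Icc (mem_Ici.2 le_rfl) hv ⟨hu, huv⟩
      rwa [hc0, max_eq_right (psi_tangent_le hb h hv)] at this
    have hmax : ConvexOn ℝ (univ : Set ℝ) (fun x : ℝ => max c x) :=
      (convexOn_const c convex_univ).sup (convexOn_id convex_univ)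
    have himg : (fun x : ℝ => max c x) '' univ = Ici c := by
      ext x
      simp only [image_univ, mem_range, mem_Ici]
      exact ⟨fun ⟨y, hy⟩ => hy ▸ le_max_left _ _, fun hx => ⟨x, max_eq_right hx⟩⟩
    have hcomp := ConvexOn.comp (g := H) (f := fun x : ℝ => max c x) (s := univ)
      (by rw [himg]; exact hH) hmax (by rw [himg]; exact hHm)
    have hlin : ConvexOn ℝ (Ici (0 : ℝ)) (fun x => d * x + 0) :=
      convexOn_affine (convex_Ici 0) _ _
    refine (hlin.add (hcomp.subset (subset_univ _) (convex_Ici 0))).congr fun x _ => ?_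
    rw [Phi_eq_tangent_add hb h]
    simp [H, c, d]
  · have h1 : ConvexOn ℝ (Ici (0 : ℝ)) (fun x : ℝ => x ^ b) := convexOn_rpow h
    have h2 : ConvexOn ℝ (Ici (0 : ℝ)) (fun x : ℝ => Real.exp (x ^ b)) := by
      refine ConvexOn.comp (g := Real.exp) (f := fun x : ℝ => x ^ b)
        (convexOn_exp.subset (subset_univ _) ?_) h1 (Real.exp_monotone.monotoneOn _)
      have := (convex_Ici (0 : ℝ)).isPreconnected.image (fun x : ℝ => x ^ b)
        (Real.continuous_rpow_const hb.le).continuousOn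
      exact this.ordConnected.convex
    exact (h2.add_const (-1)).congr fun x hx => by
      rw [Phi_eq_psi hb h hx, psi, sub_eq_add_neg]; rfl

theorem Phi_continuous {b : ℝ} (hb : 0 < b) : ContinuousOn (Phi b) (Ici 0) := by
  rcases lt_or_ge b 1 with h | h
  · have : Phi b = fun x => deriv (psi b) (xcrit b) * x +
        (psi b (max (xcrit b) x) - psi b (xcrit b) -
          deriv (psi b) (xcrit b) * (max (xcrit b) x - xcrit b)) :=
      funext (Phi_eq_tangent_add hb h)
    rw [this]
    have := psi_continuous hb
    fun_prop
  · exact (psi_continuous hb).continuousOn.congr fun x hx => Phi_eq_psi hb h hx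

theorem Phi_nonneg {b : ℝ} (hb : 0 < b) {x : ℝ} (hx : 0 ≤ x) : 0 ≤ Phi b x := by
  rcases lt_or_ge b 1 with h | h
  · rw [Phi_eq_tangent_add hb h]
    have := psi_tangent_le hb h (le_max_left (xcrit b) x)
    have := deriv_psi_xcrit_pos hb h
    positivity
  · rw [Phi_eq_psi hb h hx, psi, sub_nonneg]
    exact Real.one_le_exp (by positivity)

theorem Phi_mono {b : ℝ} (hb : 0 < b) {x y : ℝ} (hx : 0 ≤ x) (hxy : x ≤ y) :
    Phi b x ≤ Phi b y := by
  have := (convexOn_Phi hb).le_max_of_mem_Icc (mem_Ici.2 le_rfl)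
    (mem_Ici.2 (hx.trans hxy)) (z := x) ⟨hx, hxy⟩
  rwa [Phi_zero, max_eq_right (Phi_nonneg hb (hx.trans hxy))] at this

theorem Phi_mul_le {b : ℝ} (hb : 0 < b) {x c : ℝ} (hx : 0 ≤ x) (hc : 0 ≤ c) (hc1 : c ≤ 1) :
    Phi b (c * x) ≤ c * Phi b x := by
  have := (convexOn_Phi hb).2 (mem_Ici.2 hx) (mem_Ici.2 (le_refl (0 : ℝ))) hc
    (sub_nonneg.2 hc1) (by ring)
  simpa [Phi_zero] using this

/-- A Young-type inequality between three exponential Young functions. -/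
theorem Phi_mul_le_max {b b₁ b₂ : ℝ} (h₁ : 0 < b₁) (h₂ : 0 < b₂) (hb : 0 < b)
    (h : 1 / b = 1 / b₁ + 1 / b₂) {x y : ℝ} (hx : 0 ≤ x) (hy : 0 ≤ y) :
    Phi b (x * y) ≤ max (Phi b₁ x) (Phi b₂ y) := by
  have i1 : 0 < 1 / b₁ := by positivity
  have i2 : 0 < 1 / b₂ := by positivity
  set s := max (x ^ b₁) (y ^ b₂) with hs
  have hs0 : 0 ≤ s := le_max_of_le_left (by positivity)
  have hxs : x ≤ s ^ (1 / b₁) := by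
    calc x = (x ^ b₁) ^ (1 / b₁) := by
          rw [← Real.rpow_mul hx, mul_one_div_cancel h₁.ne', Real.rpow_one]
      _ ≤ _ := Real.rpow_le_rpow (by positivity) (le_max_left _ _) i1.le
  have hys : y ≤ s ^ (1 / b₂) := by
    calc y = (y ^ b₂) ^ (1 / b₂) := by
          rw [← Real.rpow_mul hy, mul_one_div_cancel h₂.ne', Real.rpow_one]
      _ ≤ _ := Real.rpow_le_rpow (by positivity) (le_max_right _ _) i2.le
  have hxy : x * y ≤ s ^ (1 / b) := by
    rw [h, Real.rpow_add_of_nonneg hs0 i1.le i2.le]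
    exact mul_le_mul hxs hys hy (by positivity)
  have hP : Phi b (s ^ (1 / b)) = youngLog (max (1 / b - 1) 0) s := by
    rw [Phi_eq_youngLog hb (by positivity), ← Real.rpow_mul hs0, one_div_mul_cancel hb.ne',
      Real.rpow_one]
  have hle := Phi_mono hb (by positivity) hxy
  rw [hP] at hle
  rcases max_choice (x ^ b₁) (y ^ b₂) with hc | hc
  · refine hle.trans ((youngLog_anti (le_max_right _ _)
      (max_le_max (by linarith : 1 / b₁ - 1 ≤ 1 / b - 1) le_rfl) hs0).trans ?_)
    rw [hs, hc, ← Phi_eq_youngLog h₁ hx]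
    exact le_max_left _ _
  · refine hle.trans ((youngLog_anti (le_max_right _ _)
      (max_le_max (by linarith : 1 / b₂ - 1 ≤ 1 / b - 1) le_rfl) hs0).trans ?_)
    rw [hs, hc, ← Phi_eq_youngLog h₂ hy]
    exact le_max_right _ _

/-! ### Comparison with exponentials and powers -/

theorem Phi_le_exp {b : ℝ} (hb : 0 < b) {x : ℝ} (hx : 0 ≤ x) : Phi b x ≤ Real.exp (x ^ b) := by
  rw [Phi_eq_youngLog hb hx]
  refine (youngLog_anti le_rfl (le_max_right _ _) (by positivity)).trans ?_
  rw [youngLog_of_le (by positivity)]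
  simp

theorem exists_exp_le_Phi_add {b : ℝ} (hb : 0 < b) :
    ∃ K : ℝ, 0 ≤ K ∧ ∀ x : ℝ, 0 ≤ x → Real.exp (x ^ b) ≤ Phi b x + K := by
  set y := max (1 / b - 1) 0
  have hy : 0 ≤ y := le_max_right _ _
  refine ⟨Real.exp y, (Real.exp_pos _).le, fun x hx => ?_⟩
  have hP := Phi_nonneg hb hx
  rcases le_total y (x ^ b) with h | h
  · rw [Phi_eq_youngLog hb hx, youngLog_of_le h]
    have : Real.exp y / (y + 1) ≤ Real.exp y := div_le_self (Real.exp_pos _).le (by linarith)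
    linarith
  · linarith [Real.exp_le_exp.2 h]

theorem rpow_le_exp {s : ℝ} (hs : 0 ≤ s) : ∃ C : ℝ, 0 ≤ C ∧ ∀ t : ℝ, 0 ≤ t →
    t ^ s ≤ C * Real.exp t := by
  obtain ⟨k, hk⟩ := exists_nat_ge s
  refine ⟨1 + k.factorial, by positivity, fun t ht => ?_⟩
  have he := Real.one_le_exp ht
  have h1 : t ^ k / k.factorial ≤ Real.exp t := Real.pow_div_factorial_le_exp t ht k
  rw [div_le_iff₀ (by positivity)] at h1
  rcases le_total t 1 with h | h
  · have := Real.rpow_le_one ht h hs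
    nlinarith [Real.exp_pos t, (Nat.cast_nonneg k.factorial : (0 : ℝ) ≤ k.factorial)]
  · have : t ^ s ≤ t ^ k := by
      rw [← Real.rpow_natCast]; exact Real.rpow_le_rpow_of_exponent_le h hk
    nlinarith [Real.exp_pos t]

/-- Gives the embedding into `L^p` for all large `p`. Near zero the Young function is of order `x`
or `x ^ b`, which requires `1 ≤ p` and `b ≤ p`; for `x ≥ 1` the exponential dominates, and the
constant `K` is absorbed because `Φ_b` is bounded below there. -/
theorem exists_rpow_le_Phi {b p : ℝ} (hb : 0 < b) (hp : 1 ≤ p) (hbp : b ≤ p) :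
    ∃ C : ℝ, 0 ≤ C ∧ ∀ x : ℝ, 0 ≤ x → x ^ p ≤ C * Phi b x := by
  obtain ⟨C, hC, h⟩ := rpow_le_exp (s := p / b) (by positivity)
  have hpow : ∀ x : ℝ, 0 ≤ x → x ^ p ≤ C * Real.exp (x ^ b) := fun x hx => by
    have := h (x ^ b) (by positivity)
    rwa [← Real.rpow_mul hx, mul_div_cancel₀ _ hb.ne'] at this
  obtain ⟨K, hK, hexp⟩ := exists_exp_le_Phi_add hb
  have hsmall : ∃ D : ℝ, 0 ≤ D ∧ ∀ x : ℝ, 0 ≤ x → x ≤ 1 → x ^ p ≤ D * Phi b x := by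
    rcases lt_or_ge b 1 with hb1 | hb1
    · have hd := deriv_psi_xcrit_pos hb hb1
      refine ⟨(deriv (psi b) (xcrit b))⁻¹, by positivity, fun x hx hx1 => ?_⟩
      have h1 : x ^ p ≤ x := by
        simpa using Real.rpow_le_rpow_of_exponent_ge_of_imp hx hx1 hp (by intros; linarith)
      rw [inv_mul_eq_div, le_div_iff₀ hd, Phi_eq_tangent_add hb hb1]
      have := psi_tangent_le hb hb1 (le_max_left (xcrit b) x)
      nlinarith
    · refine ⟨1, zero_le_one, fun x hx hx1 => ?_⟩
      rw [Phi_eq_psi hb hb1 hx, one_mul, psi]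
      have h1 : x ^ p ≤ x ^ b :=
        Real.rpow_le_rpow_of_exponent_ge_of_imp hx hx1 hbp (by intros; linarith)
      linarith [Real.add_one_le_exp (x ^ b)]
  obtain ⟨D, hD, hsmall⟩ := hsmall
  refine ⟨D + C * (1 + K * D), by positivity, fun x hx => ?_⟩
  have hP := Phi_nonneg hb hx
  rcases le_total x 1 with h1 | h1
  · have := hsmall x hx h1
    have : 0 ≤ C * (1 + K * D) * Phi b x := by positivity
    nlinarith
  · have h2 : 1 ≤ D * Phi b x := by
      have := hsmall 1 zero_le_one le_rfl
      rw [Real.one_rpow] at this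
      exact this.trans (mul_le_mul_of_nonneg_left (Phi_mono hb zero_le_one h1) hD)
    have h3 := hpow x hx
    have h4 := hexp x hx
    have h5 : Real.exp (x ^ b) ≤ (1 + K * D) * Phi b x := by nlinarith
    have : 0 ≤ D * Phi b x := by positivity
    nlinarith [mul_le_mul_of_nonneg_left h5 hC]

/-! ### The Luxemburg norm -/

section Lux

variable {V W U : Type*} [NormedAddCommGroup V] [NormedAddCommGroup W] [NormedAddCommGroup U]

theorem measurable_Phi (b : ℝ) : Measurable (Phi b) := by
  have hpsi : Measurable (psi b) := by unfold psi; fun_prop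
  have : Measurable (expE b) := by
    refine Measurable.ite measurableSet_Ici hpsi ?_
    fun_prop
  exact this.sub_const _

theorem aemeasurable_Phi_norm {b l : ℝ} {D : Set ℝ} {f : ℝ → V}
    (hf : AEStronglyMeasurable f (volume.restrict D)) :
    AEMeasurable (fun r => ENNReal.ofReal (Phi b (‖f r‖ / l))) (volume.restrict D) :=
  (((measurable_Phi b).comp_aemeasurable (hf.norm.aemeasurable.div_const l))).ennreal_ofReal

theorem luxNorm_le_ofReal {b l : ℝ} {D : Set ℝ} {f : ℝ → V} (hl : 0 < l)
    (h : ∫⁻ r in D, ENNReal.ofReal (Phi b (‖f r‖ / l)) ≤ 1) :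
    luxNorm b D f ≤ ENNReal.ofReal l :=
  iInf_le_of_le l (iInf_le_of_le hl (iInf_le_of_le h le_rfl))

/-- The strict inequality makes it unnecessary to know that the infimum is attained. -/
theorem lintegral_Phi_le_one {b l : ℝ} (hb : 0 < b) {D : Set ℝ} {f : ℝ → V}
    (h : luxNorm b D f < ENNReal.ofReal l) :
    ∫⁻ r in D, ENNReal.ofReal (Phi b (‖f r‖ / l)) ≤ 1 := by
  simp only [luxNorm, iInf_lt_iff] at h
  obtain ⟨l', hl', h1, h2⟩ := h
  have hll : l' ≤ l := ((ENNReal.ofReal_lt_ofReal_iff_of_nonneg hl'.le).1 h2).le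
  refine le_trans (lintegral_mono fun r => ENNReal.ofReal_le_ofReal ?_) h1
  exact Phi_mono hb (div_nonneg (norm_nonneg _) (hl'.le.trans hll)) (by gcongr)

theorem luxNorm_le_of_forall {b : ℝ} {D : Set ℝ} {f : ℝ → V} {L : ℝ≥0∞}
    (h : ∀ l : ℝ, 0 < l → L < ENNReal.ofReal l →
      ∫⁻ r in D, ENNReal.ofReal (Phi b (‖f r‖ / l)) ≤ 1) : luxNorm b D f ≤ L := by
  refine le_of_forall_gt_imp_ge_of_dense fun x hx => ?_
  obtain ⟨l, hl1, hl2⟩ := ENNReal.lt_iff_exists_nnreal_btwn.1 hx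
  have hl0 : 0 < (l : ℝ) := by
    have : (0 : ℝ≥0∞) < l := zero_le.trans_lt hl1
    exact_mod_cast this
  have hl1' : L < ENNReal.ofReal (l : ℝ) := by rwa [ENNReal.ofReal_coe_nnreal]
  have := luxNorm_le_ofReal hl0 (h l hl0 hl1')
  rw [ENNReal.ofReal_coe_nnreal] at this
  exact this.trans hl2.le

theorem luxNorm_mono {b : ℝ} (hb : 0 < b) {D : Set ℝ} {f : ℝ → V} {g : ℝ → W} (c : ℝ≥0)
    (h : ∀ᵐ r ∂(volume.restrict D), ‖g r‖ ≤ c * ‖f r‖) :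
    luxNorm b D g ≤ c * luxNorm b D f := by
  refine luxNorm_le_of_forall fun l hl hlt => ?_
  -- For `c = 0` the right-hand side is `0` even if the norm of `f` is infinite, so `g = 0` almost
  -- everywhere is used directly.
  rcases eq_or_ne c 0 with rfl | hc
  · refine le_trans (le_of_eq ?_) zero_le_one
    rw [lintegral_eq_zero_iff' ?_]
    · filter_upwards [h] with r hr
      have : ‖g r‖ = 0 := le_antisymm (by simpa using hr) (norm_nonneg _)
      simp [this, Phi_zero]
    · refine (aemeasurable_const (b := (0 : ℝ≥0∞))).congr ?_
      filter_upwards [h] with r hr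
      have : ‖g r‖ = 0 := le_antisymm (by simpa using hr) (norm_nonneg _)
      simp [this, Phi_zero]
  have hc0 : (0 : ℝ) < c := by positivity
  have h1 : luxNorm b D f < ENNReal.ofReal (l / c) := by
    rw [ENNReal.ofReal_div_of_pos hc0, ENNReal.ofReal_coe_nnreal,
      ENNReal.lt_div_iff_mul_lt (Or.inl (by simpa using hc)) (Or.inl ENNReal.coe_ne_top), mul_comm]
    exact hlt
  refine le_trans (lintegral_mono_ae ?_) (lintegral_Phi_le_one hb h1)
  filter_upwards [h] with r hr
  refine ENNReal.ofReal_le_ofReal (Phi_mono hb (by positivity) ?_)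
  rw [div_div_eq_mul_div, mul_comm ‖f r‖]
  gcongr

theorem luxNorm_mono_norm {b : ℝ} (hb : 0 < b) {D : Set ℝ} {f : ℝ → V} {g : ℝ → W}
    (h : ∀ᵐ r ∂(volume.restrict D), ‖g r‖ ≤ ‖f r‖) : luxNorm b D g ≤ luxNorm b D f := by
  simpa using luxNorm_mono hb (f := f) (g := g) 1 (by simpa using h)

theorem luxNorm_neg {b : ℝ} {D : Set ℝ} {f : ℝ → V} :
    luxNorm b D (fun r => -f r) = luxNorm b D f := by
  simp [luxNorm]

theorem luxNorm_shift {b : ℝ} {D D' : Set ℝ} (hb : 0 < b) (hD : MeasurableSet D)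
    (hD' : MeasurableSet D') {f : ℝ → V} {c : ℝ} (h : ∀ r ∈ D', r + c ∈ D) :
    luxNorm b D' (fun r => f (r + c)) ≤ luxNorm b D f := by
  refine luxNorm_le_of_forall fun l hl hlt => le_trans ?_ (lintegral_Phi_le_one hb hlt)
  rw [← lintegral_indicator hD', ← lintegral_indicator hD,
    ← lintegral_add_right_eq_self (μ := volume) (D.indicator _) c]
  refine lintegral_mono fun r => ?_
  by_cases hr : r ∈ D'
  · simp [hr, h r hr]
  · simp [hr]

theorem lt_ofReal_toReal_add {x : ℝ≥0∞} (hx : x ≠ ⊤) {ε : ℝ} (hε : 0 < ε) :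
    x < ENNReal.ofReal (x.toReal + ε) := by
  rw [ENNReal.ofReal_add ENNReal.toReal_nonneg hε.le, ENNReal.ofReal_toReal hx]
  exact ENNReal.lt_add_right hx (by simpa using hε)

/-- Convexity of `Φ_b` with weights proportional to two admissible levels. Measurability of one
summand suffices to split the integral. -/
theorem luxNorm_add_le {b : ℝ} (hb : 0 < b) {D : Set ℝ} {f g : ℝ → V}
    (hf : AEStronglyMeasurable f (volume.restrict D)) :
    luxNorm b D (fun r => f r + g r) ≤ luxNorm b D f + luxNorm b D g := by
  refine ENNReal.le_of_forall_pos_le_add fun ε hε hfin => ?_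
  have hF : luxNorm b D f ≠ ⊤ := (ENNReal.add_lt_top.1 hfin).1.ne
  have hG : luxNorm b D g ≠ ⊤ := (ENNReal.add_lt_top.1 hfin).2.ne
  have hε2 : (0 : ℝ) < ε / 2 := by positivity
  set l₁ := (luxNorm b D f).toReal + ε / 2
  set l₂ := (luxNorm b D g).toReal + ε / 2
  have p1 : 0 < l₁ := add_pos_of_nonneg_of_pos ENNReal.toReal_nonneg hε2
  have p2 : 0 < l₂ := add_pos_of_nonneg_of_pos ENNReal.toReal_nonneg hε2
  have i1 := lintegral_Phi_le_one hb (lt_ofReal_toReal_add hF hε2)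
  have i2 := lintegral_Phi_le_one hb (lt_ofReal_toReal_add hG hε2)
  have key : luxNorm b D (fun r => f r + g r) ≤ ENNReal.ofReal (l₁ + l₂) := by
    refine luxNorm_le_ofReal (by positivity) ?_
    have w1 : 0 ≤ l₁ / (l₁ + l₂) := by positivity
    have w2 : 0 ≤ l₂ / (l₁ + l₂) := by positivity
    have w12 : l₁ / (l₁ + l₂) + l₂ / (l₁ + l₂) = 1 := by field_simp
    calc ∫⁻ r in D, ENNReal.ofReal (Phi b (‖f r + g r‖ / (l₁ + l₂)))
        ≤ ∫⁻ r in D, (ENNReal.ofReal (l₁ / (l₁ + l₂)) * ENNReal.ofReal (Phi b (‖f r‖ / l₁)) +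
            ENNReal.ofReal (l₂ / (l₁ + l₂)) * ENNReal.ofReal (Phi b (‖g r‖ / l₂))) := by
          refine lintegral_mono fun r => ?_
          rw [← ENNReal.ofReal_mul w1, ← ENNReal.ofReal_mul w2, ← ENNReal.ofReal_add
            (mul_nonneg w1 (Phi_nonneg hb (by positivity)))
            (mul_nonneg w2 (Phi_nonneg hb (by positivity)))]
          refine ENNReal.ofReal_le_ofReal ?_
          have hc := (convexOn_Phi hb).2 (mem_Ici.2 (show 0 ≤ ‖f r‖ / l₁ by positivity))
            (mem_Ici.2 (show 0 ≤ ‖g r‖ / l₂ by positivity)) w1 w2 w12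
          simp only [smul_eq_mul] at hc
          refine (Phi_mono hb (by positivity) ?_).trans hc
          have : l₁ / (l₁ + l₂) * (‖f r‖ / l₁) + l₂ / (l₁ + l₂) * (‖g r‖ / l₂) =
            (‖f r‖ + ‖g r‖) / (l₁ + l₂) := by field_simp
          rw [this]
          gcongr
          exact norm_add_le _ _
      _ = ENNReal.ofReal (l₁ / (l₁ + l₂)) * (∫⁻ r in D, ENNReal.ofReal (Phi b (‖f r‖ / l₁))) +
            ENNReal.ofReal (l₂ / (l₁ + l₂)) * ∫⁻ r in D, ENNReal.ofReal (Phi b (‖g r‖ / l₂)) := by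
          rw [lintegral_add_left' ((aemeasurable_Phi_norm hf).const_mul _),
            lintegral_const_mul' _ _ ENNReal.ofReal_ne_top,
            lintegral_const_mul' _ _ ENNReal.ofReal_ne_top]
      _ ≤ ENNReal.ofReal (l₁ / (l₁ + l₂)) * 1 + ENNReal.ofReal (l₂ / (l₁ + l₂)) * 1 := by
          gcongr
      _ = 1 := by
          rw [mul_one, mul_one, ← ENNReal.ofReal_add w1 w2, w12, ENNReal.ofReal_one]
  refine key.trans (le_of_eq ?_)
  have : l₁ + l₂ = (luxNorm b D f).toReal + (luxNorm b D g).toReal + ε := by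
    simp only [l₁, l₂]; ring
  rw [this, ENNReal.ofReal_add (by positivity) (by positivity),
    ENNReal.ofReal_add ENNReal.toReal_nonneg ENNReal.toReal_nonneg, ENNReal.ofReal_toReal hF,
    ENNReal.ofReal_toReal hG, ENNReal.ofReal_coe_nnreal]

theorem luxNorm_sub_le {b : ℝ} (hb : 0 < b) {D : Set ℝ} {f g : ℝ → V}
    (hf : AEStronglyMeasurable f (volume.restrict D)) :
    luxNorm b D (fun r => f r - g r) ≤ luxNorm b D f + luxNorm b D g := by
  have := luxNorm_add_le hb (g := fun r => -g r) hf
  rw [luxNorm_neg] at this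
  simpa [sub_eq_add_neg] using this

theorem luxNorm_zero {b : ℝ} (hb : 0 < b) {D : Set ℝ} :
    luxNorm b D (fun _ => (0 : V)) = 0 := by
  have := luxNorm_mono hb (D := D) (f := fun _ => (0 : V)) (g := fun _ => (0 : V)) 0 (by simp)
  simpa using this

theorem luxNorm_sum_le {b : ℝ} (hb : 0 < b) {D : Set ℝ} {ι : Type*} (s : Finset ι)
    {f : ι → ℝ → V} (hf : ∀ i ∈ s, AEStronglyMeasurable (f i) (volume.restrict D)) :
    luxNorm b D (fun r => ∑ i ∈ s, f i r) ≤ ∑ i ∈ s, luxNorm b D (f i) := by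
  classical
  induction s using Finset.induction_on with
  | empty => simp [luxNorm_zero hb]
  | insert i s hi ih =>
    simp only [Finset.sum_insert hi]
    exact (luxNorm_add_le hb (hf i (Finset.mem_insert_self _ _))).trans
      (add_le_add_right (ih fun j hj => hf j (Finset.mem_insert_of_mem hj)) _)

/-- Hölder's inequality for exponential Orlicz spaces; the constant does not depend on the
exponents. -/
theorem luxNorm_mul_le {b b₁ b₂ : ℝ} (h₁ : 0 < b₁) (h₂ : 0 < b₂) (hb : 0 < b)
    (h : 1 / b = 1 / b₁ + 1 / b₂) {D : Set ℝ} {f : ℝ → V} {g : ℝ → W} {k : ℝ → U} (c : ℝ≥0)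
    (hf : AEStronglyMeasurable f (volume.restrict D))
    (hF : luxNorm b₁ D f ≠ ⊤) (hG : luxNorm b₂ D g ≠ ⊤)
    (hk : ∀ᵐ r ∂(volume.restrict D), ‖k r‖ ≤ c * (‖f r‖ * ‖g r‖)) :
    luxNorm b D k ≤ 2 * c * (luxNorm b₁ D f * luxNorm b₂ D g) := by
  have key : ∀ l₁ l₂ : ℝ, 0 < l₁ → 0 < l₂ → luxNorm b₁ D f < ENNReal.ofReal l₁ →
      luxNorm b₂ D g < ENNReal.ofReal l₂ →
      luxNorm b D (fun r => ‖f r‖ * ‖g r‖) ≤ ENNReal.ofReal (2 * (l₁ * l₂)) := by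
    intro l₁ l₂ p1 p2 hl1 hl2
    have i1 := lintegral_Phi_le_one h₁ hl1
    have i2 := lintegral_Phi_le_one h₂ hl2
    refine luxNorm_le_ofReal (by positivity) ?_
    -- The level carries the factor `2` because the maximum in `Phi_mul_le_max` is estimated by a
    -- sum: by convexity `Φ(xy / 2) ≤ (Φ(x) + Φ(y)) / 2`, and each of the two integrals is at most
    -- one.
    calc ∫⁻ r in D, ENNReal.ofReal (Phi b (‖‖f r‖ * ‖g r‖‖ / (2 * (l₁ * l₂))))
        ≤ ∫⁻ r in D, ENNReal.ofReal (1 / 2) * (ENNReal.ofReal (Phi b₁ (‖f r‖ / l₁)) +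
            ENNReal.ofReal (Phi b₂ (‖g r‖ / l₂))) := by
          refine lintegral_mono fun r => ?_
          have n1 := Phi_nonneg h₁ (show 0 ≤ ‖f r‖ / l₁ by positivity)
          have n2 := Phi_nonneg h₂ (show 0 ≤ ‖g r‖ / l₂ by positivity)
          rw [← ENNReal.ofReal_add n1 n2, ← ENNReal.ofReal_mul (by norm_num)]
          refine ENNReal.ofReal_le_ofReal ?_
          have e : ‖‖f r‖ * ‖g r‖‖ / (2 * (l₁ * l₂)) = 1 / 2 * (‖f r‖ / l₁ * (‖g r‖ / l₂)) := by
            rw [Real.norm_of_nonneg (by positivity)]; field_simp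
          rw [e]
          refine (Phi_mul_le hb (by positivity) (by norm_num) (by norm_num)).trans ?_
          gcongr
          refine (Phi_mul_le_max h₁ h₂ hb h (by positivity) (by positivity)).trans ?_
          exact max_le (by linarith) (by linarith)
      _ = ENNReal.ofReal (1 / 2) * ((∫⁻ r in D, ENNReal.ofReal (Phi b₁ (‖f r‖ / l₁))) +
            ∫⁻ r in D, ENNReal.ofReal (Phi b₂ (‖g r‖ / l₂))) := by
          rw [lintegral_const_mul' _ _ ENNReal.ofReal_ne_top,
            lintegral_add_left' (aemeasurable_Phi_norm hf)]
      _ ≤ ENNReal.ofReal (1 / 2) * (1 + 1) := by gcongr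
      _ = 1 := by
          rw [one_add_one_eq_two, ← ENNReal.ofReal_ofNat, ← ENNReal.ofReal_mul (by norm_num)]
          norm_num
  have key2 : luxNorm b D (fun r => ‖f r‖ * ‖g r‖) ≤
      2 * (luxNorm b₁ D f * luxNorm b₂ D g) := by
    set A := (luxNorm b₁ D f).toReal
    set B := (luxNorm b₂ D g).toReal
    have hA : 0 ≤ A := ENNReal.toReal_nonneg
    have hB : 0 ≤ B := ENNReal.toReal_nonneg
    have lim : Tendsto (fun ε : ℝ => ENNReal.ofReal (2 * ((A + ε) * (B + ε)))) (𝓝[>] 0)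
        (𝓝 (ENNReal.ofReal (2 * ((A + 0) * (B + 0))))) := by
      refine ENNReal.tendsto_ofReal (Tendsto.mono_left ?_ nhdsWithin_le_nhds)
      exact (Continuous.tendsto (by fun_prop) 0)
    have hle : luxNorm b D (fun r => ‖f r‖ * ‖g r‖) ≤
        ENNReal.ofReal (2 * ((A + 0) * (B + 0))) := by
      refine ge_of_tendsto lim ?_
      filter_upwards [self_mem_nhdsWithin] with ε hε
      have hε : 0 < ε := hε
      exact key _ _ (by positivity) (by positivity) (lt_ofReal_toReal_add hF hε)
        (lt_ofReal_toReal_add hG hε)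
    rwa [add_zero, add_zero, ENNReal.ofReal_mul (by norm_num), ENNReal.ofReal_mul hA,
      ENNReal.ofReal_toReal hF, ENNReal.ofReal_toReal hG, ENNReal.ofReal_ofNat] at hle
  calc luxNorm b D k ≤ c * luxNorm b D (fun r => ‖f r‖ * ‖g r‖) := by
        refine luxNorm_mono hb c ?_
        filter_upwards [hk] with r hr
        simpa using hr
    _ ≤ c * (2 * (luxNorm b₁ D f * luxNorm b₂ D g)) := by gcongr
    _ = _ := by ring

/-- A bound for the Luxemburg norm of the constant `1` on a set of measure at most `T`. -/
def luxOne (b T : ℝ) : ℝ≥0 := (max 1 (Phi b 1 * T)).toNNReal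

theorem luxNorm_le_of_bound {b T : ℝ} (hb : 0 < b) {D : Set ℝ} {f : ℝ → V} (c : ℝ≥0)
    (hD : volume D ≤ ENNReal.ofReal T) (h : ∀ᵐ r ∂(volume.restrict D), ‖f r‖ ≤ c) :
    luxNorm b D f ≤ c * luxOne b T := by
  have h1 : luxNorm b D (fun _ => (1 : ℝ)) ≤ luxOne b T := by
    have hK : 1 ≤ max 1 (Phi b 1 * T) := le_max_left _ _
    have hK0 : 0 < max 1 (Phi b 1 * T) := by linarith
    refine luxNorm_le_ofReal hK0 ?_
    rw [norm_one, lintegral_const, Measure.restrict_apply_univ]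
    have h2 : Phi b (1 / max 1 (Phi b 1 * T)) ≤ 1 / max 1 (Phi b 1 * T) * Phi b 1 := by
      simpa using Phi_mul_le hb (x := 1) (c := 1 / max 1 (Phi b 1 * T)) zero_le_one
        (by positivity) (by rw [div_le_one hK0]; exact hK)
    have h3 : 0 ≤ Phi b 1 := Phi_nonneg hb zero_le_one
    calc _ ≤ ENNReal.ofReal (1 / max 1 (Phi b 1 * T) * Phi b 1) * ENNReal.ofReal T := by gcongr
      _ = ENNReal.ofReal ((1 / max 1 (Phi b 1 * T)) * (Phi b 1 * T)) := by
          rw [← ENNReal.ofReal_mul (by positivity), mul_assoc]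
      _ ≤ ENNReal.ofReal 1 := by
          refine ENNReal.ofReal_le_ofReal ?_
          rw [one_div, inv_mul_le_iff₀ hK0, mul_one]
          exact le_max_right _ _
      _ = 1 := ENNReal.ofReal_one
  refine (luxNorm_mono hb (f := fun _ => (1 : ℝ)) c (by simpa using h)).trans ?_
  gcongr

/-- The integral over a short window is controlled by the Luxemburg norm. -/
theorem lintegral_window_le {b p C : ℝ} (hb : 0 < b) (hp : 1 ≤ p) (hC0 : 0 ≤ C)
    (hC : ∀ x : ℝ, 0 ≤ x → x ^ p ≤ C * Phi b x) {D S : Set ℝ} (hS : S ⊆ D) {ε : ℝ} (hε : 0 < ε)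
    (hvol : volume S ≤ ENNReal.ofReal ε) (g : ℝ → V) :
    ∫⁻ r in S, ‖g r‖ₑ ≤ ENNReal.ofReal ((1 + C) * ε ^ (1 - 1 / p)) * luxNorm b D g := by
  have hp0 : 0 < p := by linarith
  set E := (1 + C) * ε ^ (1 - 1 / p) with hE
  have hE0 : 0 < E := by positivity
  have key : ∀ l : ℝ, 0 < l → luxNorm b D g < ENNReal.ofReal l →
      ∫⁻ r in S, ‖g r‖ₑ ≤ ENNReal.ofReal E * ENNReal.ofReal l := by
    intro l hl hlt
    -- The threshold balancing the two parts: values below `a` contribute `a * ε`, values above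
    -- contribute at most `a ^ (1 - p) * C`, and both powers equal `ε ^ (1 - 1 / p)`.
    set a := ε ^ (-(1 / p)) with ha
    have ha0 : 0 < a := by positivity
    have hpt : ∀ x : ℝ, 0 ≤ x → x ≤ a + a ^ (1 - p) * (C * Phi b x) := by
      intro x hx
      have hPn := Phi_nonneg hb hx
      rcases le_total x a with h | h
      · have : 0 ≤ a ^ (1 - p) * (C * Phi b x) := by positivity
        linarith
      · have hx0 : 0 < x := ha0.trans_le h
        have h1 : x = x ^ (1 - p) * x ^ p := by
          rw [← Real.rpow_add hx0]; simp
        have h2 : x ^ (1 - p) ≤ a ^ (1 - p) :=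
          Real.rpow_le_rpow_of_nonpos ha0 h (by linarith)
        have h3 : x ^ (1 - p) * x ^ p ≤ a ^ (1 - p) * (C * Phi b x) :=
          mul_le_mul h2 (hC x hx) (by positivity) (by positivity)
        linarith
    have e1 : a ^ (1 - p) = ε ^ (1 - 1 / p) := by
      rw [ha, ← Real.rpow_mul hε.le]; congr 1; field_simp; ring
    have e2 : a * ε = ε ^ (1 - 1 / p) := by
      rw [ha]; nth_rw 2 [← Real.rpow_one ε]
      rw [← Real.rpow_add hε]; congr 1; ring
    calc ∫⁻ r in S, ‖g r‖ₑ
        ≤ ∫⁻ r in S, ENNReal.ofReal l * (ENNReal.ofReal a +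
            ENNReal.ofReal (a ^ (1 - p) * C) * ENNReal.ofReal (Phi b (‖g r‖ / l))) := by
          refine lintegral_mono fun r => ?_
          have hx : 0 ≤ ‖g r‖ / l := by positivity
          have hPn := Phi_nonneg hb hx
          rw [← ENNReal.ofReal_mul (by positivity), ← ENNReal.ofReal_add ha0.le (by positivity),
            ← ENNReal.ofReal_mul hl.le, ← ofReal_norm]
          refine ENNReal.ofReal_le_ofReal ?_
          have := hpt _ hx
          rw [div_le_iff₀ hl] at this
          linarith
      _ = ENNReal.ofReal l * (ENNReal.ofReal a * volume S +
            ENNReal.ofReal (a ^ (1 - p) * C) *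
              ∫⁻ r in S, ENNReal.ofReal (Phi b (‖g r‖ / l))) := by
          rw [lintegral_const_mul' _ _ ENNReal.ofReal_ne_top,
            lintegral_add_left measurable_const, lintegral_const_mul' _ _ ENNReal.ofReal_ne_top,
            lintegral_const, Measure.restrict_apply_univ]
      _ ≤ ENNReal.ofReal l * (ENNReal.ofReal a * ENNReal.ofReal ε +
            ENNReal.ofReal (a ^ (1 - p) * C) * 1) := by
          gcongr
          exact (lintegral_mono_set hS).trans (lintegral_Phi_le_one hb hlt)
      _ = ENNReal.ofReal E * ENNReal.ofReal l := by
          rw [mul_one, ← ENNReal.ofReal_mul ha0.le, e2, e1, ← ENNReal.ofReal_add (by positivity)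
            (by positivity), mul_comm]
          congr 2
          rw [hE]; ring
  rcases eq_or_ne (luxNorm b D g) ⊤ with h | h
  · rw [h, ENNReal.mul_top (by simpa using hE0)]
    exact le_top
  have lim : Tendsto (fun δ : ℝ => ENNReal.ofReal E * ENNReal.ofReal ((luxNorm b D g).toReal + δ))
      (𝓝[>] 0) (𝓝 (ENNReal.ofReal E * ENNReal.ofReal ((luxNorm b D g).toReal + 0))) := by
    refine ENNReal.Tendsto.const_mul (ENNReal.tendsto_ofReal
      (Tendsto.mono_left ?_ nhdsWithin_le_nhds)) (Or.inr ENNReal.ofReal_ne_top)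
    exact (Continuous.tendsto (by fun_prop) 0)
  rw [add_zero, ENNReal.ofReal_toReal h] at lim
  refine ge_of_tendsto lim ?_
  filter_upwards [self_mem_nhdsWithin] with δ hδ
  have hδ : 0 < δ := hδ
  exact key _ (add_pos_of_nonneg_of_pos ENNReal.toReal_nonneg hδ) (lt_ofReal_toReal_add h hδ)

/-- A bounded function of exponent `b / 2` has exponent `b`. -/
theorem exists_luxNorm_le_sqrt {b : ℝ} (hb : 0 < b) (T : ℝ) : ∃ C : ℝ≥0,
    ∀ (D : Set ℝ) (f : ℝ → V) (M : ℝ≥0), volume D ≤ ENNReal.ofReal T →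
      (∀ᵐ r ∂(volume.restrict D), ‖f r‖ ≤ M) →
      luxNorm b D f ≤ C * (M * luxNorm (b / 2) D f) ^ (1 / 2 : ℝ) := by
  have hb2 : 0 < b / 2 := by positivity
  obtain ⟨K, hK, hexp⟩ := exists_exp_le_Phi_add hb2
  set T' := max T 0
  have hT' : 0 ≤ T' := le_max_right _ _
  -- Chosen so that the final modular `C⁻¹ * (K * T' + 1)` equals one.
  set C : ℝ := 1 + K * T' with hCdef
  have hC1 : 1 ≤ C := by have : 0 ≤ K * T' := by positivity
                         linarith
  have hC0 : 0 < C := by linarith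
  refine ⟨⟨C, hC0.le⟩, fun D f M hD hM => ?_⟩
  rcases eq_or_ne M 0 with rfl | hM0
  · have := luxNorm_mono hb (D := D) (f := f) (g := f) 0 (by simpa using hM)
    rw [ENNReal.coe_zero, zero_mul] at this
    exact this.trans zero_le
  have hMp : (0 : ℝ) < M := by positivity
  refine luxNorm_le_of_forall fun l hl hlt => ?_
  -- The level at exponent `b / 2` that satisfies `l = C * √(M * lam)`.
  set lam := (l / C) ^ 2 / M with hlam
  have hlam0 : 0 < lam := by positivity
  have hL : luxNorm (b / 2) D f < ENNReal.ofReal lam := by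
    by_contra hcon
    rw [not_lt] at hcon
    refine absurd hlt (not_lt.2 ?_)
    calc ENNReal.ofReal l = ENNReal.ofReal C * (M * ENNReal.ofReal lam) ^ (1 / 2 : ℝ) := by
          rw [← ENNReal.ofReal_coe_nnreal, ← ENNReal.ofReal_mul hMp.le,
            ENNReal.ofReal_rpow_of_nonneg (by positivity) (by norm_num),
            ← ENNReal.ofReal_mul hC0.le, hlam, mul_div_cancel₀ _ hMp.ne', ← Real.sqrt_eq_rpow,
            Real.sqrt_sq (by positivity), mul_div_cancel₀ _ hC0.ne']
      _ ≤ ENNReal.ofReal C * (M * luxNorm (b / 2) D f) ^ (1 / 2 : ℝ) := by gcongr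
      _ = _ := by
          congr 1
          exact ENNReal.ofReal_eq_coe_nnreal hC0.le
  have hint := lintegral_Phi_le_one hb2 hL
  calc ∫⁻ r in D, ENNReal.ofReal (Phi b (‖f r‖ / l))
      ≤ ∫⁻ r in D, ENNReal.ofReal C⁻¹ * (ENNReal.ofReal K +
          ENNReal.ofReal (Phi (b / 2) (‖f r‖ / lam))) := by
        refine lintegral_mono_ae ?_
        filter_upwards [hM] with r hr
        have hx : 0 ≤ ‖f r‖ / lam := by positivity
        have hPn := Phi_nonneg hb2 hx
        rw [← ENNReal.ofReal_add hK hPn, ← ENNReal.ofReal_mul (by positivity)]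
        refine ENNReal.ofReal_le_ofReal ?_
        -- Boundedness gives `|f| ≤ √M √|f|`, and a square root doubles the exponential exponent:
        -- `Φ_b (√u) ≤ exp (u ^ (b / 2))`.
        have h1 : ‖f r‖ / l ≤ C⁻¹ * Real.sqrt (‖f r‖ / lam) := by
          have hle : ‖f r‖ ≤ Real.sqrt M * Real.sqrt ‖f r‖ := by
            rw [← Real.sqrt_mul hMp.le]
            refine Real.le_sqrt_of_sq_le ?_
            rw [sq]; gcongr
          have hs : Real.sqrt (‖f r‖ / lam) = Real.sqrt M * Real.sqrt ‖f r‖ / (l / C) := by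
            rw [hlam, div_div_eq_mul_div, Real.sqrt_div (by positivity),
              Real.sqrt_sq (by positivity), Real.sqrt_mul (norm_nonneg _), mul_comm]
          rw [hs]
          have : C⁻¹ * (Real.sqrt M * Real.sqrt ‖f r‖ / (l / C)) =
            Real.sqrt M * Real.sqrt ‖f r‖ / l := by field_simp
          rw [this]; gcongr
        refine (Phi_mono hb (by positivity) h1).trans
          ((Phi_mul_le hb (Real.sqrt_nonneg _) (by positivity) (inv_le_one_of_one_le₀ hC1)).trans ?_)
        gcongr
        refine (Phi_le_exp hb (Real.sqrt_nonneg _)).trans ?_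
        have e : Real.sqrt (‖f r‖ / lam) ^ b = (‖f r‖ / lam) ^ (b / 2) := by
          rw [Real.sqrt_eq_rpow, ← Real.rpow_mul hx]; congr 1; ring
        rw [e]
        linarith [hexp _ hx]
    _ = ENNReal.ofReal C⁻¹ * (ENNReal.ofReal K * volume D +
          ∫⁻ r in D, ENNReal.ofReal (Phi (b / 2) (‖f r‖ / lam))) := by
        rw [lintegral_const_mul' _ _ ENNReal.ofReal_ne_top, lintegral_add_left measurable_const,
          lintegral_const, Measure.restrict_apply_univ]
    _ ≤ ENNReal.ofReal C⁻¹ * (ENNReal.ofReal K * ENNReal.ofReal T' + ENNReal.ofReal 1) := by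
        gcongr
        · exact hD.trans (ENNReal.ofReal_le_ofReal (le_max_left _ _))
        · simpa using hint
    _ = 1 := by
        rw [← ENNReal.ofReal_mul hK, ← ENNReal.ofReal_add (by positivity) zero_le_one,
          ← ENNReal.ofReal_mul (by positivity), add_comm, ← hCdef, inv_mul_cancel₀ hC0.ne',
          ENNReal.ofReal_one]

end Lux

/-! ### The scale norm -/

theorem scaleMeasure_eq_restrict (T : ℝ) : scaleMeasure T =
    ((volume : Measure ℝ).withDensity (fun τ => ENNReal.ofReal τ⁻¹)).restrict (Ioc 0 T) :=
  (restrict_withDensity measurableSet_Ioc _).symm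

/-- The endpoint `T` is a null set. Dropping it matters: a finite scale norm makes a monotone
modulus finite only for `τ < T`. -/
theorem ae_scaleMeasure {T : ℝ} {P : ℝ → Prop} (h : ∀ τ, 0 < τ → τ < T → P τ) :
    ∀ᵐ τ ∂(scaleMeasure T), P τ := by
  refine (withDensity_absolutelyContinuous _ _).ae_le ?_
  change ∀ᵐ τ ∂(volume.restrict (Ioc 0 T)), P τ
  rw [← Measure.restrict_congr_set (Ioo_ae_eq_Ioc (a := (0 : ℝ)) (b := T))]
  exact (ae_restrict_iff' measurableSet_Ioo).2 (ae_of_all _ fun τ hτ => h τ hτ.1 hτ.2)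

theorem scaleMeasure_mono {S T : ℝ} (h : S ≤ T) : scaleMeasure S ≤ scaleMeasure T := by
  rw [scaleMeasure_eq_restrict, scaleMeasure_eq_restrict]
  exact Measure.restrict_mono (Ioc_subset_Ioc_right h) le_rfl

/-- The measure `dτ/τ` is invariant under dilations; only the time horizon changes. -/
theorem map_mul_scaleMeasure {θ : ℝ} (hθ : 0 < θ) (T : ℝ) :
    (scaleMeasure T).map (fun τ => θ * τ) = scaleMeasure (θ * T) := by
  refine Measure.ext_of_lintegral _ fun F hF => ?_
  have hm : Measurable (fun τ : ℝ => ENNReal.ofReal τ⁻¹) := by fun_prop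
  rw [lintegral_map hF (by fun_prop), scaleMeasure, scaleMeasure,
    lintegral_withDensity_eq_lintegral_mul _ hm
      (show Measurable fun τ => F (θ * τ) from hF.comp (measurable_const_mul θ)),
    lintegral_withDensity_eq_lintegral_mul _ hm hF]
  have himg : Ioc 0 (θ * T) = (fun τ => θ * τ) '' Ioc 0 T := by
    rw [image_mul_left_Ioc hθ, mul_zero]
  rw [himg, lintegral_image_eq_lintegral_abs_deriv_mul (f' := fun _ => θ) measurableSet_Ioc
    (fun x _ => by simpa using ((hasDerivAt_id x).const_mul θ).hasDerivWithinAt)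
    (mul_right_injective₀ hθ.ne').injOn]
  refine setLIntegral_congr_fun measurableSet_Ioc fun τ hτ => ?_
  simp only [Pi.mul_apply]
  rw [← mul_assoc, ← ENNReal.ofReal_mul (abs_nonneg _), abs_of_pos hθ, mul_inv,
    mul_inv_cancel_left₀ hθ.ne']

theorem measurable_scale {a : ℝ} {ω : ℝ → ℝ≥0∞} (hω : Measurable ω) :
    Measurable (fun τ => ω τ / ENNReal.ofReal (τ ^ a)) :=
  hω.div (by fun_prop)

theorem scaleNorm_mono {a T : ℝ} {r : ℝ≥0∞} {ω ω' : ℝ → ℝ≥0∞}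
    (h : ∀ τ, 0 < τ → τ < T → ω τ ≤ ω' τ) : scaleNorm a r T ω ≤ scaleNorm a r T ω' := by
  refine eLpNorm_mono_enorm_ae (ae_scaleMeasure fun τ h0 h1 => ?_)
  simp only [enorm_eq_self]
  gcongr
  exact h τ h0 h1

theorem scaleNorm_le_mul {a T : ℝ} {r : ℝ≥0∞} {ω ω' : ℝ → ℝ≥0∞} (c : ℝ≥0)
    (h : ∀ τ, 0 < τ → τ < T → ω τ ≤ c * ω' τ) :
    scaleNorm a r T ω ≤ c * scaleNorm a r T ω' := by
  refine (eLpNorm_le_nnreal_smul_eLpNorm_of_ae_le_mul' (c := c)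
    (g := fun τ => ω' τ / ENNReal.ofReal (τ ^ a)) (ae_scaleMeasure fun τ h0 h1 => ?_) r).trans
    (le_of_eq (by rw [ENNReal.smul_def, smul_eq_mul]; rfl))
  simp only [enorm_eq_self]
  rw [← mul_div_assoc]
  gcongr
  exact h τ h0 h1

/-- The constant in the quasi-triangle inequality of `L^r`. -/
def lpAddConst (r : ℝ≥0∞) : ℝ≥0 := r.LpAddConst.toNNReal

theorem coe_lpAddConst (r : ℝ≥0∞) : (lpAddConst r : ℝ≥0∞) = r.LpAddConst :=
  ENNReal.coe_toNNReal (ENNReal.LpAddConst_lt_top r).ne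

theorem scaleNorm_add_le {a T : ℝ} {r : ℝ≥0∞} {ω ω' : ℝ → ℝ≥0∞} (hω : Measurable ω)
    (hω' : Measurable ω') : scaleNorm a r T (fun τ => ω τ + ω' τ) ≤
      lpAddConst r * (scaleNorm a r T ω + scaleNorm a r T ω') := by
  rw [coe_lpAddConst]
  refine le_trans (le_of_eq ?_) (eLpNorm_add_le' (measurable_scale hω).aestronglyMeasurable
    (measurable_scale hω').aestronglyMeasurable r)
  unfold scaleNorm
  congr 1
  ext τ
  simp only [Pi.add_apply]
  rw [ENNReal.add_div]

theorem eLpNorm_ennreal {f : ℝ → ℝ≥0∞} {r : ℝ≥0∞} {μ : Measure ℝ} (h0 : r ≠ 0) (h1 : r ≠ ⊤) :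
    eLpNorm f r μ = (∫⁻ x, f x ^ r.toReal ∂μ) ^ (1 / r.toReal) := by
  simp [eLpNorm_eq_lintegral_rpow_enorm_toReal h0 h1]

theorem eLpNorm_ennreal_top {f : ℝ → ℝ≥0∞} {μ : Measure ℝ} :
    eLpNorm f ⊤ μ = essSup f μ := by
  simp [eLpNorm_exponent_top, eLpNormEssSup]

/-- Hölder's inequality with `3 / q = 2 / q + 1 / q`. For nonnegative functions it holds for
exponents below one as well; `q = ⊤` is a separate case. -/
theorem eLpNorm_mul_le {q : ℝ≥0∞} (hq : q ≠ 0) {μ : Measure ℝ} {f g : ℝ → ℝ≥0∞}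
    (hf : AEMeasurable f μ) (hg : AEMeasurable g μ) :
    eLpNorm (fun x => f x * g x) (q / 3) μ ≤ eLpNorm f (q / 2) μ * eLpNorm g q μ := by
  rcases eq_or_ne q ⊤ with rfl | hqt
  · rw [ENNReal.top_div_of_ne_top (by simp), ENNReal.top_div_of_ne_top (by simp),
      eLpNorm_ennreal_top, eLpNorm_ennreal_top, eLpNorm_ennreal_top]
    refine essSup_le_of_ae_le _ ?_
    filter_upwards [ENNReal.ae_le_essSup f, ENNReal.ae_le_essSup g] with x h1 h2
    gcongr
  · have hq0 : 0 < q.toReal := ENNReal.toReal_pos hq hqt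
    have h3 : q / 3 ≠ 0 := by simp [ENNReal.div_eq_zero_iff, hq]
    have h2 : q / 2 ≠ 0 := by simp [ENNReal.div_eq_zero_iff, hq]
    have h3t : q / 3 ≠ ⊤ := by simp [ENNReal.div_eq_top, hqt]
    have h2t : q / 2 ≠ ⊤ := by simp [ENNReal.div_eq_top, hqt]
    rw [eLpNorm_ennreal h3 h3t, eLpNorm_ennreal h2 h2t, eLpNorm_ennreal hq hqt]
    have e3 : (q / 3).toReal = q.toReal / 3 := by simp [ENNReal.toReal_div]
    have e2 : (q / 2).toReal = q.toReal / 2 := by simp [ENNReal.toReal_div]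
    rw [e3, e2]
    exact ENNReal.lintegral_Lp_mul_le_Lq_mul_Lr (by positivity) (by linarith)
      (by field_simp; norm_num) μ hf hg

/-- Hölder's inequality for scale norms. -/
theorem scaleNorm_mul_le {a₁ a₂ T : ℝ} {q : ℝ≥0∞} (hq : q ≠ 0) {ω ω' : ℝ → ℝ≥0∞}
    (hω : Measurable ω) (hω' : Measurable ω') :
    scaleNorm (a₁ + a₂) (q / 3) T (fun τ => ω τ * ω' τ) ≤
      scaleNorm a₁ (q / 2) T ω * scaleNorm a₂ q T ω' := by
  refine le_trans ?_ (eLpNorm_mul_le hq (measurable_scale hω).aemeasurable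
    (measurable_scale hω').aemeasurable)
  refine eLpNorm_mono_enorm_ae (ae_scaleMeasure fun τ h0 h1 => le_of_eq ?_)
  have p1 : 0 < τ ^ a₁ := by positivity
  have p2 : 0 < τ ^ a₂ := by positivity
  simp only [enorm_eq_self]
  rw [Real.rpow_add h0, ENNReal.ofReal_mul p1.le, div_eq_mul_inv, div_eq_mul_inv, div_eq_mul_inv,
    ENNReal.mul_inv (Or.inl (by simpa using p1)) (Or.inl ENNReal.ofReal_ne_top)]
  ring

theorem scaleNorm_mono_time {a S T : ℝ} (h : S ≤ T) {r : ℝ≥0∞} {ω : ℝ → ℝ≥0∞} :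
    scaleNorm a r S ω ≤ scaleNorm a r T ω :=
  eLpNorm_mono_measure _ (scaleMeasure_mono h)

/-- The factor `θ ^ a` is the source of all gains from small scales, both in the dyadic series and
in the partial sums. -/
theorem scaleNorm_dilate {a T θ : ℝ} (hθ : 0 < θ) {r : ℝ≥0∞} {ω : ℝ → ℝ≥0∞} (hω : Measurable ω) :
    scaleNorm a r T (fun τ => ω (θ * τ)) ≤ (θ ^ a).toNNReal * scaleNorm a r (θ * T) ω := by
  have hθa : 0 < θ ^ a := by positivity
  unfold scaleNorm
  rw [← map_mul_scaleMeasure hθ, eLpNorm_map_measure (measurable_scale hω).aestronglyMeasurable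
    (by fun_prop)]
  refine (eLpNorm_le_nnreal_smul_eLpNorm_of_ae_le_mul' (c := (θ ^ a).toNNReal)
    (ae_scaleMeasure fun τ h0 h1 => ?_) r).trans (le_of_eq (by rw [ENNReal.smul_def, smul_eq_mul]))
  have p1 : 0 < τ ^ a := by positivity
  simp only [enorm_eq_self, Function.comp_apply]
  rw [Real.mul_rpow hθ.le h0.le, ENNReal.ofReal_mul hθa.le]
  change _ ≤ ENNReal.ofReal (θ ^ a) * _
  rw [← mul_div_assoc, ENNReal.mul_div_mul_left _ _ (by simpa using hθa) ENNReal.ofReal_ne_top]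

/-- Geometric series in `L^r` for all `r ∈ (0, ∞]`. -/
theorem exists_eLpNorm_tsum_le {r : ℝ≥0∞} (hr : r ≠ 0) {x : ℝ≥0} (hx : x < 1) :
    ∃ C : ℝ≥0, ∀ (μ : Measure ℝ) (h : ℕ → ℝ → ℝ≥0∞) (N : ℝ≥0∞), (∀ j, Measurable (h j)) →
      (∀ j, eLpNorm (h j) r μ ≤ x ^ j * N) →
      eLpNorm (fun t => ∑' j, (x : ℝ≥0∞) ^ j * h j t) r μ ≤ C * N := by
  have hx' : (x : ℝ≥0∞) < 1 := by exact_mod_cast hx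
  have hgeom : ∀ y : ℝ≥0∞, y < 1 → ∑' j : ℕ, y ^ j ≠ ⊤ := by
    intro y hy
    rw [ENNReal.tsum_geometric]
    exact ENNReal.inv_ne_top.2 (tsub_pos_of_lt hy).ne'
  set A := ∑' j : ℕ, (x : ℝ≥0∞) ^ j with hA
  have hAt : A ≠ ⊤ := hgeom _ hx'
  rcases eq_or_ne r ⊤ with rfl | hrt
  · refine ⟨A.toNNReal, fun μ h N _ hN => ?_⟩
    rw [ENNReal.coe_toNNReal hAt, eLpNorm_ennreal_top]
    refine essSup_le_of_ae_le _ ?_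
    have : ∀ᵐ t ∂μ, ∀ j, h j t ≤ N := by
      refine ae_all_iff.2 fun j => ?_
      have h1 := hN j
      rw [eLpNorm_ennreal_top] at h1
      filter_upwards [ENNReal.ae_le_essSup (h j) (μ := μ)] with t ht
      refine ht.trans (h1.trans ?_)
      calc (x : ℝ≥0∞) ^ j * N ≤ 1 * N := by gcongr; exact pow_le_one' hx'.le j
        _ = N := one_mul N
    filter_upwards [this] with t ht
    rw [hA, ← ENNReal.tsum_mul_right]
    exact ENNReal.tsum_le_tsum fun j => by gcongr; exact ht j
  · have hr0 : 0 < r.toReal := ENNReal.toReal_pos hr hrt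
    set y : ℝ≥0∞ := (x : ℝ≥0∞) ^ r.toReal with hy
    have hy1 : y < 1 := ENNReal.rpow_lt_one hx' hr0
    set B := ∑' j : ℕ, y ^ j with hB
    have hBt : B ≠ ⊤ := hgeom _ hy1
    have hCt : A * B ^ (1 / r.toReal) ≠ ⊤ :=
      ENNReal.mul_ne_top hAt (ENNReal.rpow_ne_top_of_nonneg (by positivity) hBt)
    refine ⟨(A * B ^ (1 / r.toReal)).toNNReal, fun μ h N hm hN => ?_⟩
    rw [ENNReal.coe_toNNReal hCt, eLpNorm_ennreal hr hrt]
    -- There is no triangle inequality for `r < 1`. Each `h j` is instead bounded by the `ℓ^r` sum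
    -- over all indices, which can be integrated termwise. The weights `x ^ j` in the series sum to
    -- `A`, those in the norms give `B`.
    have pt : ∀ t, ∑' j, (x : ℝ≥0∞) ^ j * h j t ≤
        A * (∑' i, h i t ^ r.toReal) ^ (1 / r.toReal) := by
      intro t
      rw [hA, ← ENNReal.tsum_mul_right]
      refine ENNReal.tsum_le_tsum fun j => ?_
      gcongr
      calc h j t = (h j t ^ r.toReal) ^ (1 / r.toReal) := by
            rw [← ENNReal.rpow_mul, mul_one_div_cancel hr0.ne', ENNReal.rpow_one]
        _ ≤ _ := by gcongr; exact ENNReal.le_tsum j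
    have pw : ∀ z : ℝ≥0∞, (z ^ (1 / r.toReal)) ^ r.toReal = z := fun z => by
      rw [← ENNReal.rpow_mul, one_div_mul_cancel hr0.ne', ENNReal.rpow_one]
    have hterm : ∀ j, ∫⁻ t, h j t ^ r.toReal ∂μ ≤ y ^ j * N ^ r.toReal := by
      intro j
      have h1 := hN j
      rw [eLpNorm_ennreal hr hrt] at h1
      have h2 := ENNReal.rpow_le_rpow h1 hr0.le
      rw [pw, ENNReal.mul_rpow_of_nonneg _ _ hr0.le] at h2
      refine h2.trans (le_of_eq ?_)
      congr 1
      rw [hy, ← ENNReal.rpow_natCast, ← ENNReal.rpow_natCast, ← ENNReal.rpow_mul,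
        ← ENNReal.rpow_mul, mul_comm]
    calc (∫⁻ t, (∑' j, (x : ℝ≥0∞) ^ j * h j t) ^ r.toReal ∂μ) ^ (1 / r.toReal)
        ≤ (∫⁻ t, A ^ r.toReal * ∑' i, h i t ^ r.toReal ∂μ) ^ (1 / r.toReal) := by
          gcongr with t
          refine (ENNReal.rpow_le_rpow (pt t) hr0.le).trans (le_of_eq ?_)
          rw [ENNReal.mul_rpow_of_nonneg _ _ hr0.le, pw]
      _ = (A ^ r.toReal * ∑' i, ∫⁻ t, h i t ^ r.toReal ∂μ) ^ (1 / r.toReal) := by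
          rw [lintegral_const_mul' _ _ (ENNReal.rpow_ne_top_of_nonneg hr0.le hAt),
            lintegral_tsum fun i => ((hm i).pow_const _).aemeasurable]
      _ ≤ (A ^ r.toReal * ∑' i, y ^ i * N ^ r.toReal) ^ (1 / r.toReal) := by
          gcongr with i
          exact hterm i
      _ = A * B ^ (1 / r.toReal) * N := by
          rw [ENNReal.tsum_mul_right, ← hB, ENNReal.mul_rpow_of_nonneg _ _ (by positivity),
            ENNReal.mul_rpow_of_nonneg _ _ (by positivity), ← ENNReal.rpow_mul,
            ← ENNReal.rpow_mul, mul_one_div_cancel hr0.ne', ENNReal.rpow_one, ENNReal.rpow_one,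
            mul_assoc]

/-- Summation over dyadic scales. -/
theorem exists_scaleNorm_dyadic_le {a : ℝ} {r : ℝ≥0∞} (hr : r ≠ 0) {w : ℝ≥0} (hw0 : 0 < w)
    (hw : (w : ℝ) < 2 ^ a) : ∃ C : ℝ≥0, ∀ (T : ℝ) (ω : ℝ → ℝ≥0∞), 0 < T → Measurable ω →
      scaleNorm a r T (fun τ => ∑' j : ℕ, (w : ℝ≥0∞) ^ j * ω (τ / 2 ^ j)) ≤
        C * scaleNorm a r T ω := by
  have h2a : (0 : ℝ) < 2 ^ a := by positivity
  set A : ℝ≥0 := (2 : ℝ≥0) ^ a with hA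
  have hAr : (A : ℝ) = 2 ^ a := by simp [hA]
  have hA0 : 0 < A := by rw [← NNReal.coe_pos, hAr]; exact h2a
  have hwA : w < A := by rw [← NNReal.coe_lt_coe, hAr]; exact hw
  -- The ratio `w / 2 ^ a < 1` is split into two equal factors: one stays in the series as weight,
  -- the other becomes the geometric decay of the dilated norms.
  set x : ℝ≥0 := NNReal.sqrt (w / A) with hx
  have hx0 : 0 < x := by rw [hx, NNReal.sqrt_pos]; positivity
  have hx1 : x < 1 := by
    rw [hx, ← NNReal.sqrt_one, NNReal.sqrt_lt_sqrt]
    exact (div_lt_one hA0).2 hwA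
  have hxx : x * x = w / A := NNReal.mul_self_sqrt _
  obtain ⟨C, hC⟩ := exists_eLpNorm_tsum_le hr hx1
  refine ⟨C, fun T ω hT hω => ?_⟩
  have hsc : ∀ j : ℕ, Measurable fun τ : ℝ => ω (τ / 2 ^ j) := fun j =>
    hω.comp (measurable_id.div_const _)
  refine le_trans (le_of_eq ?_) (hC (scaleMeasure T) (fun j τ => ((w / x : ℝ≥0) : ℝ≥0∞) ^ j *
    (ω (τ / 2 ^ j) / ENNReal.ofReal (τ ^ a))) (scaleNorm a r T ω)
    (fun j => (measurable_scale (hsc j)).const_mul _) fun j => ?_)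
  · unfold scaleNorm
    congr 1
    ext τ
    simp only [ENNReal.div_eq_inv_mul]
    rw [← ENNReal.tsum_mul_left]
    refine tsum_congr fun j => ?_
    rw [← mul_assoc (_ ^ j), ← mul_pow, ← ENNReal.coe_mul, mul_div_cancel₀ _ hx0.ne',
      mul_left_comm]
  · have h1 : scaleNorm a r T (fun τ => ω (τ / 2 ^ j)) ≤ ((A ^ j)⁻¹ : ℝ≥0) * scaleNorm a r T ω := by
      have h2 := scaleNorm_dilate (a := a) (T := T) (θ := (2 ^ j)⁻¹) (by positivity) (r := r) hω
      have h3 : (((2 : ℝ) ^ j)⁻¹ ^ a).toNNReal = (A ^ j)⁻¹ := by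
        apply NNReal.eq
        rw [Real.coe_toNNReal _ (by positivity), NNReal.coe_inv, NNReal.coe_pow, hAr,
          Real.inv_rpow (by positivity), ← Real.rpow_natCast, ← Real.rpow_natCast,
          ← Real.rpow_mul (by norm_num), ← Real.rpow_mul (by norm_num), mul_comm]
      rw [h3] at h2
      simp only [div_eq_inv_mul]
      refine h2.trans ?_
      gcongr
      refine scaleNorm_mono_time ?_
      rw [inv_mul_le_iff₀ (by positivity)]
      have : (1 : ℝ) ≤ 2 ^ j := one_le_pow₀ (by norm_num)
      nlinarith
    have h2 := eLpNorm_le_nnreal_smul_eLpNorm_of_ae_le_mul' (c := (w / x) ^ j)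
      (f := fun τ => ((w / x : ℝ≥0) : ℝ≥0∞) ^ j * (ω (τ / 2 ^ j) / ENNReal.ofReal (τ ^ a)))
      (g := fun τ => (ω (τ / 2 ^ j) / ENNReal.ofReal (τ ^ a))) (μ := scaleMeasure T)
      (by simp) r
    refine h2.trans ?_
    rw [ENNReal.smul_def, smul_eq_mul]
    calc _ ≤ (((w / x) ^ j : ℝ≥0) : ℝ≥0∞) * (((A ^ j)⁻¹ : ℝ≥0) * scaleNorm a r T ω) := by
          gcongr; exact h1
      _ = _ := by
          rw [← mul_assoc, ← ENNReal.coe_mul, ← inv_pow, ← mul_pow]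
          have : w / x * A⁻¹ = x := by
            have : w = x * x * A := by rw [hxx, div_mul_cancel₀ _ hA0.ne']
            rw [this]; field_simp
          rw [this, ENNReal.coe_pow]

theorem scaleMeasure_Ioc {s : ℝ} (hs : 0 < s) {T : ℝ} (h : 2 * s ≤ T) :
    scaleMeasure T (Ioc s (2 * s)) = ENNReal.ofReal (Real.log 2) := by
  rw [scaleMeasure_eq_restrict, Measure.restrict_apply measurableSet_Ioc,
    inter_eq_self_of_subset_left (Ioc_subset_Ioc hs.le h), withDensity_apply _ measurableSet_Ioc]
  rw [← ofReal_integral_eq_lintegral_ofReal]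
  · rw [← intervalIntegral.integral_of_le (by linarith), integral_inv_of_pos hs (by linarith)]
    congr 2
    field_simp
  · refine (ContinuousOn.integrableOn_Icc ?_).mono_set Ioc_subset_Icc_self
    exact fun x hx => (continuousAt_inv₀ (by have := hx.1; intro h; linarith)).continuousWithinAt
  · filter_upwards [ae_restrict_mem measurableSet_Ioc] with x hx
    exact inv_nonneg.2 (hs.le.trans hx.1.le)

/-- The constant in the pointwise bound on a modulus by its scale norm. -/
def supConst (a : ℝ) (r : ℝ≥0∞) : ℝ≥0 :=
  ((2 : ℝ) ^ a / Real.log 2 ^ (1 / r.toReal)).toNNReal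

/-- On `(s, 2s]`, which has measure `log 2`, the integrand is at least `ω s / (2s) ^ a`. This window
has to fit into `(0, T]`, whence the recurring condition `2 * h ≤ T`. For `r = ⊤` the exponent `1 /
r.toReal` is `1 / 0 = 0` and the logarithmic factor is one. -/
theorem le_scaleNorm {a : ℝ} (ha : 0 ≤ a) {r : ℝ≥0∞} (hr : r ≠ 0) {ω : ℝ → ℝ≥0∞}
    (hω : Monotone ω) {T s : ℝ} (hs : 0 < s) (h : 2 * s ≤ T) :
    ω s ≤ supConst a r * ENNReal.ofReal (s ^ a) * scaleNorm a r T ω := by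
  have hl : 0 < Real.log 2 := Real.log_pos (by norm_num)
  have hL : 0 < Real.log 2 ^ (1 / r.toReal) := by positivity
  have hsa : 0 < s ^ a := by positivity
  have h2a : (0 : ℝ) < 2 ^ a := by positivity
  have hμ : (scaleMeasure T).restrict (Ioc s (2 * s)) ≠ 0 := by
    rw [Ne, Measure.restrict_eq_zero, scaleMeasure_Ioc hs h]
    simpa using hl
  have h1 : ω s / ENNReal.ofReal ((2 * s) ^ a) * ENNReal.ofReal (Real.log 2 ^ (1 / r.toReal)) ≤
      scaleNorm a r T ω := by
    calc _ = eLpNorm (fun _ : ℝ => ω s / ENNReal.ofReal ((2 * s) ^ a)) r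
          ((scaleMeasure T).restrict (Ioc s (2 * s))) := by
          rw [eLpNorm_const _ hr hμ, Measure.restrict_apply_univ, scaleMeasure_Ioc hs h,
            ENNReal.ofReal_rpow_of_pos hl, enorm_eq_self]
      _ ≤ eLpNorm (fun τ => ω τ / ENNReal.ofReal (τ ^ a)) r
          ((scaleMeasure T).restrict (Ioc s (2 * s))) := by
          refine eLpNorm_mono_enorm_ae ?_
          filter_upwards [ae_restrict_mem measurableSet_Ioc] with τ hτ
          simp only [enorm_eq_self]
          have : 0 < τ := hs.trans hτ.1
          gcongr
          · exact hω hτ.1.le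
          · exact hτ.2
      _ ≤ _ := eLpNorm_mono_measure _ Measure.restrict_le_self
  have e : supConst a r * ENNReal.ofReal (s ^ a) =
      ENNReal.ofReal ((2 * s) ^ a) * (ENNReal.ofReal (Real.log 2 ^ (1 / r.toReal)))⁻¹ := by
    rw [supConst]
    change ENNReal.ofReal _ * _ = _
    rw [ENNReal.ofReal_div_of_pos hL, Real.mul_rpow (by norm_num) hs.le,
      ENNReal.ofReal_mul h2a.le, div_eq_mul_inv]
    ring
  rw [e]
  have hn1 : ENNReal.ofReal ((2 * s) ^ a) ≠ 0 := by
    have : 0 < (2 * s) ^ a := by positivity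
    simpa using this
  have hn2 : ENNReal.ofReal (Real.log 2 ^ (1 / r.toReal)) ≠ 0 := by simpa using hL
  calc ω s = ENNReal.ofReal ((2 * s) ^ a) * (ENNReal.ofReal (Real.log 2 ^ (1 / r.toReal)))⁻¹ *
      (ω s / ENNReal.ofReal ((2 * s) ^ a) * ENNReal.ofReal (Real.log 2 ^ (1 / r.toReal))) := by
        rw [ENNReal.div_eq_inv_mul]
        calc ω s = ω s * (ENNReal.ofReal ((2 * s) ^ a) * (ENNReal.ofReal ((2 * s) ^ a))⁻¹) *
              (ENNReal.ofReal (Real.log 2 ^ (1 / r.toReal)) *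
                (ENNReal.ofReal (Real.log 2 ^ (1 / r.toReal)))⁻¹) := by
              rw [ENNReal.mul_inv_cancel hn1 ENNReal.ofReal_ne_top,
                ENNReal.mul_inv_cancel hn2 ENNReal.ofReal_ne_top, mul_one, mul_one]
          _ = _ := by ring
    _ ≤ _ := by gcongr

/-- An infinite value at `s` would persist on `(s, T]`, a set of positive measure. -/
theorem lt_top_of_scaleNorm_lt_top {a : ℝ} {r : ℝ≥0∞} (hr : r ≠ 0) {ω : ℝ → ℝ≥0∞}
    (hω : Monotone ω) {T s : ℝ} (hs0 : 0 < s) (hs : s < T) (h : scaleNorm a r T ω < ⊤) : ω s < ⊤ := by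
  by_contra hcon
  have htop : ω s = ⊤ := not_lt_top_iff.1 hcon
  have hμ : (scaleMeasure T).restrict (Ioc s T) ≠ 0 := by
    rw [Ne, Measure.restrict_eq_zero, scaleMeasure_eq_restrict,
      Measure.restrict_apply measurableSet_Ioc,
      inter_eq_self_of_subset_left (Ioc_subset_Ioc_left hs0.le),
      withDensity_apply _ measurableSet_Ioc, ← Ne]
    refine (setLIntegral_pos_iff (by fun_prop)).2 ?_ |>.ne'
    have : Ioc s T ⊆ Function.support (fun τ : ℝ => ENNReal.ofReal τ⁻¹) ∩ Ioc s T := by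
      intro x hx
      refine ⟨?_, hx⟩
      simpa using hs0.trans hx.1
    refine lt_of_lt_of_le ?_ (measure_mono this)
    simpa using hs
  have h1 : (⊤ : ℝ≥0∞) ≤ scaleNorm a r T ω := by
    calc (⊤ : ℝ≥0∞) = eLpNorm (fun _ : ℝ => (⊤ : ℝ≥0∞)) r
          ((scaleMeasure T).restrict (Ioc s T)) := by
          rw [eLpNorm_const _ hr hμ, enorm_eq_self, ENNReal.top_mul]
          intro h0
          rcases ENNReal.rpow_eq_zero_iff.1 h0 with h0 | h0
          · exact hμ (Measure.measure_univ_eq_zero.1 h0.1)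
          · have : 0 ≤ 1 / r.toReal := by positivity
            linarith [h0.2]
      _ ≤ eLpNorm (fun τ => ω τ / ENNReal.ofReal (τ ^ a)) r
          ((scaleMeasure T).restrict (Ioc s T)) := by
          refine eLpNorm_mono_enorm_ae ?_
          filter_upwards [ae_restrict_mem measurableSet_Ioc] with τ hτ
          have : ω τ = ⊤ := top_le_iff.1 (htop ▸ hω hτ.1.le)
          simp [this, ENNReal.top_div]
      _ ≤ _ := eLpNorm_mono_measure _ Measure.restrict_le_self
  exact absurd h (not_lt.2 h1)

/-- Explains the pairing of indices: taking the root of a modulus of type `(2a, q / 2)` gives type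
`(a, q)`. -/
theorem scaleNorm_sqrt {a T : ℝ} {q : ℝ≥0∞} {ω : ℝ → ℝ≥0∞} :
    scaleNorm a q T (fun τ => ω τ ^ (1 / 2 : ℝ)) ≤ scaleNorm (2 * a) (q / 2) T ω ^ (1 / 2 : ℝ) := by
  have h := eLpNorm_enorm_rpow (p := q) (q := 1 / 2) (μ := scaleMeasure T)
    (fun τ => ω τ / ENNReal.ofReal (τ ^ (2 * a))) (by norm_num)
  have e : q * ENNReal.ofReal (1 / 2) = q / 2 := by
    rw [one_div, ENNReal.ofReal_inv_of_pos (by norm_num), ENNReal.ofReal_ofNat, div_eq_mul_inv]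
  rw [e] at h
  unfold scaleNorm
  rw [← h]
  refine eLpNorm_mono_enorm_ae (ae_scaleMeasure fun τ h0 _ => le_of_eq ?_)
  simp only [enorm_eq_self]
  rw [ENNReal.div_rpow_of_nonneg _ _ (by norm_num), ENNReal.ofReal_rpow_of_nonneg (by positivity)
    (by norm_num), ← Real.rpow_mul h0.le]
  congr 3
  ring

/-- On short scales, a finite scale norm of exponent `r₀` gives finite ones of larger exponents. -/
theorem scaleNorm_lt_top_of_le {a : ℝ} (ha : 0 ≤ a) {r₀ r : ℝ≥0∞} (hr₀ : r₀ ≠ 0) (hr : r₀ ≤ r)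
    {ω : ℝ → ℝ≥0∞} (hω : Monotone ω) {T : ℝ} (h : scaleNorm a r₀ T ω < ⊤) :
    scaleNorm a r (T / 2) ω < ⊤ := by
  set N := scaleNorm a r₀ T ω
  have hb : ∀ τ, 0 < τ → τ < T / 2 → ω τ / ENNReal.ofReal (τ ^ a) ≤ supConst a r₀ * N := by
    intro τ h0 h1
    have hp : 0 < τ ^ a := by positivity
    refine ENNReal.div_le_of_le_mul ?_
    refine (le_scaleNorm ha hr₀ hω h0 (T := T) (by linarith)).trans (le_of_eq ?_)
    ring
  have hKt : supConst a r₀ * N < ⊤ := ENNReal.mul_lt_top ENNReal.coe_lt_top h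
  rcases eq_or_ne r ⊤ with rfl | hrt
  · unfold scaleNorm
    rw [eLpNorm_ennreal_top]
    exact (essSup_le_of_ae_le _ (ae_scaleMeasure hb)).trans_lt hKt
  · have hr₀t : r₀ ≠ ⊤ := (hr.trans_lt hrt.lt_top).ne
    have hrz : r ≠ 0 := fun h0 => hr₀ (le_antisymm (h0 ▸ hr) zero_le)
    have p0 : 0 < r₀.toReal := ENNReal.toReal_pos hr₀ hr₀t
    have p1 : 0 < r.toReal := ENNReal.toReal_pos hrz hrt
    have ple : r₀.toReal ≤ r.toReal := ENNReal.toReal_mono hrt hr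
    have hN : scaleNorm a r₀ (T / 2) ω < ⊤ := by
      rcases le_total 0 T with hT | hT
      · exact (scaleNorm_mono_time (by linarith)).trans_lt h
      · have : scaleMeasure (T / 2) = 0 := by
          rw [scaleMeasure_eq_restrict, Ioc_eq_empty (by linarith), Measure.restrict_empty]
        simp [scaleNorm, this]
    unfold scaleNorm at hN ⊢
    rw [eLpNorm_ennreal hr₀ hr₀t] at hN
    rw [eLpNorm_ennreal hrz hrt]
    have hint : ∫⁻ τ, (ω τ / ENNReal.ofReal (τ ^ a)) ^ r₀.toReal ∂(scaleMeasure (T / 2)) < ⊤ :=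
      (ENNReal.rpow_lt_top_iff_of_pos (by positivity)).1 hN
    refine (ENNReal.rpow_lt_top_iff_of_pos (by positivity)).2 ?_
    -- Interpolation with the uniform bound: of the power `r`, the excess over `r₀` is estimated by
    -- the supremum, which is available on `(0, T / 2)`.
    calc ∫⁻ τ, (ω τ / ENNReal.ofReal (τ ^ a)) ^ r.toReal ∂(scaleMeasure (T / 2))
        ≤ ∫⁻ τ, (supConst a r₀ * N) ^ (r.toReal - r₀.toReal) *
            (ω τ / ENNReal.ofReal (τ ^ a)) ^ r₀.toReal ∂(scaleMeasure (T / 2)) := by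
          refine lintegral_mono_ae (ae_scaleMeasure fun τ h0 h1 => ?_)
          calc _ = (ω τ / ENNReal.ofReal (τ ^ a)) ^ (r.toReal - r₀.toReal) *
                (ω τ / ENNReal.ofReal (τ ^ a)) ^ r₀.toReal := by
                rw [← ENNReal.rpow_add_of_nonneg _ _ (by linarith) p0.le]; congr 1; ring
            _ ≤ _ := by
                gcongr
                exact hb τ h0 h1
      _ = (supConst a r₀ * N) ^ (r.toReal - r₀.toReal) *
            ∫⁻ τ, (ω τ / ENNReal.ofReal (τ ^ a)) ^ r₀.toReal ∂(scaleMeasure (T / 2)) :=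
          lintegral_const_mul' _ _ (ENNReal.rpow_ne_top_of_nonneg (by linarith) hKt.ne)
      _ < ⊤ := ENNReal.mul_lt_top (ENNReal.rpow_lt_top_of_nonneg (by linarith) hKt.ne) hint

/-! ### Hölder regularity of paths -/

section Holder

variable {V : Type*} [NormedAddCommGroup V] [NormedSpace ℝ V]

/-- The set `S` allows integration of sections that exist only up to `T - h` and are extended by
zero. -/
theorem norm_integral_window_le {b p C : ℝ} (hb : 0 < b) (hp : 1 ≤ p) (hC0 : 0 ≤ C)
    (hC : ∀ x : ℝ, 0 ≤ x → x ^ p ≤ C * Phi b x) {D : Set ℝ} {s t ε L : ℝ} (hst : s ≤ t)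
    (hε : 0 < ε) {S : Set ℝ} (hS : S ∩ Ioc s t ⊆ D) (hSm : MeasurableSet S)
    (hvol : volume (S ∩ Ioc s t) ≤ ENNReal.ofReal ε) {g : ℝ → V} (hL : 0 ≤ L) (h : luxNorm b D g ≤ ENNReal.ofReal L) :
    ‖∫ r in s..t, S.indicator g r‖ ≤ (1 + C) * ε ^ (1 - 1 / p) * L := by
  have h1 : ‖∫ r in s..t, S.indicator g r‖ₑ ≤
      ENNReal.ofReal ((1 + C) * ε ^ (1 - 1 / p) * L) := by
    rw [intervalIntegral.integral_of_le hst]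
    refine (enorm_integral_le_lintegral_enorm _).trans ?_
    have e : ∀ r, ‖S.indicator g r‖ₑ = S.indicator (fun r => ‖g r‖ₑ) r := fun r => by
      by_cases hr : r ∈ S <;> simp [hr]
    simp only [e]
    rw [lintegral_indicator hSm, Measure.restrict_restrict hSm]
    refine (lintegral_window_le hb hp hC0 hC hS hε hvol g).trans ?_
    rw [ENNReal.ofReal_mul (p := (1 + C) * ε ^ (1 - 1 / p)) (by positivity)]
    gcongr
  rw [← ofReal_norm] at h1
  exact (ENNReal.ofReal_le_ofReal_iff (by positivity)).1 h1

/-- The value `f s` is compared with the averages of `f` over `[s, s + ε]`. Passing from window `2δ`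
to `δ` changes the average by a window integral of `f (r + δ) - f r`, of size `δ ^ (a - 1 / p)`, and
these changes form a geometric series. -/
theorem exists_holder_aux [CompleteSpace V] {a b p : ℝ} (hb : 0 < b) (hp : 1 ≤ p) (hbp : b ≤ p)
    (hap : 1 / p < a) :
    ∃ C : ℝ, 0 ≤ C ∧ ∀ (T M : ℝ) (f : ℝ → V), 0 ≤ M → Continuous f →
      (∀ h, 0 < h → 2 * h ≤ T →
        luxNorm b (Icc 0 (T - h)) (fun r => f (r + h) - f r) ≤ ENNReal.ofReal (M * h ^ a)) →
      ∀ s t, 0 ≤ s → s < t → t ≤ T → ‖f t - f s‖ ≤ C * M * (t - s) ^ (a - 1 / p) := by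
  obtain ⟨K, hK0, hK⟩ := exists_rpow_le_Phi hb hp hbp
  set γ := a - 1 / p with hγ
  have hγ0 : 0 < γ := by linarith
  set ρ : ℝ := 2 ^ (-γ) with hρ
  have hρ1 : ρ < 1 := Real.rpow_lt_one_of_one_lt_of_neg (by norm_num) (by linarith)
  have hρ0 : 0 < ρ := by positivity
  have h1ρ : 0 < 1 - ρ := by linarith
  set W := 1 + K
  have hscale : ∀ ε : ℝ, 0 < ε → ∀ k : ℕ, (ε / 2 ^ (k + 1)) ^ γ ≤ ε ^ γ * ρ ^ k := by
    intro ε hε k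
    have e1 : (2 : ℝ) ^ k = 2 ^ (k : ℝ) := (Real.rpow_natCast 2 k).symm
    have : (ε / 2 ^ k) ^ γ = ε ^ γ * ρ ^ k := by
      rw [Real.div_rpow hε.le (by positivity), hρ, ← Real.rpow_natCast (2 ^ (-γ)),
        ← Real.rpow_mul (by norm_num), e1, ← Real.rpow_mul (by norm_num), div_eq_mul_inv,
        ← Real.rpow_neg (by norm_num)]
      congr 2; ring
    rw [← this]
    gcongr
    · norm_num
    · omega
  refine ⟨(2 * W / (1 - ρ) + W) / (1 - ρ), by positivity, fun T M f hM hf H => ?_⟩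
  have hwin : ∀ s δ, 0 ≤ s → 0 < δ → s + 2 * δ ≤ T →
      ‖∫ r in s..s + δ, (f (r + δ) - f r)‖ ≤ W * M * δ ^ γ * δ := by
    intro s δ hs hδ hsT
    have h1 := norm_integral_window_le hb hp hK0 hK (D := Icc 0 (T - δ)) (s := s) (t := s + δ)
      (ε := δ) (L := M * δ ^ a) (S := univ) (by linarith) hδ
      (by rintro x ⟨-, hx⟩; exact ⟨by linarith [hx.1], by linarith [hx.2]⟩) MeasurableSet.univ
      (by simp) (by positivity) (H δ hδ (by linarith))
    simp only [indicator_univ] at h1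
    refine h1.trans (le_of_eq ?_)
    have : δ ^ (1 - 1 / p) * δ ^ a = δ ^ γ * δ := by
      nth_rw 4 [← Real.rpow_one δ]
      rw [← Real.rpow_add hδ, ← Real.rpow_add hδ]; congr 1; rw [hγ]; ring
    calc _ = W * M * (δ ^ (1 - 1 / p) * δ ^ a) := by ring
      _ = _ := by rw [this]; ring
  have hint : ∀ x y, IntervalIntegrable f volume x y := fun x y => hf.intervalIntegrable x y
  have hshift : ∀ s δ, ∫ r in s..s + δ, (f (r + δ) - f r) =
      (∫ r in s + δ..s + δ + δ, f r) - ∫ r in s..s + δ, f r := by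
    intro s δ
    rw [intervalIntegral.integral_sub
      ((show Continuous fun r => f (r + δ) by fun_prop).intervalIntegrable _ _) (hint _ _), intervalIntegral.integral_comp_add_right]
  let A : ℝ → ℝ → V := fun ε s => ε⁻¹ • ∫ r in s..s + ε, f r
  have hA2 : ∀ s δ, 0 ≤ s → 0 < δ → s + 2 * δ ≤ T → ‖A (2 * δ) s - A δ s‖ ≤ W * M * δ ^ γ := by
    intro s δ hs hδ hsT
    have e : A (2 * δ) s - A δ s = (2 * δ)⁻¹ • ∫ r in s..s + δ, (f (r + δ) - f r) := by
      simp only [A]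
      rw [hshift, ← intervalIntegral.integral_add_adjacent_intervals (hint s (s + δ))
        (hint (s + δ) (s + 2 * δ)), show s + 2 * δ = s + δ + δ by ring]
      have : δ⁻¹ = 2 * (2 * δ)⁻¹ := by field_simp
      rw [this]
      module
    rw [e, norm_smul, norm_inv, Real.norm_of_nonneg (by positivity)]
    calc _ ≤ (2 * δ)⁻¹ * (W * M * δ ^ γ * δ) := by gcongr; exact hwin s δ hs hδ hsT
      _ = W * M * δ ^ γ / 2 := by field_simp
      _ ≤ _ := half_le_self (by positivity)
  have hAlim : ∀ s ε, 0 < ε → Tendsto (fun k : ℕ => A (ε / 2 ^ k) s) atTop (𝓝 (f s)) := by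
    intro s ε hε
    have hd : HasDerivAt (fun x => ∫ r in s..x, f r) (f s) s :=
      (hf.integral_hasStrictDerivAt s s).hasDerivAt
    have hz : Tendsto (fun k : ℕ => ε / 2 ^ k) atTop (𝓝[≠] 0) := by
      refine tendsto_nhdsWithin_iff.2 ⟨?_, Eventually.of_forall fun k => ?_⟩
      · have := (tendsto_pow_atTop_nhds_zero_of_lt_one (r := (1 / 2 : ℝ)) (by norm_num)
          (by norm_num)).const_mul ε
        simpa [div_eq_mul_inv] using this
      · have : 0 < ε / 2 ^ k := by positivity
        exact this.ne'
    have := (hasDerivAt_iff_tendsto_slope_zero.1 hd).comp hz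
    simpa [A, Function.comp_def] using this
  have hAf : ∀ s ε, 0 ≤ s → 0 < ε → s + ε ≤ T → ‖A ε s - f s‖ ≤ W * M * ε ^ γ / (1 - ρ) := by
    intro s ε hs hε hsT
    have := dist_le_of_le_geometric_of_tendsto₀ ρ (W * M * ε ^ γ) (f := fun k : ℕ => A (ε / 2 ^ k) s)
      hρ1 (fun k => ?_) (hAlim s ε hε)
    · simpa [dist_eq_norm] using this
    · have e : ε / 2 ^ k = 2 * (ε / 2 ^ (k + 1)) := by rw [pow_succ]; field_simp
      have hle : 2 * (ε / 2 ^ (k + 1)) ≤ ε := by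
        rw [← e]; exact div_le_self hε.le (one_le_pow₀ (by norm_num))
      have h1 := hA2 s (ε / 2 ^ (k + 1)) hs (by positivity) (by linarith)
      rw [← e] at h1
      rw [dist_eq_norm]
      refine h1.trans ?_
      rw [mul_assoc (W * M)]
      gcongr
      exact hscale ε hε k
  set B := 2 * W / (1 - ρ) + W with hB
  have hB0 : 0 ≤ B := by positivity
  -- Averages at `s` and `s + h` differ again by a window integral of increments. The window has to
  -- stay inside `[0, T]`, so `s + 2h ≤ T` is needed.
  have hstep : ∀ s h, 0 ≤ s → 0 < h → s + 2 * h ≤ T → ‖f (s + h) - f s‖ ≤ B * M * h ^ γ := by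
    intro s h hs hh hsT
    have h1 := hAf s h hs hh (by linarith)
    have h2 := hAf (s + h) h (by linarith) hh (by linarith)
    have h3 : ‖A h (s + h) - A h s‖ ≤ W * M * h ^ γ := by
      have e : A h (s + h) - A h s = h⁻¹ • ∫ r in s..s + h, (f (r + h) - f r) := by
        simp only [A]; rw [hshift, smul_sub]
      rw [e, norm_smul, norm_inv, Real.norm_of_nonneg hh.le]
      calc _ ≤ h⁻¹ * (W * M * h ^ γ * h) := by gcongr; exact hwin s h hs hh hsT
        _ = _ := by field_simp
    have e : f (s + h) - f s = -(A h (s + h) - f (s + h)) + (A h (s + h) - A h s) +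
      (A h s - f s) := by abel
    rw [e]
    refine (norm_add₃_le).trans ?_
    rw [norm_neg]
    have : B * M * h ^ γ = W * M * h ^ γ / (1 - ρ) + W * M * h ^ γ + W * M * h ^ γ / (1 - ρ) := by
      rw [hB]; ring
    linarith
  intro s t hs hst ht
  set h := t - s with hh
  have hh0 : 0 < h := by linarith
  -- To reach `t` itself, advance along `t - h / 2 ^ k`. The step `h / 2 ^ (k + 1)` taken there
  -- meets the room condition exactly, since twice that step ends at `t`.
  have hlim : Tendsto (fun k : ℕ => f (t - h / 2 ^ k)) atTop (𝓝 (f t)) := by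
    refine (hf.tendsto t).comp ?_
    have := ((tendsto_pow_atTop_nhds_zero_of_lt_one (r := (1 / 2 : ℝ)) (by norm_num)
          (by norm_num)).const_mul h).const_sub t
    simpa [div_eq_mul_inv] using this
  have := dist_le_of_le_geometric_of_tendsto₀ ρ (B * M * h ^ γ) hρ1 (fun k => ?_) hlim
  · rw [dist_comm, dist_eq_norm] at this
    simp only [pow_zero, div_one, hh, sub_sub_cancel] at this
    rw [← hh] at this
    refine this.trans (le_of_eq ?_)
    ring
  · have e : t - h / 2 ^ (k + 1) = (t - h / 2 ^ k) + h / 2 ^ (k + 1) := by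
      rw [pow_succ]; field_simp; ring
    have hle : h / 2 ^ k ≤ h := div_le_self hh0.le (one_le_pow₀ (by norm_num))
    rw [dist_comm, dist_eq_norm, e]
    refine (hstep _ _ (by linarith) (by positivity) ?_).trans ?_
    · have : t - h / 2 ^ k + 2 * (h / 2 ^ (k + 1)) = t := by rw [pow_succ]; field_simp; ring
      linarith
    · rw [mul_assoc (B * M)]
      gcongr
      exact hscale h hh0 k

/-- A continuous path with Orlicz modulus of order `a` is Hölder continuous of order `a - 1 / p`
for all large `p`. -/
theorem exists_holder (V : Type*) [NormedAddCommGroup V] [NormedSpace ℝ V] [CompleteSpace V]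
    {a b p : ℝ} (hb : 0 < b) (hp : 1 ≤ p) (hbp : b ≤ p) (hap : 1 / p < a) :
    ∃ C : ℝ, 0 ≤ C ∧ ∀ (T M : ℝ) (f : ℝ → V), 0 ≤ M → ContinuousOn f (Icc 0 T) →
      (∀ h, 0 < h → 2 * h ≤ T →
        luxNorm b (Icc 0 (T - h)) (fun r => f (r + h) - f r) ≤ ENNReal.ofReal (M * h ^ a)) →
      ∀ s t, 0 ≤ s → s ≤ t → t ≤ T → ‖f t - f s‖ ≤ C * M * (t - s) ^ (a - 1 / p) := by
  obtain ⟨C, hC0, hC⟩ := exists_holder_aux (V := V) hb hp hbp hap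
  refine ⟨C, hC0, fun T M f hM hf H s t hs hst ht => ?_⟩
  rcases hst.eq_or_lt with rfl | hst
  · simp only [sub_self, norm_zero]
    positivity
  have hT : (0 : ℝ) ≤ T := by linarith
  -- The constant extension is continuous on the line, so all window integrals exist; the section
  -- norms only see `[0, T]`.
  set F : ℝ → V := IccExtend hT ((Icc 0 T).domRestrict f) with hF
  have hFc : Continuous F := (continuousOn_iff_continuous_domRestrict.1 hf).Icc_extend'
  have hFe : ∀ x ∈ Icc 0 T, F x = f x := fun x hx => by
    rw [hF, IccExtend_of_mem hT _ hx]; rfl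
  have := hC T M F hM hFc (fun h h0 h2 => ?_) s t hs hst ht
  · rwa [hFe t ⟨by linarith, ht⟩, hFe s ⟨hs, by linarith⟩] at this
  · refine (luxNorm_mono_norm hb ?_).trans (H h h0 h2)
    refine (ae_restrict_iff' measurableSet_Icc).2 (ae_of_all _ fun r hr => ?_)
    rw [hFe r ⟨hr.1, by linarith [hr.2]⟩, hFe (r + h) ⟨by linarith [hr.1], by linarith [hr.2]⟩]

end Holder

/-! ### Sections and dyadic sums of two-parameter maps -/

section Sections

variable {V : Type*} [NormedAddCommGroup V]

/-- The Luxemburg norm of the section `t - s = h` of a two-parameter map. -/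
def secNorm (b T : ℝ) (A : ℝ → ℝ → V) (h : ℝ) : ℝ≥0∞ :=
  luxNorm b (Icc 0 (T - h)) (fun r => A r (r + h))

/-- Measurability of all sections of a two-parameter map. -/
def SecMeas (T : ℝ) (A : ℝ → ℝ → V) : Prop := ∀ h ∈ Icc (0 : ℝ) T,
  AEStronglyMeasurable (fun r => A r (r + h)) (volume.restrict (Icc 0 (T - h)))

theorem AEStronglyMeasurable.shift_Icc {g : ℝ → V} {c u v : ℝ} (hc : 0 ≤ c) (huv : u + c ≤ v)
    (hg : AEStronglyMeasurable g (volume.restrict (Icc 0 v))) :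
    AEStronglyMeasurable (fun r => g (r + c)) (volume.restrict (Icc 0 u)) := by
  have h1 := hg.comp_measurePreserving
    ((measurePreserving_add_right volume c).restrict_preimage measurableSet_Icc)
  refine h1.mono_measure (Measure.restrict_mono (fun r hr => ?_) le_rfl)
  exact ⟨by linarith [hr.1], by linarith [hr.2]⟩

theorem SecMeas.shift {T : ℝ} {A : ℝ → ℝ → V} (hA : SecMeas T A) {c h H : ℝ} (hc : 0 ≤ c)
    (hh : 0 ≤ h) (hH : c + h ≤ H) (hT : h ≤ T) :
    AEStronglyMeasurable (fun r => A (r + c) (r + c + h)) (volume.restrict (Icc 0 (T - H))) :=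
  AEStronglyMeasurable.shift_Icc (g := fun r => A r (r + h)) hc (by linarith) (hA h ⟨hh, hT⟩)

theorem luxNorm_shift_le_secNorm {b T : ℝ} (hb : 0 < b) (A : ℝ → ℝ → V) {c h H : ℝ} (hc : 0 ≤ c)
    (hH : c + h ≤ H) :
    luxNorm b (Icc 0 (T - H)) (fun r => A (r + c) (r + c + h)) ≤ secNorm b T A h :=
  luxNorm_shift (f := fun r => A r (r + h)) hb measurableSet_Icc measurableSet_Icc
    fun r hr => ⟨by linarith [hr.1], by linarith [hr.2]⟩

theorem SecMeas.sub {T : ℝ} {A B : ℝ → ℝ → V} (hA : SecMeas T A) (hB : SecMeas T B) :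
    SecMeas T (A - B) := fun h hh => (hA h hh).sub (hB h hh)

theorem SecMeas.add {T : ℝ} {A B : ℝ → ℝ → V} (hA : SecMeas T A) (hB : SecMeas T B) :
    SecMeas T (A + B) := fun h hh => (hA h hh).add (hB h hh)

theorem secMeas_del {T : ℝ} {f : ℝ → V} (hf : ContinuousOn f (Icc 0 T)) : SecMeas T (del f) := by
  intro h hh
  have h1 : ContinuousOn (fun r => f (r + h)) (Icc 0 (T - h)) :=
    hf.comp (by fun_prop) fun r hr => ⟨by linarith [hr.1, hh.1], by linarith [hr.2]⟩
  have h2 : ContinuousOn f (Icc 0 (T - h)) := hf.mono (Icc_subset_Icc_right (by linarith [hh.1]))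
  exact (h1.sub h2).aestronglyMeasurable measurableSet_Icc

/-- The sum of a two-parameter map over the dyadic partition of order `k`. -/
def dyadicSum (A : ℝ → ℝ → V) : ℕ → ℝ → ℝ → V
  | 0 => A
  | k + 1 => fun s t => dyadicSum A k s ((s + t) / 2) + dyadicSum A k ((s + t) / 2) t

theorem dyadicSum_succ (A : ℝ → ℝ → V) (k : ℕ) (r h : ℝ) : dyadicSum A (k + 1) r (r + h) =
    dyadicSum A k r (r + h / 2) + dyadicSum A k (r + h / 2) (r + h / 2 + h / 2) := by
  have e1 : (r + (r + h)) / 2 = r + h / 2 := by ring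
  have e2 : r + h / 2 + h / 2 = r + h := by ring
  rw [e2, ← e1]; rfl

theorem dyadicSum_del (f : ℝ → V) (k : ℕ) : dyadicSum (del f) k = del f := by
  induction k with
  | zero => rfl
  | succ k ih =>
    ext s t
    change dyadicSum (del f) k _ _ + dyadicSum (del f) k _ _ = _
    rw [ih]; simp [del]

theorem dyadicSum_sub (A B : ℝ → ℝ → V) (k : ℕ) :
    dyadicSum (A - B) k = dyadicSum A k - dyadicSum B k := by
  induction k with
  | zero => rfl
  | succ k ih =>
    ext s t
    change dyadicSum (A - B) k _ _ + dyadicSum (A - B) k _ _ =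
      dyadicSum A k _ _ + dyadicSum A k _ _ - (dyadicSum B k _ _ + dyadicSum B k _ _)
    rw [ih]; simp only [Pi.sub_apply]; abel

theorem SecMeas.dyadicSum {T : ℝ} {A : ℝ → ℝ → V} (hA : SecMeas T A) (k : ℕ) :
    SecMeas T (dyadicSum A k) := by
  induction k with
  | zero => exact hA
  | succ k ih =>
    intro h hh
    simp only [dyadicSum_succ]
    have h1 := ih.shift (c := 0) (h := h / 2) (H := h) le_rfl (by linarith [hh.1])
      (by linarith [hh.1]) (by linarith [hh.1, hh.2])
    simp only [add_zero] at h1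
    exact h1.add (ih.shift (by linarith [hh.1]) (by linarith [hh.1]) (by linarith)
      (by linarith [hh.1, hh.2]))

theorem secNorm_dyadicSum_le {b T : ℝ} (hb : 0 < b) {A : ℝ → ℝ → V} (hA : SecMeas T A) (k : ℕ)
    {h : ℝ} (h0 : 0 ≤ h) (hT : h ≤ T) :
    secNorm b T (dyadicSum A k) h ≤ 2 ^ k * secNorm b T A (h / 2 ^ k) := by
  induction k generalizing h with
  | zero => simp [dyadicSum]
  | succ k ih =>
    have hh : 0 ≤ h / 2 := by positivity
    have m1 := (hA.dyadicSum k).shift (c := 0) (h := h / 2) (H := h) le_rfl hh (by linarith)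
      (by linarith)
    have l1 := luxNorm_shift_le_secNorm (T := T) hb (dyadicSum A k) (c := 0) (h := h / 2) (H := h)
      le_rfl (by linarith)
    have l2 := luxNorm_shift_le_secNorm (T := T) hb (dyadicSum A k) (c := h / 2) (h := h / 2)
      (H := h) hh (by linarith)
    simp only [add_zero] at m1 l1
    have key : secNorm b T (dyadicSum A (k + 1)) h ≤
        secNorm b T (dyadicSum A k) (h / 2) + secNorm b T (dyadicSum A k) (h / 2) := by
      unfold secNorm
      simp only [dyadicSum_succ]
      exact (luxNorm_add_le hb m1).trans (add_le_add l1 l2)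
    have i := ih (h := h / 2) hh (by linarith)
    have e : h / 2 / 2 ^ k = h / 2 ^ (k + 1) := by rw [pow_succ]; field_simp
    rw [e] at i
    calc _ ≤ _ := key
      _ ≤ 2 ^ k * secNorm b T A (h / 2 ^ (k + 1)) + 2 ^ k * secNorm b T A (h / 2 ^ (k + 1)) :=
          add_le_add i i
      _ = _ := by rw [pow_succ]; ring

/-- Refining from order `j` to `j + 1` adds `2 ^ j` defects at scale `h / 2 ^ j`. The induction
peels off the first bisection, in agreement with the recursion of `dyadicSum`. The bound `H`
restricts the argument to scales where the defect is controlled. -/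
theorem secNorm_dyadicSum_sub_le {b T H : ℝ} (hb : 0 < b) {A : ℝ → ℝ → V} (hA : SecMeas T A)
    {ω : ℝ → ℝ≥0∞} (hH : H ≤ T) (hω : ∀ h, 0 < h → h ≤ H →
      luxNorm b (Icc 0 (T - h)) (fun r => del2 A r (r + h / 2) (r + h)) ≤ ω h) (k : ℕ)
    {h : ℝ} (h0 : 0 < h) (hT : h ≤ H) :
    secNorm b T (dyadicSum A k - A) h ≤ ∑ j ∈ Finset.range k, 2 ^ j * ω (h / 2 ^ j) := by
  induction k generalizing h with
  | zero => simp [dyadicSum, secNorm, luxNorm_zero hb]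
  | succ k ih =>
    have hh : 0 < h / 2 := by positivity
    have hm : SecMeas T (dyadicSum A k - A) := (hA.dyadicSum k).sub hA
    have m1 := hm.shift (c := 0) (h := h / 2) (H := h) le_rfl hh.le (by linarith) (by linarith)
    have m2 := hm.shift (c := h / 2) (h := h / 2) (H := h) hh.le hh.le (by linarith) (by linarith)
    have l1 := luxNorm_shift_le_secNorm (T := T) hb (dyadicSum A k - A) (c := 0) (h := h / 2)
      (H := h) le_rfl (by linarith)
    have l2 := luxNorm_shift_le_secNorm (T := T) hb (dyadicSum A k - A) (c := h / 2) (h := h / 2)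
      (H := h) hh.le (by linarith)
    simp only [add_zero] at m1 l1
    have i := ih (h := h / 2) hh (by linarith)
    have e : ∀ r, (dyadicSum A (k + 1) - A) r (r + h) =
        ((dyadicSum A k - A) r (r + h / 2) + (dyadicSum A k - A) (r + h / 2) (r + h / 2 + h / 2)) -
          del2 A r (r + h / 2) (r + h) := by
      intro r
      have e2 : r + h / 2 + h / 2 = r + h := by ring
      simp only [Pi.sub_apply, dyadicSum_succ, del2, e2]
      abel
    have key : secNorm b T (dyadicSum A (k + 1) - A) h ≤
        secNorm b T (dyadicSum A k - A) (h / 2) + secNorm b T (dyadicSum A k - A) (h / 2) +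
          ω h := by
      unfold secNorm
      simp only [e]
      refine (luxNorm_sub_le hb (m1.add m2)).trans (add_le_add ?_ (hω h h0 hT))
      exact (luxNorm_add_le hb m1).trans (add_le_add l1 l2)
    refine key.trans ((add_le_add_left (add_le_add i i) _).trans (le_of_eq ?_))
    rw [Finset.sum_range_succ', ← two_mul, Finset.mul_sum]
    simp only [pow_zero, one_mul, div_one]
    congr 1
    refine Finset.sum_congr rfl fun j _ => ?_
    rw [← mul_assoc, pow_succ', pow_succ']
    congr 2
    rw [div_div]

/-- If the sewing error is of smaller order than the step, it is controlled by the dyadic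
series of the defects. -/
theorem secNorm_le_tsum {b T : ℝ} (hb : 0 < b) {A : ℝ → ℝ → V} (hA : SecMeas T A) {f : ℝ → V}
    (hf : ContinuousOn f (Icc 0 T)) {ω : ℝ → ℝ≥0∞} (hω : ∀ h, 0 < h → h ≤ T →
      luxNorm b (Icc 0 (T - h)) (fun r => del2 A r (r + h / 2) (r + h)) ≤ ω h)
    {h : ℝ} (h0 : 0 < h) (hT : h ≤ T)
    (hlim : Tendsto (fun k : ℕ => 2 ^ k * secNorm b T (del f - A) (h / 2 ^ k)) atTop (𝓝 0)) :
    secNorm b T (del f - A) h ≤ ∑' j : ℕ, 2 ^ j * ω (h / 2 ^ j) := by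
  have hK : SecMeas T (del f - A) := (secMeas_del hf).sub hA
  -- Increments are unchanged by dyadic summation, so the error is its own dyadic sum plus
  -- `dyadicSum A k - A`. The first term is at most `2 ^ k` errors at the smallest scale and
  -- vanishes in the limit.
  have hb' : ∀ k : ℕ, secNorm b T (del f - A) h ≤
      2 ^ k * secNorm b T (del f - A) (h / 2 ^ k) + ∑' j : ℕ, 2 ^ j * ω (h / 2 ^ j) := by
    intro k
    have e : ∀ r, (del f - A) r (r + h) =
        dyadicSum (del f - A) k r (r + h) + (dyadicSum A k - A) r (r + h) := by
      intro r
      rw [dyadicSum_sub, dyadicSum_del]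
      simp
    calc secNorm b T (del f - A) h
        ≤ secNorm b T (dyadicSum (del f - A) k) h + secNorm b T (dyadicSum A k - A) h := by
          conv_lhs => unfold secNorm
          simp only [e]
          exact luxNorm_add_le hb (hK.dyadicSum k h ⟨h0.le, hT⟩)
      _ ≤ _ := by
          refine add_le_add (secNorm_dyadicSum_le hb hK k h0.le hT) ?_
          exact (secNorm_dyadicSum_sub_le hb hA le_rfl hω k h0 hT).trans (ENNReal.sum_le_tsum _)
  have := hlim.add_const (∑' j : ℕ, 2 ^ j * ω (h / 2 ^ j))
  rw [zero_add] at this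
  exact ge_of_tendsto this (Eventually.of_forall hb')

end Sections

/-! ### Existence of the sewing -/

section Sewing

variable {V : Type*} [NormedAddCommGroup V] [NormedSpace ℝ V]

/-- Tonelli and translation invariance: averaging preserves total mass. -/
theorem lintegral_average_shift {F : ℝ → ℝ≥0∞} (hF : AEMeasurable F) {ε : ℝ} (hε : 0 < ε) :
    ∫⁻ s, ENNReal.ofReal ε⁻¹ * ∫⁻ r in Ioc s (s + ε), F r = ∫⁻ r, F r := by
  have e : ∀ s, ∫⁻ r in Ioc s (s + ε), F r = ∫⁻ v in Ioc 0 ε, F (s + v) := by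
    intro s
    rw [← lintegral_indicator measurableSet_Ioc, ← lintegral_indicator measurableSet_Ioc,
      ← lintegral_add_left_eq_self _ s]
    refine lintegral_congr fun v => ?_
    by_cases hv : v ∈ Ioc 0 ε
    · have : s + v ∈ Ioc s (s + ε) := ⟨by linarith [hv.1], by linarith [hv.2]⟩
      simp [hv, this]
    · have : s + v ∉ Ioc s (s + ε) := fun h => hv ⟨by linarith [h.1], by linarith [h.2]⟩
      simp [hv, this]
  simp only [e]
  rw [lintegral_const_mul' _ _ ENNReal.ofReal_ne_top]
  have hmeas : AEMeasurable (Function.uncurry fun s v : ℝ => F (s + v))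
      ((volume : Measure ℝ).prod (volume.restrict (Ioc 0 ε))) := by
    have h1 : AEMeasurable (fun z : ℝ × ℝ => F (z.1 + z.2))
        ((volume : Measure ℝ).prod (volume : Measure ℝ)) :=
      hF.comp_quasiMeasurePreserving (quasiMeasurePreserving_add volume volume)
    refine h1.mono_measure ?_
    exact Measure.prod_mono le_rfl Measure.restrict_le_self
  rw [lintegral_lintegral_swap hmeas]
  have : ∀ v : ℝ, ∫⁻ s, F (s + v) = ∫⁻ s, F s := fun v => lintegral_add_right_eq_self _ v
  simp only [this]
  rw [lintegral_const, Measure.restrict_apply_univ, Real.volume_Ioc, sub_zero, mul_comm, mul_assoc,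
    ← ENNReal.ofReal_mul hε.le, mul_inv_cancel₀ hε.ne', ENNReal.ofReal_one, mul_one]

/-- Averaging over short windows does not increase the Orlicz modular. -/
theorem lintegral_Phi_average_le {b l ε : ℝ} (hb : 0 < b) (hl : 0 < l) (hε : 0 < ε) {w : ℝ → V}
    (hw : Integrable w) (hfin : ∫⁻ r, ENNReal.ofReal (Phi b (‖w r‖ / l)) ≠ ⊤) :
    ∫⁻ s, ENNReal.ofReal (Phi b (‖ε⁻¹ • ∫ r in s..s + ε, w r‖ / l)) ≤
      ∫⁻ r, ENNReal.ofReal (Phi b (‖w r‖ / l)) := by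
  have hm : AEMeasurable (fun r => Phi b (‖w r‖ / l)) :=
    (measurable_Phi b).comp_aemeasurable (hw.1.norm.aemeasurable.div_const l)
  have hnn : ∀ r, 0 ≤ Phi b (‖w r‖ / l) := fun r => Phi_nonneg hb (by positivity)
  have hint : Integrable (fun r => Phi b (‖w r‖ / l)) := by
    refine ⟨hm.aestronglyMeasurable, ?_⟩
    rw [hasFiniteIntegral_iff_ofReal (ae_of_all _ hnn)]
    exact hfin.lt_top
  rw [← lintegral_average_shift hm.ennreal_ofReal hε]
  refine lintegral_mono fun s => ?_
  have hvol : (volume : Measure ℝ).real (Ioc s (s + ε)) = ε := by simp [Measure.real, hε.le]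
  -- Jensen's inequality on the window, applied to the norm of `w` because `Φ_b` is convex on the
  -- half-line only.
  have hj := (convexOn_Phi hb).map_set_average_le (Phi_continuous hb) isClosed_Ici
    (μ := volume) (t := Ioc s (s + ε)) (f := fun r => ‖w r‖ / l) (by simp [hε]) (by simp)
    (ae_of_all _ fun r => mem_Ici.2 (by positivity)) (hw.norm.div_const l).integrableOn
    hint.integrableOn
  rw [setAverage_eq, setAverage_eq, hvol] at hj
  have h1 : ‖ε⁻¹ • ∫ r in s..s + ε, w r‖ / l ≤ ε⁻¹ • ∫ r in Ioc s (s + ε), ‖w r‖ / l := by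
    rw [norm_smul, integral_div, smul_eq_mul, mul_div_assoc, norm_inv, Real.norm_of_nonneg hε.le,
      intervalIntegral.integral_of_le (by linarith)]
    gcongr
    exact norm_integral_le_integral_norm _
  refine (ENNReal.ofReal_le_ofReal ((Phi_mono hb (by positivity) h1).trans hj)).trans (le_of_eq ?_)
  rw [smul_eq_mul, ENNReal.ofReal_mul (by positivity),
    ofReal_integral_eq_lintegral_ofReal hint.integrableOn (ae_of_all _ hnn)]

theorem integrable_section {V : Type*} [NormedAddCommGroup V] {b T h : ℝ} (hb : 0 < b) {A : ℝ → ℝ → V} (hA : SecMeas T A)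
    (h0 : 0 ≤ h) (hT : h ≤ T) (hfin : secNorm b T A h ≠ ⊤) :
    Integrable ((Icc 0 (T - h)).indicator fun r => A r (r + h)) := by
  rw [integrable_indicator_iff measurableSet_Icc]
  refine ⟨hA h ⟨h0, hT⟩, ?_⟩
  obtain ⟨C, hC0, hC⟩ := exists_rpow_le_Phi hb (le_max_left 1 b) (le_max_right 1 b)
  refine (lintegral_window_le hb (le_max_left 1 b) hC0 hC (S := Icc 0 (T - h)) subset_rfl
    (ε := T - h + 1) (by linarith) ?_ _).trans_lt ?_
  · rw [Real.volume_Icc]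
    exact ENNReal.ofReal_le_ofReal (by linarith)
  · exact ENNReal.mul_lt_top ENNReal.ofReal_lt_top hfin.lt_top

/-- Window integrals of dyadic sums. -/
theorem integral_dyadicSum {b T ε : ℝ} (hb : 0 < b) (hε : 0 < ε) {A : ℝ → ℝ → V}
    (hA : SecMeas T A) (hfin : secNorm b T A ε ≠ ⊤) (k : ℕ) {s : ℝ} (hs : 0 ≤ s)
    (hT : s + 2 ^ k * ε + ε ≤ T) :
    ∫ r in s..s + 2 ^ k * ε, (Icc 0 (T - ε)).indicator (fun r => A r (r + ε)) r =
      ∫ r in s..s + ε, dyadicSum A k r (r + 2 ^ k * ε) := by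
  have hεT : ε ≤ T := by have : 0 ≤ 2 ^ k * ε := by positivity
                         linarith
  have hI := integrable_section hb hA hε.le hεT hfin
  induction k generalizing s with
  | zero =>
    simp only [pow_zero, one_mul] at hT ⊢
    refine intervalIntegral.integral_congr fun r hr => ?_
    rw [uIcc_of_le (by linarith)] at hr
    have : r ∈ Icc 0 (T - ε) := ⟨by linarith [hr.1], by linarith [hr.2]⟩
    simp [this, dyadicSum]
  | succ k ih =>
    set d := 2 ^ k * ε with hd
    have hd0 : 0 < d := by positivity
    have e : (2 : ℝ) ^ (k + 1) * ε = d + d := by rw [hd, pow_succ]; ring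
    rw [e] at hT ⊢
    have i1 := ih (s := s) hs (by linarith)
    have i2 := ih (s := s + d) (by linarith) (by linarith)
    have hJ : Integrable ((Icc 0 (T - d)).indicator fun r => dyadicSum A k r (r + d)) := by
      refine integrable_section hb (hA.dyadicSum k) hd0.le (by linarith) ?_
      refine ((secNorm_dyadicSum_le hb hA k hd0.le (by linarith)).trans_lt ?_).ne
      have : d / 2 ^ k = ε := by rw [hd]; field_simp
      rw [this]
      exact ENNReal.mul_lt_top (by simp) hfin.lt_top
    have hJ' : ∀ x y, 0 ≤ x → x ≤ y → y ≤ T - d →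
        IntervalIntegrable (fun r => dyadicSum A k r (r + d)) volume x y := by
      intro x y hx hxy hy
      rw [intervalIntegrable_iff_integrableOn_Icc_of_le hxy]
      exact ((integrable_indicator_iff measurableSet_Icc).1 hJ).mono_set (Icc_subset_Icc hx hy)
    -- The window of length `d + d` is cut in half and the second half is translated back by `d`.
    -- The integrands then add up to the next dyadic sum over one window of length `ε`.
    rw [← add_assoc, ← intervalIntegral.integral_add_adjacent_intervals
      (hI.intervalIntegrable (a := s) (b := s + d)) hI.intervalIntegrable, i1, i2,
      add_right_comm s d ε, ← intervalIntegral.integral_comp_add_right _ d,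
      ← intervalIntegral.integral_add (hJ' _ _ hs (by linarith) (by linarith))]
    · refine intervalIntegral.integral_congr fun r _ => ?_
      have e2 : (d + d) / 2 = d := by ring
      simp only [dyadicSum_succ, e2]
    · have := (hJ' (s + d) (s + ε + d) (by linarith) (by linarith) (by linarith)).comp_add_right d
      simpa using this

end Sewing

/-! ### The sewing as a limit of the regularised integrals `ε⁻¹ ∫₀ᵗ A_{r,r+ε} dr`. -/

section Sewing

variable {V : Type*} [NormedAddCommGroup V]

/-- The section of a two-parameter map, extended by zero. -/
def secInd (T : ℝ) (A : ℝ → ℝ → V) (h : ℝ) : ℝ → V :=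
  (Icc 0 (T - h)).indicator fun r => A r (r + h)

/-- The half-step section lives on a longer interval than the full-step section; the term on `(T -
ε, T - ε / 2]` corrects the mismatch at the right end. -/
theorem secInd_split {T ε r : ℝ} (A : ℝ → ℝ → V) (hε : 0 < ε) (hr : 0 ≤ r) :
    secInd T A ε r - secInd T A (ε / 2) r - secInd T A (ε / 2) (r + ε / 2) +
      (Ioc (T - ε) (T - ε / 2)).indicator (secInd T A (ε / 2)) r =
    (Icc 0 (T - ε)).indicator (fun r => del2 A r (r + ε / 2) (r + ε)) r := by
  have e : r + ε / 2 + ε / 2 = r + ε := by ring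
  unfold secInd
  rcases le_or_gt r (T - ε) with h1 | h1
  · have m1 : r ∈ Icc 0 (T - ε) := ⟨hr, h1⟩
    have m2 : r ∈ Icc 0 (T - ε / 2) := ⟨hr, by linarith⟩
    have m3 : r + ε / 2 ∈ Icc 0 (T - ε / 2) := ⟨by linarith, by linarith⟩
    have m4 : r ∉ Ioc (T - ε) (T - ε / 2) := fun h => absurd h.1 (not_lt.2 h1)
    rw [indicator_of_mem m1, indicator_of_mem m2, indicator_of_mem m3, indicator_of_notMem m4,
      indicator_of_mem m1, e, add_zero, del2]
  · have m1 : r ∉ Icc 0 (T - ε) := fun h => absurd h.2 (not_le.2 h1)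
    have m3 : r + ε / 2 ∉ Icc 0 (T - ε / 2) := fun h => by linarith [h.2]
    rw [indicator_of_notMem m1, indicator_of_notMem m3, indicator_of_notMem m1]
    by_cases h2 : r ∈ Ioc (T - ε) (T - ε / 2)
    · rw [indicator_of_mem h2]; abel
    · have m2 : r ∉ Icc 0 (T - ε / 2) := fun h => h2 ⟨h1, h.2⟩
      rw [indicator_of_notMem h2, indicator_of_notMem m2]; abel

variable [NormedSpace ℝ V]

/-- Halving `ε` changes the regularised integral by the integrated defect, of order `ε ^ (a - 1)`,
and by three boundary terms over sets of measure at most `ε / 2`, each of order `ε ^ (α - 1 / p)`.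
-/
theorem norm_approx_sub_le {b p C T α a M₁ M₂ : ℝ} (hb : 0 < b) (hp : 1 ≤ p) (hC0 : 0 ≤ C)
    (hC : ∀ x : ℝ, 0 ≤ x → x ^ p ≤ C * Phi b x) (hpα : 1 / p < α) (hM₁ : 0 ≤ M₁)
    (hM₂ : 0 ≤ M₂) {A : ℝ → ℝ → V} (hA : SecMeas T A)
    (H₁ : ∀ h, 0 < h → 2 * h ≤ T → secNorm b T A h ≤ ENNReal.ofReal (M₁ * h ^ α))
    (H₂ : ∀ h, 0 < h → 2 * h ≤ T → luxNorm b (Icc 0 (T - h))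
      (fun r => del2 A r (r + h / 2) (r + h)) ≤ ENNReal.ofReal (M₂ * h ^ a))
    {ε t : ℝ} (hε : 0 < ε) (hεT : 2 * ε ≤ T) (ht0 : 0 ≤ t) (htT : t ≤ T) :
    ‖ε⁻¹ • (∫ r in 0..t, secInd T A ε r) - (ε / 2)⁻¹ • ∫ r in 0..t, secInd T A (ε / 2) r‖ ≤
      3 * (1 + C) * M₁ * ε ^ (α - 1 / p) + (1 + C) * T ^ (1 - 1 / p) * M₂ * ε ^ (a - 1) := by
  set ε' := ε / 2 with hε'
  have hε'0 : 0 < ε' := by positivity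
  have hI : Integrable (secInd T A ε) :=
    integrable_section hb hA hε.le (by linarith) ((H₁ ε hε hεT).trans_lt ENNReal.ofReal_lt_top).ne
  have hI' : Integrable (secInd T A ε') :=
    integrable_section hb hA hε'0.le (by linarith)
      ((H₁ ε' hε'0 (by linarith)).trans_lt ENNReal.ofReal_lt_top).ne
  set U := Ioc (T - ε) (T - ε') with hU
  have hIU : Integrable (U.indicator (secInd T A ε')) := hI'.indicator measurableSet_Ioc
  have hIs : Integrable (fun r => secInd T A ε' (r + ε')) := hI'.comp_add_right ε'
  have hD : ∫ r in 0..t, (Icc 0 (T - ε)).indicator (fun r => del2 A r (r + ε') (r + ε)) r =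
      (∫ r in 0..t, secInd T A ε r) - (∫ r in 0..t, secInd T A ε' r) -
        (∫ r in 0..t, secInd T A ε' (r + ε')) + ∫ r in 0..t, U.indicator (secInd T A ε') r := by
    have hI₁ : Integrable fun r => secInd T A ε r - secInd T A ε' r := hI.sub hI'
    have hI₂ : Integrable fun r => secInd T A ε r - secInd T A ε' r - secInd T A ε' (r + ε') :=
      hI₁.sub hIs
    rw [← intervalIntegral.integral_sub hI.intervalIntegrable hI'.intervalIntegrable,
      ← intervalIntegral.integral_sub hI₁.intervalIntegrable hIs.intervalIntegrable,
      ← intervalIntegral.integral_add hI₂.intervalIntegrable hIU.intervalIntegrable]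
    refine intervalIntegral.integral_congr fun r hr => ?_
    rw [uIcc_of_le ht0] at hr
    exact (secInd_split A hε hr.1).symm
  -- Shifting the half-step section by `ε / 2` produces boundary windows at `t` and at `0`;
  -- otherwise it repeats the unshifted integral, which yields the factor `2 = (ε / 2)⁻¹ / ε⁻¹`.
  have hshift : ∫ r in 0..t, secInd T A ε' (r + ε') =
      (∫ r in 0..t, secInd T A ε' r) + (∫ r in t..t + ε', secInd T A ε' r) -
        ∫ r in 0..ε', secInd T A ε' r := by
    rw [intervalIntegral.integral_comp_add_right, zero_add,
      intervalIntegral.integral_add_adjacent_intervals hI'.intervalIntegrable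
        hI'.intervalIntegrable,
      ← intervalIntegral.integral_add_adjacent_intervals (a := 0) (b := ε') (c := t + ε')
        hI'.intervalIntegrable hI'.intervalIntegrable]
    abel
  set P₁ := ∫ r in t..t + ε', secInd T A ε' r
  set P₂ := ∫ r in 0..ε', secInd T A ε' r
  set P₃ := ∫ r in 0..t, U.indicator (secInd T A ε') r
  set P₄ := ∫ r in 0..t, (Icc 0 (T - ε)).indicator (fun r => del2 A r (r + ε') (r + ε)) r
  have hrepr : ε⁻¹ • (∫ r in 0..t, secInd T A ε r) - ε'⁻¹ • (∫ r in 0..t, secInd T A ε' r) =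
      ε⁻¹ • (P₁ - P₂ - P₃ + P₄) := by
    rw [hD, hshift]
    have : ε'⁻¹ = 2 * ε⁻¹ := by rw [hε']; field_simp
    rw [this]
    module
  have hwin : ∀ {s u : ℝ} {S : Set ℝ}, s ≤ u → MeasurableSet S → S ⊆ Icc 0 (T - ε') →
      volume (S ∩ Ioc s u) ≤ ENNReal.ofReal ε' →
      ‖∫ r in s..u, S.indicator (fun r => A r (r + ε')) r‖ ≤
        (1 + C) * M₁ * ε ^ (α - 1 / p) * ε := by
    intro s u S hsu hSm hS hvol
    refine (norm_integral_window_le hb hp hC0 hC hsu hε'0 (inter_subset_left.trans hS) hSm hvol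
      (L := M₁ * ε' ^ α) (by positivity) (H₁ ε' hε'0 (by linarith))).trans ?_
    have e : ε' ^ (1 - 1 / p) * ε' ^ α = ε' ^ (α - 1 / p) * ε' := by
      nth_rw 4 [← Real.rpow_one ε']
      rw [← Real.rpow_add hε'0, ← Real.rpow_add hε'0]; congr 1; ring
    calc _ = (1 + C) * M₁ * (ε' ^ (1 - 1 / p) * ε' ^ α) := by ring
      _ = (1 + C) * M₁ * ε' ^ (α - 1 / p) * ε' := by rw [e]; ring
      _ ≤ _ := by
          have : ε' ≤ ε := by linarith
          gcongr
  have b1 : ‖P₁‖ ≤ (1 + C) * M₁ * ε ^ (α - 1 / p) * ε :=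
    hwin (by linarith) measurableSet_Icc subset_rfl
      ((measure_mono inter_subset_right).trans (by rw [Real.volume_Ioc]; simp))
  have b2 : ‖P₂‖ ≤ (1 + C) * M₁ * ε ^ (α - 1 / p) * ε :=
    hwin hε'0.le measurableSet_Icc subset_rfl
      ((measure_mono inter_subset_right).trans (by rw [Real.volume_Ioc]; simp))
  have b3 : ‖P₃‖ ≤ (1 + C) * M₁ * ε ^ (α - 1 / p) * ε := by
    have e : ∀ r, U.indicator (secInd T A ε') r =
        (U ∩ Icc 0 (T - ε')).indicator (fun r => A r (r + ε')) r := fun r => by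
      rw [← indicator_indicator]; rfl
    simp only [P₃, e]
    refine hwin ht0 (measurableSet_Ioc.inter measurableSet_Icc) inter_subset_right ?_
    refine (measure_mono (inter_subset_left.trans inter_subset_left)).trans ?_
    rw [hU, Real.volume_Ioc]
    exact ENNReal.ofReal_le_ofReal (by linarith)
  have b4 : ‖P₄‖ ≤ (1 + C) * T ^ (1 - 1 / p) * M₂ * ε ^ (a - 1) * ε := by
    refine (norm_integral_window_le hb hp hC0 hC ht0 (ε := T) (by linarith) inter_subset_left
      measurableSet_Icc ((measure_mono inter_subset_right).trans
        (by rw [Real.volume_Ioc]; exact ENNReal.ofReal_le_ofReal (by linarith)))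
      (L := M₂ * ε ^ a) (by positivity) (H₂ ε hε hεT)).trans (le_of_eq ?_)
    have e : ε ^ a = ε ^ (a - 1) * ε := by
      nth_rw 3 [← Real.rpow_one ε]
      rw [← Real.rpow_add hε]; congr 1; ring
    rw [e]; ring
  rw [hrepr, norm_smul, norm_inv, Real.norm_of_nonneg hε.le, inv_mul_le_iff₀ hε]
  calc ‖P₁ - P₂ - P₃ + P₄‖ ≤ ‖P₁‖ + ‖P₂‖ + ‖P₃‖ + ‖P₄‖ :=
        (norm_add_le _ _).trans (add_le_add ((norm_sub_le _ _).trans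
          (add_le_add (norm_sub_le _ _) le_rfl)) le_rfl)
    _ ≤ _ := by linarith

theorem summable_dyadic_rpow {T γ : ℝ} (hT : 0 < T) (hγ : 0 < γ) (c : ℝ) :
    Summable fun k : ℕ => c * (T / 2 ^ (k + 1)) ^ γ := by
  have hρ1 : (2 : ℝ) ^ (-γ) < 1 := Real.rpow_lt_one_of_one_lt_of_neg (by norm_num) (by linarith)
  have h := (summable_geometric_of_lt_one (by positivity) hρ1).mul_left (c * (T / 2) ^ γ)
  refine h.congr fun k => ?_
  have e1 : (2 : ℝ) ^ k = 2 ^ (k : ℝ) := (Real.rpow_natCast 2 k).symm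
  have : T / 2 ^ (k + 1) = T / 2 / 2 ^ k := by rw [pow_succ']; field_simp
  rw [this, Real.div_rpow (x := T / 2) (y := 2 ^ k) (by positivity) (by positivity) γ, mul_assoc,
    ← Real.rpow_natCast (2 ^ (-γ)), ← Real.rpow_mul (by norm_num), e1,
    ← Real.rpow_mul (by norm_num), div_eq_mul_inv (_ ^ γ), ← Real.rpow_neg (by norm_num)]
  congr 3
  ring

/-- Averaging in `r` is forced because sections are known only through Orlicz norms. Halving errors
are summable uniformly in `t`, as `1 / p < α` and `1 < a`, so the limit is continuous. -/
theorem exists_sewing_limit [CompleteSpace V] {b T α a M₁ M₂ : ℝ} (hb : 0 < b) (hT : 0 < T)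
    (hα : 0 < α) (ha : 1 < a) (hM₁ : 0 ≤ M₁) (hM₂ : 0 ≤ M₂) {A : ℝ → ℝ → V} (hA : SecMeas T A)
    (H₁ : ∀ h, 0 < h → 2 * h ≤ T → secNorm b T A h ≤ ENNReal.ofReal (M₁ * h ^ α))
    (H₂ : ∀ h, 0 < h → 2 * h ≤ T → luxNorm b (Icc 0 (T - h))
      (fun r => del2 A r (r + h / 2) (r + h)) ≤ ENNReal.ofReal (M₂ * h ^ a)) :
    ∃ I : ℝ → V, ContinuousOn I (Icc 0 T) ∧ I 0 = 0 ∧ ∀ t ∈ Icc 0 T,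
      Tendsto (fun k : ℕ => (T / 2 ^ (k + 1))⁻¹ • ∫ r in 0..t, secInd T A (T / 2 ^ (k + 1)) r)
        atTop (𝓝 (I t)) := by
  obtain ⟨p, hp1, hpb, hpα⟩ : ∃ p : ℝ, 1 ≤ p ∧ b ≤ p ∧ 1 / p < α := by
    refine ⟨max 1 (max b (2 / α)), le_max_left _ _, (le_max_left _ _).trans (le_max_right _ _), ?_⟩
    rw [div_lt_comm₀ (by positivity) hα]
    have : 2 / α ≤ max 1 (max b (2 / α)) := (le_max_right _ _).trans (le_max_right _ _)
    have h2 : 1 / α < 2 / α := by gcongr; norm_num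
    linarith
  obtain ⟨C, hC0, hC⟩ := exists_rpow_le_Phi hb hp1 hpb
  set ε : ℕ → ℝ := fun k => T / 2 ^ (k + 1) with hεdef
  have hε : ∀ k, 0 < ε k := fun k => by positivity
  have hε2 : ∀ k, 2 * ε k ≤ T := fun k => by
    have : 2 * ε k = T / 2 ^ k := by simp only [hεdef]; rw [pow_succ]; field_simp
    rw [this]
    exact div_le_self hT.le (one_le_pow₀ (by norm_num))
  have hεs : ∀ k, ε k / 2 = ε (k + 1) := fun k => by
    simp only [hεdef]; rw [pow_succ (2 : ℝ) (k + 1)]; field_simp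
  let J : ℕ → ℝ → V := fun k t => (ε k)⁻¹ • ∫ r in 0..t, secInd T A (ε k) r
  have hJc : ∀ k, Continuous (J k) := by
    intro k
    have hI : Integrable (secInd T A (ε k)) :=
      integrable_section hb hA (hε k).le (by linarith [hε2 k, hε k])
        ((H₁ _ (hε k) (hε2 k)).trans_lt ENNReal.ofReal_lt_top).ne
    exact (intervalIntegral.continuous_primitive (fun _ _ => hI.intervalIntegrable) 0).const_smul _
  let u : ℕ → ℝ := fun k => 3 * (1 + C) * M₁ * ε k ^ (α - 1 / p) +
    (1 + C) * T ^ (1 - 1 / p) * M₂ * ε k ^ (a - 1)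
  have hu : Summable u := (summable_dyadic_rpow hT (by linarith) _).add
    (summable_dyadic_rpow hT (by linarith) _)
  have hdiff : ∀ k, ∀ t ∈ Icc 0 T, ‖J (k + 1) t - J k t‖ ≤ u k := by
    intro k t ht
    have := norm_approx_sub_le hb hp1 hC0 hC hpα hM₁ hM₂ hA H₁ H₂ (hε k) (hε2 k) ht.1 ht.2
    rw [norm_sub_rev, hεs] at this
    exact this
  refine ⟨fun t => J 0 t + ∑' k, (J (k + 1) t - J k t), ?_, ?_, fun t ht => ?_⟩
  · exact (hJc 0).continuousOn.add
      (continuousOn_tsum (fun k => ((hJc _).sub (hJc _)).continuousOn) hu hdiff)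
  · simp [J]
  · have hs : Summable fun k => J (k + 1) t - J k t :=
      Summable.of_norm_bounded hu fun k => hdiff k t ht
    have h1 := hs.hasSum.tendsto_sum_nat.const_add (J 0 t)
    refine h1.congr fun n => ?_
    rw [Finset.sum_range_sub (fun k => J k t)]
    simp [J, hεdef]

/-- The sewing error on dyadic scales. -/
theorem secNorm_sewing_dyadic [CompleteSpace V] {b T : ℝ} (hb : 0 < b) (hT : 0 < T)
    {A : ℝ → ℝ → V} (hA : SecMeas T A)
    (hfin : ∀ h, 0 < h → 2 * h ≤ T → secNorm b T A h ≠ ⊤) {I : ℝ → V}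
    (hI : ∀ t ∈ Icc 0 T, Tendsto (fun k : ℕ => (T / 2 ^ (k + 1))⁻¹ •
      ∫ r in 0..t, secInd T A (T / 2 ^ (k + 1)) r) atTop (𝓝 (I t)))
    (j : ℕ) {S : ℝ≥0∞} (hS : ∀ k, secNorm b T (dyadicSum A k - A) (T / 2 ^ (j + 1)) ≤ S) :
    secNorm b T (del I - A) (T / 2 ^ (j + 1)) ≤ S := by
  set d := T / 2 ^ (j + 1) with hd
  have hd0 : 0 < d := by positivity
  have hd2 : 2 * d ≤ T := by
    have : 2 * d = T / 2 ^ j := by rw [hd, pow_succ]; field_simp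
    rw [this]
    exact div_le_self hT.le (one_le_pow₀ (by norm_num))
  refine luxNorm_le_of_forall fun l hl hlt => ?_
  -- The index is shifted by `j` so that `2 ^ k` steps of length `ε k` fill exactly the fixed scale
  -- `d`.
  set ε : ℕ → ℝ := fun k => T / 2 ^ (k + j + 1) with hεdef
  have hε : ∀ k, 0 < ε k := fun k => by positivity
  have hdε : ∀ k, 2 ^ k * ε k = d := fun k => by
    simp only [hεdef, hd]; rw [add_assoc, pow_add]; field_simp
  have hε2 : ∀ k, 2 * ε k ≤ T := fun k => by
    have h1 : (1 : ℝ) ≤ 2 ^ k := one_le_pow₀ (by norm_num)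
    have := hdε k
    nlinarith [hε k]
  have hε0 : Tendsto ε atTop (𝓝 0) := by
    have := ((tendsto_pow_atTop_nhds_zero_of_lt_one (r := (1 / 2 : ℝ)) (by norm_num)
          (by norm_num)).const_mul d)
    rw [mul_zero] at this
    refine this.congr fun k => ?_
    rw [← hdε k, one_div, inv_pow]; field_simp
  let w : ℕ → ℝ → V := fun k => secInd T (dyadicSum A k - A) d
  have hξd : Integrable (secInd T A d) := integrable_section hb hA hd0.le (by linarith)
    (hfin d hd0 hd2)
  have hDint : ∀ k, Integrable (secInd T (dyadicSum A k) d) := fun k => by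
    refine integrable_section hb (hA.dyadicSum k) hd0.le (by linarith) ?_
    refine ((secNorm_dyadicSum_le hb hA k hd0.le (by linarith)).trans_lt ?_).ne
    have : d / 2 ^ k = ε k := by rw [← hdε k]; field_simp
    rw [this]
    exact ENNReal.mul_lt_top (by simp) (hfin _ (hε k) (hε2 k)).lt_top
  have hwe : ∀ k, w k = secInd T (dyadicSum A k) d - secInd T A d := fun k => by
    ext r
    simp only [w, secInd, Pi.sub_apply]
    exact congrFun (indicator_sub (Icc 0 (T - d)) (fun r => dyadicSum A k r (r + d))
      (fun r => A r (r + d))) r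
  have hwI : ∀ k, Integrable (w k) := fun k => by rw [hwe]; exact (hDint k).sub hξd
  have hmod : ∀ k, ∫⁻ r, ENNReal.ofReal (Phi b (‖w k r‖ / l)) ≤ 1 := by
    intro k
    have h1 := lintegral_Phi_le_one hb ((hS k).trans_lt hlt)
    rw [← lintegral_indicator measurableSet_Icc] at h1
    refine le_trans (lintegral_mono fun r => le_of_eq ?_) h1
    by_cases hr : r ∈ Icc 0 (T - d)
    · simp [w, secInd, hr]
    · simp [w, secInd, hr, Phi_zero]
  -- Averages of `dyadicSum A k - A` over windows shrinking with `k`. Jensen's inequality keeps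
  -- their modular below one, and their pointwise limit is the sewing error.
  let Z : ℕ → ℝ → V := fun k s => (ε k)⁻¹ • ∫ r in s..s + ε k, w k r
  have hZ : ∀ k, ∫⁻ s, ENNReal.ofReal (Phi b (‖Z k s‖ / l)) ≤ 1 := fun k =>
    (lintegral_Phi_average_le hb hl (hε k) (hwI k) ((hmod k).trans_lt ENNReal.one_lt_top).ne).trans
      (hmod k)
  have hZc : ∀ k, Continuous (Z k) := by
    intro k
    have hc := intervalIntegral.continuous_primitive (fun _ _ => (hwI k).intervalIntegrable) 0
    have e : ∀ s, ∫ r in s..s + ε k, w k r =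
        (∫ r in 0..s + ε k, w k r) - ∫ r in 0..s, w k r := fun s =>
      (intervalIntegral.integral_interval_sub_left (hwI k).intervalIntegrable
        (hwI k).intervalIntegrable).symm
    simp only [Z, e]
    exact ((hc.comp (continuous_add_const _)).sub hc).const_smul _
  have hlim : ∀ᵐ s ∂(volume.restrict (Icc 0 (T - d))),
      Tendsto (fun k => Z k s) atTop (𝓝 ((del I - A) s (s + d))) := by
    rw [← Measure.restrict_congr_set (Ico_ae_eq_Icc (a := (0 : ℝ)) (b := T - d)),
      ae_restrict_iff' measurableSet_Ico]
    filter_upwards [LocallyIntegrable.ae_hasDerivAt_integral hξd.locallyIntegrable] with s hs hsd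
    have hsI : s ∈ Icc 0 (T - d) := ⟨hsd.1, hsd.2.le⟩
    have hz : Tendsto ε atTop (𝓝[≠] 0) :=
      tendsto_nhdsWithin_iff.2 ⟨hε0, Eventually.of_forall fun k => (hε k).ne'⟩
    have l1 : Tendsto (fun k => (ε k)⁻¹ • ∫ r in s..s + ε k, secInd T A d r) atTop
        (𝓝 (A s (s + d))) := by
      have := (hasDerivAt_iff_tendsto_slope_zero.1 (hs s)).comp hz
      simpa [Function.comp_def, secInd, hsI] using this
    have l2 : Tendsto (fun k => (ε k)⁻¹ • ((∫ r in 0..s + d, secInd T A (ε k) r) -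
        ∫ r in 0..s, secInd T A (ε k) r)) atTop (𝓝 (I (s + d) - I s)) := by
      have a1 := (hI (s + d) ⟨by linarith [hsd.1], by linarith [hsd.2]⟩).comp
        (tendsto_add_atTop_nat j)
      have a2 := (hI s ⟨hsd.1, by linarith [hsd.2]⟩).comp (tendsto_add_atTop_nat j)
      refine (a1.sub a2).congr fun k => ?_
      simp only [Function.comp_apply, hεdef, smul_sub]
    refine (l2.sub l1).congr' ?_
    -- The window starting at `s` must fit below `T - d`, which is why the endpoint `s = T - d` was
    -- discarded.
    have hev : ∀ᶠ k in atTop, ε k < T - d - s :=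
      hε0.eventually (gt_mem_nhds (by linarith [hsd.2]))
    filter_upwards [hev] with k hk
    have hk0 := hε k
    -- By `integral_dyadicSum`, the increment of the regularised integral over `[s, s + d]` is a
    -- short window integral of the dyadic sum of order `k`.
    have e1 : (∫ r in 0..s + d, secInd T A (ε k) r) - ∫ r in 0..s, secInd T A (ε k) r =
        ∫ r in s..s + ε k, secInd T (dyadicSum A k) d r := by
      have hIk : Integrable (secInd T A (ε k)) := integrable_section hb hA (hε k).le
        (by linarith [hε2 k]) (hfin _ (hε k) (hε2 k))
      rw [intervalIntegral.integral_interval_sub_left hIk.intervalIntegrable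
        hIk.intervalIntegrable]
      have h1 := integral_dyadicSum hb (hε k) hA (hfin _ (hε k) (hε2 k)) k hsd.1
        (by rw [hdε]; linarith)
      rw [hdε] at h1
      refine h1.trans (intervalIntegral.integral_congr fun r hr => ?_)
      rw [uIcc_of_le (by linarith)] at hr
      have : r ∈ Icc 0 (T - d) := ⟨hsd.1.trans hr.1, by linarith [hr.2]⟩
      simp [secInd, this]
    simp only [Z, hwe, e1]
    rw [← smul_sub, ← intervalIntegral.integral_sub (hDint k).intervalIntegrable
      hξd.intervalIntegrable]
    rfl
  have hmeas : ∀ k, Measurable fun s => ENNReal.ofReal (Phi b (‖Z k s‖ / l)) := fun k =>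
    ((measurable_Phi b).comp ((hZc k).norm.measurable.div_const l)).ennreal_ofReal
  -- Fatou's lemma, using that `Φ_b` is continuous.
  calc ∫⁻ r in Icc 0 (T - d), ENNReal.ofReal (Phi b (‖(del I - A) r (r + d)‖ / l))
      = ∫⁻ r in Icc 0 (T - d), liminf (fun k => ENNReal.ofReal (Phi b (‖Z k r‖ / l))) atTop := by
        refine lintegral_congr_ae ?_
        filter_upwards [hlim] with r hr
        have h1 : Tendsto (fun k => ‖Z k r‖ / l) atTop
            (𝓝[Ici 0] (‖(del I - A) r (r + d)‖ / l)) :=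
          tendsto_nhdsWithin_iff.2 ⟨(hr.norm).div_const l,
            Eventually.of_forall fun k => mem_Ici.2 (by positivity)⟩
        have h2 := (Phi_continuous hb _ (mem_Ici.2
          (show 0 ≤ ‖(del I - A) r (r + d)‖ / l by positivity))).tendsto.comp h1
        exact (ENNReal.tendsto_ofReal h2).liminf_eq.symm
    _ ≤ liminf (fun k => ∫⁻ r in Icc 0 (T - d), ENNReal.ofReal (Phi b (‖Z k r‖ / l))) atTop :=
        lintegral_liminf_le hmeas
    _ ≤ 1 := by
        refine liminf_le_of_le (by isBoundedDefault) fun x hx => ?_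
        obtain ⟨k, hk⟩ := hx.exists
        exact hk.trans ((setLIntegral_le_lintegral _ _).trans (hZ k))

end Sewing

/-! ### From dyadic to arbitrary scales, and the sewing lemma. -/

section Sewing

variable {V : Type*} [NormedAddCommGroup V]

/-- Passage from dyadic to all scales by greedy dyadic expansion. -/
theorem le_of_dyadic_subadditive {T a M : ℝ} (hT : 0 < T) (ha : 1 ≤ a) (hM : 0 ≤ M) {κ : ℝ → ℝ≥0∞}
    (hκ : ∀ (j : ℕ) (h : ℝ), T / 2 ^ (j + 1) < h → 2 * h ≤ T → h ≤ 2 * (T / 2 ^ (j + 1)) →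
      κ h ≤ ENNReal.ofReal (M * h ^ a) + κ (h - T / 2 ^ (j + 1)))
    (hlim : ∀ η : ℝ≥0, 0 < η → ∃ δ > 0, ∀ h, 0 < h → h ≤ δ → 2 * h ≤ T → κ h ≤ η)
    {h : ℝ} (h0 : 0 < h) (hT2 : 2 * h ≤ T) : κ h ≤ ENNReal.ofReal (2 * M * h ^ a) := by
  refine ENNReal.le_of_forall_pos_le_add fun η hη _ => ?_
  obtain ⟨δ, hδ, hδ'⟩ := hlim η hη
  have key : ∀ J : ℕ, ∀ h, 0 < h → 2 * h ≤ T → h ≤ 2 ^ J * δ →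
      κ h ≤ ENNReal.ofReal (2 * M * h ^ a) + η := by
    intro J
    induction J with
    | zero =>
      intro h h0 hT2 hh
      exact (hδ' h h0 (by simpa using hh) hT2).trans le_add_self
    | succ J ih =>
      intro h h0 hT2 hh
      obtain ⟨n, hn1, hn2⟩ := exists_nat_pow_near_of_lt_one (x := 2 * h / T) (y := 1 / 2)
        (by positivity) (by rw [div_le_one hT]; exact hT2) (by norm_num) (by norm_num)
      -- The dyadic scale with `d < h ≤ 2 * d`. Since `h - d ≤ h / 2` and `1 ≤ a`, the bound `2 * M
      -- * (h - d) ^ a` is at most `M * h ^ a`, so the induction closes with the same constant.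
      set d := T / 2 ^ (n + 1 + 1) with hd
      have hd1 : d < h := by
        rw [lt_div_iff₀ hT, one_div, inv_pow] at hn1
        have : d = (2 ^ (n + 1))⁻¹ * T / 2 := by rw [hd, pow_succ (2 : ℝ) (n + 1)]; field_simp
        linarith
      have hd2 : h ≤ 2 * d := by
        rw [div_le_iff₀ hT, one_div, inv_pow] at hn2
        have : 2 * d = (2 ^ n)⁻¹ * T / 2 := by
          rw [hd, pow_succ (2 : ℝ) (n + 1), pow_succ (2 : ℝ) n]; field_simp
        linarith
      have h1 := hκ (n + 1) h hd1 hT2 hd2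
      have h2 := ih (h - d) (by linarith) (by linarith) (by rw [pow_succ] at hh; linarith)
      have h3 : 2 * M * (h - d) ^ a ≤ M * h ^ a := by
        have e1 : (h - d) ^ a ≤ (h / 2) ^ a :=
          Real.rpow_le_rpow (by linarith) (by linarith) (by linarith)
        have e2 : (h / 2) ^ a ≤ h ^ a / 2 := by
          rw [Real.div_rpow h0.le (by norm_num)]
          have : (2 : ℝ) ≤ 2 ^ a := by
            simpa using Real.rpow_le_rpow_of_exponent_le (x := 2) (by norm_num) ha
          gcongr
        nlinarith
      calc κ h ≤ _ := h1
        _ ≤ ENNReal.ofReal (M * h ^ a) + (ENNReal.ofReal (M * h ^ a) + η) := by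
            gcongr
            refine h2.trans ?_
            gcongr
        _ = _ := by
            rw [← add_assoc, ← ENNReal.ofReal_add (by positivity) (by positivity)]
            congr 2; ring
  obtain ⟨J, hJ⟩ := pow_unbounded_of_one_lt (h / δ) (one_lt_two)
  exact key J h h0 hT2 (by rw [div_lt_iff₀ hδ] at hJ; exact hJ.le)

theorem sum_dyadic_le {a d M : ℝ} (ha : 1 < a) (hd : 0 < d) (hM : 0 ≤ M) (k : ℕ) :
    ∑ j ∈ Finset.range k, (2 : ℝ≥0∞) ^ j * ENNReal.ofReal (M * (d / 2 ^ j) ^ a) ≤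
      ENNReal.ofReal (M * (1 - 2 ^ (1 - a))⁻¹ * d ^ a) := by
  set x : ℝ := 2 ^ (1 - a) with hx
  have hx1 : x < 1 := Real.rpow_lt_one_of_one_lt_of_neg (by norm_num) (by linarith)
  have hx0 : 0 ≤ x := by positivity
  have e : ∀ j : ℕ, (2 : ℝ≥0∞) ^ j * ENNReal.ofReal (M * (d / 2 ^ j) ^ a) =
      ENNReal.ofReal (M * d ^ a * x ^ j) := by
    intro j
    rw [← ENNReal.ofReal_ofNat, ← ENNReal.ofReal_pow (by norm_num),
      ← ENNReal.ofReal_mul (by positivity)]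
    congr 1
    have hxj : x ^ j = 2 ^ j / ((2 : ℝ) ^ j) ^ a := by
      rw [hx, ← Real.rpow_natCast (2 ^ (1 - a)), ← Real.rpow_mul (by norm_num), sub_mul, one_mul,
        Real.rpow_sub (by norm_num), Real.rpow_natCast, mul_comm a, Real.rpow_mul (by norm_num),
        Real.rpow_natCast]
    rw [Real.div_rpow hd.le (by positivity), hxj]
    ring
  simp only [e]
  rw [← ENNReal.ofReal_sum_of_nonneg fun j _ => by positivity]
  refine ENNReal.ofReal_le_ofReal ?_
  rw [← Finset.mul_sum]
  have h1 : ∑ j ∈ Finset.range k, x ^ j ≤ (1 - x)⁻¹ := by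
    rw [← tsum_geometric_of_lt_one hx0 hx1]
    exact (summable_geometric_of_lt_one hx0 hx1).sum_le_tsum _ fun _ _ => by positivity
  calc _ ≤ M * d ^ a * (1 - x)⁻¹ := by gcongr
    _ = _ := by ring

/-- Uniform continuity of the path. No rate is needed: this only terminates the greedy dyadic
expansion. -/
theorem exists_secNorm_del_le {b T : ℝ} (hb : 0 < b) {f : ℝ → V} (hf : ContinuousOn f (Icc 0 T))
    {η : ℝ≥0} (hη : 0 < η) :
    ∃ δ > 0, ∀ h, 0 < h → h ≤ δ → h ≤ T → secNorm b T (del f) h ≤ η := by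
  have huc := isCompact_Icc.uniformContinuousOn_of_continuous hf
  rw [Metric.uniformContinuousOn_iff_le] at huc
  have hK : 0 < luxOne b T := by
    simp only [luxOne, Real.toNNReal_pos]
    exact lt_max_of_lt_left one_pos
  obtain ⟨δ, hδ, h⟩ := huc (η / luxOne b T : ℝ≥0) (by positivity)
  refine ⟨δ, hδ, fun t ht0 htδ htT => ?_⟩
  refine (luxNorm_le_of_bound hb (T := T) (η / luxOne b T) ?_ ?_).trans (le_of_eq ?_)
  · rw [Real.volume_Icc]
    exact ENNReal.ofReal_le_ofReal (by linarith)
  · refine (ae_restrict_iff' measurableSet_Icc).2 (ae_of_all _ fun r hr => ?_)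
    have := h (r + t) ⟨by linarith [hr.1], by linarith [hr.2]⟩ r ⟨hr.1, by linarith [hr.2]⟩
      (by simpa [Real.dist_eq, abs_of_pos ht0] using htδ)
    simpa [del, dist_eq_norm] using this
  · rw [← ENNReal.coe_mul, div_mul_cancel₀ _ hK.ne']

variable [NormedSpace ℝ V]

/-- The sewing lemma in exponential Orlicz spaces. -/
theorem exists_sewing [CompleteSpace V] {b T α a M₁ M₂ : ℝ} (hb : 0 < b) (hT : 0 < T)
    (hα : 0 < α) (ha : 1 < a) (hM₁ : 0 ≤ M₁) (hM₂ : 0 ≤ M₂) {A : ℝ → ℝ → V} (hA : SecMeas T A)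
    (H₁ : ∀ h, 0 < h → 2 * h ≤ T → secNorm b T A h ≤ ENNReal.ofReal (M₁ * h ^ α))
    (H₂ : ∀ h, 0 < h → 2 * h ≤ T → ∀ θ ∈ Icc (0 : ℝ) 1, luxNorm b (Icc 0 (T - h))
      (fun r => del2 A r (r + θ * h) (r + h)) ≤ ENNReal.ofReal (M₂ * h ^ a)) :
    ∃ I : ℝ → V, ContinuousOn I (Icc 0 T) ∧ I 0 = 0 ∧ ∃ M : ℝ, 0 ≤ M ∧
      ∀ h, 0 < h → 2 * h ≤ T → secNorm b T (del I - A) h ≤ ENNReal.ofReal (M * h ^ a) := by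
  have H₂' : ∀ h, 0 < h → 2 * h ≤ T → luxNorm b (Icc 0 (T - h))
      (fun r => del2 A r (r + h / 2) (r + h)) ≤ ENNReal.ofReal (M₂ * h ^ a) := by
    intro h h0 h2
    have := H₂ h h0 h2 (1 / 2) ⟨by norm_num, by norm_num⟩
    have e : 1 / 2 * h = h / 2 := by ring
    rwa [e] at this
  obtain ⟨I, hIc, hI0, hI⟩ := exists_sewing_limit hb hT hα ha hM₁ hM₂ hA H₁ H₂'
  have hx1 : (2 : ℝ) ^ (1 - a) < 1 :=
    Real.rpow_lt_one_of_one_lt_of_neg (by norm_num) (by linarith)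
  set B := M₂ * (1 - 2 ^ (1 - a))⁻¹ with hB
  have hB0 : 0 ≤ B := mul_nonneg hM₂ (inv_nonneg.2 (by linarith))
  have hd2 : ∀ j : ℕ, 2 * (T / 2 ^ (j + 1)) ≤ T := fun j => by
    have : 2 * (T / 2 ^ (j + 1)) = T / 2 ^ j := by rw [pow_succ]; field_simp
    rw [this]
    exact div_le_self hT.le (one_le_pow₀ (by norm_num))
  have hdy : ∀ j : ℕ, secNorm b T (del I - A) (T / 2 ^ (j + 1)) ≤
      ENNReal.ofReal (B * (T / 2 ^ (j + 1)) ^ a) := by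
    intro j
    refine secNorm_sewing_dyadic hb hT hA
      (fun h h0 h2 => ((H₁ h h0 h2).trans_lt ENNReal.ofReal_lt_top).ne) hI j fun k => ?_
    have hd0 : 0 < T / 2 ^ (j + 1) := by positivity
    exact (secNorm_dyadicSum_sub_le hb hA (H := T / 2) (by linarith)
      (ω := fun h => ENNReal.ofReal (M₂ * h ^ a)) (fun h h0 h2 => H₂' h h0 (by linarith)) k hd0
      (by linarith [hd2 j])).trans (sum_dyadic_le ha hd0 hM₂ k)
  have hKm : SecMeas T (del I - A) := (secMeas_del hIc).sub hA
  refine ⟨I, hIc, hI0, 2 * (B + M₂), by positivity, fun h h0 h2 =>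
    le_of_dyadic_subadditive hT ha.le (by positivity) (κ := secNorm b T (del I - A))
      (fun j h hdh h2 hhd => ?_) (fun η hη => ?_) h0 h2⟩
  · have hd0 : 0 < T / 2 ^ (j + 1) := by positivity
    have hdj := hdy j
    have hdj2 := hd2 j
    set d := T / 2 ^ (j + 1)
    have h0 : 0 < h := hd0.trans hdh
    -- Cutting an interval of length `h` at a dyadic length `d` needs the defect at ratio `d / h`;
    -- the dyadic construction itself only used the ratio `1 / 2`.
    have e : ∀ r, (del I - A) r (r + h) = ((del I - A) r (r + d) +
        (del I - A) (r + d) (r + d + (h - d))) - del2 A r (r + d / h * h) (r + h) := by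
      intro r
      have e1 : d / h * h = d := by field_simp
      have e2 : r + d + (h - d) = r + h := by ring
      simp only [Pi.sub_apply, del, del2, e1, e2]
      abel
    have m1 := hKm.shift (c := 0) (h := d) (H := h) le_rfl hd0.le (by linarith) (by linarith)
    have l1 := luxNorm_shift_le_secNorm (T := T) hb (del I - A) (c := 0) (h := d) (H := h) le_rfl
      (by linarith)
    have m2 := hKm.shift (c := d) (h := h - d) (H := h) hd0.le (by linarith) (by linarith)
      (by linarith)
    have l2 := luxNorm_shift_le_secNorm (T := T) hb (del I - A) (c := d) (h := h - d) (H := h)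
      hd0.le (by linarith)
    simp only [add_zero] at m1 l1
    calc secNorm b T (del I - A) h
        ≤ secNorm b T (del I - A) d + secNorm b T (del I - A) (h - d) +
            ENNReal.ofReal (M₂ * h ^ a) := by
          conv_lhs => unfold secNorm
          simp only [e]
          refine (luxNorm_sub_le hb (m1.add m2)).trans (add_le_add ?_
            (H₂ h h0 h2 (d / h) ⟨by positivity, (div_le_one h0).2 hdh.le⟩))
          exact (luxNorm_add_le hb m1).trans (add_le_add l1 l2)
      _ ≤ ENNReal.ofReal (B * h ^ a) + secNorm b T (del I - A) (h - d) +
            ENNReal.ofReal (M₂ * h ^ a) := by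
          gcongr
          refine hdj.trans (ENNReal.ofReal_le_ofReal ?_)
          gcongr
      _ = _ := by
          rw [add_mul, ENNReal.ofReal_add (by positivity) (by positivity)]
          ring
  · obtain ⟨δ, hδ, hδ'⟩ := exists_secNorm_del_le hb hIc (η := η / 2) (by positivity)
    have hlim : Tendsto (fun h : ℝ => ENNReal.ofReal (M₁ * h ^ α)) (𝓝 0) (𝓝 0) := by
      have : Tendsto (fun h : ℝ => M₁ * h ^ α) (𝓝 0) (𝓝 (M₁ * 0 ^ α)) :=
        ((Real.continuous_rpow_const hα.le).tendsto 0).const_mul M₁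
      rw [Real.zero_rpow hα.ne', mul_zero] at this
      simpa using ENNReal.tendsto_ofReal this
    have hev := hlim.eventually (gt_mem_nhds (show (0 : ℝ≥0∞) < ((η / 2 : ℝ≥0) : ℝ≥0∞) by
      have : 0 < η / 2 := by positivity
      exact_mod_cast this))
    obtain ⟨δ', hδ'0, hball⟩ := Metric.eventually_nhds_iff.1 hev
    refine ⟨min δ (δ' / 2), by positivity, fun h h0 hh h2 => ?_⟩
    have a1 := hδ' h h0 (hh.trans (min_le_left _ _)) (by linarith)
    have a2 : secNorm b T A h ≤ ((η / 2 : ℝ≥0) : ℝ≥0∞) := (H₁ h h0 h2).trans (hball (by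
      have := hh.trans (min_le_right _ _)
      rw [Real.dist_eq, sub_zero, abs_of_pos h0]; linarith)).le
    calc secNorm b T (del I - A) h ≤ secNorm b T (del I) h + secNorm b T A h :=
          luxNorm_sub_le hb (secMeas_del hIc h ⟨h0.le, by linarith⟩)
      _ ≤ ((η / 2 : ℝ≥0) : ℝ≥0∞) + ((η / 2 : ℝ≥0) : ℝ≥0∞) := add_le_add a1 a2
      _ = η := by rw [← ENNReal.coe_add, add_halves]

end Sewing

/-! ### Moduli -/

section Modulus

variable {V : Type*} [NormedAddCommGroup V]

theorem modulus2_mono (b T : ℝ) (A : ℝ → ℝ → V) : Monotone (modulus2 b T A) := fun _ _ h =>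
  iSup₂_le fun u hu => le_iSup₂_of_le u ⟨hu.1, hu.2.trans h⟩ le_rfl

theorem modulus3_mono (b T : ℝ) (A : ℝ → ℝ → ℝ → V) : Monotone (modulus3 b T A) := fun _ _ h =>
  iSup₂_le fun θ hθ => iSup₂_le fun u hu =>
    le_iSup₂_of_le θ hθ (le_iSup₂_of_le u ⟨hu.1, hu.2.trans h⟩ le_rfl)

theorem secNorm_le_modulus2 {b T : ℝ} (A : ℝ → ℝ → V) {h τ : ℝ} (h0 : 0 ≤ h) (hτ : h ≤ τ) :
    secNorm b T A h ≤ modulus2 b T A τ :=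
  le_iSup₂_of_le (f := fun h (_ : h ∈ Icc (0 : ℝ) τ) => secNorm b T A h) h ⟨h0, hτ⟩ le_rfl

theorem modulus2_le {b T τ : ℝ} {A : ℝ → ℝ → V} {L : ℝ≥0∞}
    (h : ∀ u, 0 ≤ u → u ≤ τ → secNorm b T A u ≤ L) : modulus2 b T A τ ≤ L :=
  iSup₂_le fun u hu => h u hu.1 hu.2

theorem luxNorm_le_modulus3 {b T : ℝ} (A : ℝ → ℝ → ℝ → V) {h τ θ : ℝ} (hθ : θ ∈ Icc (0 : ℝ) 1)
    (h0 : 0 ≤ h) (hτ : h ≤ τ) :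
    luxNorm b (Icc 0 (T - h)) (fun r => A r (r + θ * h) (r + h)) ≤ modulus3 b T A τ :=
  le_iSup₂_of_le (f := fun θ (_ : θ ∈ Icc (0 : ℝ) 1) => ⨆ h ∈ Icc (0 : ℝ) τ,
    luxNorm b (Icc 0 (T - h)) (fun r => A r (r + θ * h) (r + h))) θ hθ
    (le_iSup₂_of_le (f := fun h (_ : h ∈ Icc (0 : ℝ) τ) =>
      luxNorm b (Icc 0 (T - h)) (fun r => A r (r + θ * h) (r + h))) h ⟨h0, hτ⟩ le_rfl)

theorem modulus3_le {b T τ : ℝ} {A : ℝ → ℝ → ℝ → V} {L : ℝ≥0∞}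
    (h : ∀ θ ∈ Icc (0 : ℝ) 1, ∀ u, 0 ≤ u → u ≤ τ →
      luxNorm b (Icc 0 (T - u)) (fun r => A r (r + θ * u) (r + u)) ≤ L) : modulus3 b T A τ ≤ L :=
  iSup₂_le fun θ hθ => iSup₂_le fun u hu => h θ hθ u hu.1 hu.2

/-- The pointwise bound on the Orlicz modulus up to half of the time horizon. -/
theorem modulus2_le_boNorm2 {a b T : ℝ} (ha : 0 ≤ a) {r : ℝ≥0∞} (hr : r ≠ 0) (A : ℝ → ℝ → V)
    {h : ℝ} (h0 : 0 < h) (h2 : 2 * h ≤ T) :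
    modulus2 b T A h ≤ supConst a r * ENNReal.ofReal (h ^ a) * boNorm2 a b r T A :=
  le_scaleNorm ha hr (modulus2_mono b T A) h0 h2

theorem secNorm_le_boNorm2 {a b T : ℝ} (ha : 0 ≤ a) {r : ℝ≥0∞} (hr : r ≠ 0) (A : ℝ → ℝ → V)
    {h : ℝ} (h0 : 0 < h) (h2 : 2 * h ≤ T) :
    secNorm b T A h ≤ supConst a r * ENNReal.ofReal (h ^ a) * boNorm2 a b r T A :=
  (secNorm_le_modulus2 A h0.le le_rfl).trans (modulus2_le_boNorm2 ha hr A h0 h2)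

theorem secNorm_le_boNorm2_real {a b T : ℝ} (ha : 0 ≤ a) {r : ℝ≥0∞} (hr : r ≠ 0) (A : ℝ → ℝ → V)
    (hA : boNorm2 a b r T A ≠ ⊤) {h : ℝ} (h0 : 0 < h) (h2 : 2 * h ≤ T) :
    secNorm b T A h ≤
      ENNReal.ofReal (supConst a r * (boNorm2 a b r T A).toReal * h ^ a) := by
  refine (secNorm_le_boNorm2 ha hr A h0 h2).trans (le_of_eq ?_)
  rw [ENNReal.ofReal_mul (by positivity), ENNReal.ofReal_mul (by positivity),
    ENNReal.ofReal_toReal hA, ENNReal.ofReal_coe_nnreal]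
  ring

theorem secNorm_add_le {b T : ℝ} (hb : 0 < b) {A B : ℝ → ℝ → V} (hA : SecMeas T A) {h : ℝ}
    (h0 : 0 ≤ h) (hT : h ≤ T) :
    secNorm b T (A + B) h ≤ secNorm b T A h + secNorm b T B h :=
  luxNorm_add_le hb (hA h ⟨h0, hT⟩)

theorem secNorm_sub_le {b T : ℝ} (hb : 0 < b) {A B : ℝ → ℝ → V} (hA : SecMeas T A) {h : ℝ}
    (h0 : 0 ≤ h) (hT : h ≤ T) :
    secNorm b T (A - B) h ≤ secNorm b T A h + secNorm b T B h :=
  luxNorm_sub_le hb (hA h ⟨h0, hT⟩)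

theorem modulus2_add_le {b T : ℝ} (hb : 0 < b) {A B : ℝ → ℝ → V} (hA : SecMeas T A) {τ : ℝ}
    (hτ : τ ≤ T) : modulus2 b T (A + B) τ ≤ modulus2 b T A τ + modulus2 b T B τ :=
  modulus2_le fun _ h0 h1 => (secNorm_add_le hb hA h0 (h1.trans hτ)).trans
    (add_le_add (secNorm_le_modulus2 A h0 h1) (secNorm_le_modulus2 B h0 h1))

theorem boNorm2_add_le {a b T : ℝ} {r : ℝ≥0∞} (hb : 0 < b) {A B : ℝ → ℝ → V} (hA : SecMeas T A) :
    boNorm2 a b r T (A + B) ≤ lpAddConst r * (boNorm2 a b r T A + boNorm2 a b r T B) :=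
  (scaleNorm_mono fun _ _ h1 => modulus2_add_le hb hA h1.le).trans
    (scaleNorm_add_le (modulus2_mono b T A).measurable (modulus2_mono b T B).measurable)

/-- Domination of sections gives domination of norms. -/
theorem boNorm2_le_mul {W : Type*} [NormedAddCommGroup W] {a b T : ℝ} {r : ℝ≥0∞} (hb : 0 < b)
    {A : ℝ → ℝ → V} {B : ℝ → ℝ → W} (c : ℝ≥0)
    (h : ∀ s t, 0 ≤ s → s ≤ t → t ≤ T → ‖A s t‖ ≤ c * ‖B s t‖) :
    boNorm2 a b r T A ≤ c * boNorm2 a b r T B := by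
  refine scaleNorm_le_mul c fun τ h0 h1 => modulus2_le fun u u0 u1 => ?_
  refine (luxNorm_mono hb c ?_).trans (by gcongr; exact secNorm_le_modulus2 B u0 u1)
  refine (ae_restrict_iff' measurableSet_Icc).2 (ae_of_all _ fun s hs => ?_)
  exact h s (s + u) hs.1 (by linarith) (by linarith [hs.2])

theorem secNorm_le_mul {W : Type*} [NormedAddCommGroup W] {b T : ℝ} (hb : 0 < b)
    {A : ℝ → ℝ → V} {B : ℝ → ℝ → W} (c : ℝ≥0)
    (h : ∀ s t, 0 ≤ s → s ≤ t → t ≤ T → ‖A s t‖ ≤ c * ‖B s t‖) {u : ℝ} (u0 : 0 ≤ u) :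
    secNorm b T A u ≤ c * secNorm b T B u := by
  refine luxNorm_mono hb c ?_
  refine (ae_restrict_iff' measurableSet_Icc).2 (ae_of_all _ fun s hs => ?_)
  exact h s (s + u) hs.1 (by linarith) (by linarith [hs.2])

theorem luxNorm_one_ne_top {b T : ℝ} (hb : 0 < b) {D : Set ℝ} (hD : volume D ≤ ENNReal.ofReal T) :
    luxNorm b D (fun _ => (1 : ℝ)) ≤ luxOne b T := by
  simpa using luxNorm_le_of_bound hb (f := fun _ : ℝ => (1 : ℝ)) 1 hD (by simp)

/-- Embedding between exponential Orlicz spaces on a bounded set. -/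
theorem luxNorm_embed {b b₁ b₂ T : ℝ} (h₁ : 0 < b₁) (h₂ : 0 < b₂) (hb : 0 < b)
    (h : 1 / b = 1 / b₁ + 1 / b₂) {D : Set ℝ} (hD : volume D ≤ ENNReal.ofReal T) {f : ℝ → V}
    (hf : AEStronglyMeasurable f (volume.restrict D)) :
    luxNorm b D f ≤ 2 * luxOne b₂ T * luxNorm b₁ D f := by
  have hone : 0 < luxOne b₂ T := by
    simp only [luxOne, Real.toNNReal_pos]
    exact lt_max_of_lt_left one_pos
  rcases eq_or_ne (luxNorm b₁ D f) ⊤ with hF | hF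
  · rw [hF, ENNReal.mul_top]
    · exact le_top
    · simp [hone.ne']
  have h1 := luxNorm_one_ne_top h₂ hD
  have := luxNorm_mul_le h₁ h₂ hb h (f := f) (g := fun _ => (1 : ℝ)) (k := f) 1 hf hF
    (h1.trans_lt ENNReal.coe_lt_top).ne (by simp)
  refine this.trans ?_
  rw [ENNReal.coe_one, mul_one]
  calc 2 * (luxNorm b₁ D f * luxNorm b₂ D fun _ => (1 : ℝ))
      ≤ 2 * (luxNorm b₁ D f * luxOne b₂ T) := by gcongr
    _ = _ := by ring

theorem secNorm_embed {b b₁ b₂ T : ℝ} (h₁ : 0 < b₁) (h₂ : 0 < b₂) (hb : 0 < b)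
    (h : 1 / b = 1 / b₁ + 1 / b₂) {A : ℝ → ℝ → V} (hA : SecMeas T A) {u : ℝ} (u0 : 0 ≤ u)
    (uT : u ≤ T) : secNorm b T A u ≤ 2 * luxOne b₂ T * secNorm b₁ T A u :=
  luxNorm_embed h₁ h₂ hb h (by rw [Real.volume_Icc]; exact ENNReal.ofReal_le_ofReal (by linarith))
    (hA u ⟨u0, uT⟩)

end Modulus

/-! ### Products -/

section Products

variable {E F G : Type*} [NormedAddCommGroup E] [NormedSpace ℝ E] [NormedAddCommGroup F]
  [NormedSpace ℝ F] [NormedAddCommGroup G] [NormedSpace ℝ G]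

theorem aestronglyMeasurable_bilin (L : E →L[ℝ] F →L[ℝ] G) {T : ℝ} {A : ℝ → ℝ → E}
    {B : ℝ → ℝ → F} (hA : SecMeas T A) (hB : SecMeas T B) {θ h : ℝ} (hθ : θ ∈ Icc (0 : ℝ) 1)
    (h0 : 0 ≤ h) (hT : h ≤ T) :
    AEStronglyMeasurable (fun r => L (A r (r + θ * h)) (B (r + θ * h) (r + h)))
      (volume.restrict (Icc 0 (T - h))) := by
  have t0 : 0 ≤ θ * h := mul_nonneg hθ.1 h0
  have t1 : θ * h ≤ h := mul_le_of_le_one_left h0 hθ.2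
  have m1 := hA.shift (c := 0) (h := θ * h) (H := h) le_rfl t0 (by linarith) (by linarith)
  have m2 := hB.shift (c := θ * h) (h := h - θ * h) (H := h) t0 (by linarith) (by linarith)
    (by linarith)
  have e : ∀ r, r + θ * h + (h - θ * h) = r + h := fun r => by ring
  simp only [add_zero] at m1
  simp only [e] at m2
  exact L.aestronglyMeasurable_comp₂ m1 m2

/-- The two factors are sections of lengths `θ * h` and `h - θ * h`, both at most `τ`, so their
moduli at `τ` dominate uniformly in `θ`. -/
theorem luxNorm_bilin_le (L : E →L[ℝ] F →L[ℝ] G) {b b₁ b₂ T : ℝ} (h₁ : 0 < b₁) (h₂ : 0 < b₂)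
    (hb : 0 < b) (hbb : 1 / b = 1 / b₁ + 1 / b₂) {A : ℝ → ℝ → E} {B : ℝ → ℝ → F}
    (hA : SecMeas T A) {θ h τ : ℝ} (hθ : θ ∈ Icc (0 : ℝ) 1) (h0 : 0 ≤ h)
    (hτ : h ≤ τ) (hT : h ≤ T) (fA : modulus2 b₁ T A τ ≠ ⊤) (fB : modulus2 b₂ T B τ ≠ ⊤) :
    luxNorm b (Icc 0 (T - h)) (fun r => L (A r (r + θ * h)) (B (r + θ * h) (r + h))) ≤
      2 * ‖L‖₊ * (modulus2 b₁ T A τ * modulus2 b₂ T B τ) := by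
  have t0 : 0 ≤ θ * h := mul_nonneg hθ.1 h0
  have t1 : θ * h ≤ h := mul_le_of_le_one_left h0 hθ.2
  have m1 := hA.shift (c := 0) (h := θ * h) (H := h) le_rfl t0 (by linarith) (by linarith)
  have l1 := (luxNorm_shift_le_secNorm (T := T) h₁ A (c := 0) (h := θ * h) (H := h) le_rfl
    (by linarith)).trans (secNorm_le_modulus2 A t0 (t1.trans hτ))
  have l2 := (luxNorm_shift_le_secNorm (T := T) h₂ B (c := θ * h) (h := h - θ * h) (H := h) t0
    (by linarith)).trans (secNorm_le_modulus2 B (by linarith) (τ := τ) (by linarith))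
  have e : ∀ r, r + θ * h + (h - θ * h) = r + h := fun r => by ring
  simp only [add_zero] at m1 l1
  simp only [e] at l2
  refine (luxNorm_mul_le h₁ h₂ hb hbb ‖L‖₊ m1 (l1.trans_lt fA.lt_top).ne
    (l2.trans_lt fB.lt_top).ne (ae_of_all _ fun r => ?_)).trans ?_
  · simpa [mul_assoc] using L.le_opNorm₂ (A r (r + θ * h)) (B (r + θ * h) (r + h))
  · gcongr

/-- A bounded factor leaves the Orlicz exponent of the other unchanged, in contrast to Hölder's
inequality. This is what gives estimates in `Φ_{β/2}` instead of `Φ_{β/3}`. -/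
theorem luxNorm_bilin_le_left (L : E →L[ℝ] F →L[ℝ] G) {b T : ℝ} (hb : 0 < b) {A : ℝ → ℝ → E}
    {B : ℝ → ℝ → F} {θ h τ : ℝ} (hθ : θ ∈ Icc (0 : ℝ) 1) (h0 : 0 ≤ h) (hτ : h ≤ τ) (c : ℝ≥0)
    (hB : ∀ s t, 0 ≤ s → s ≤ t → t ≤ T → t - s ≤ τ → ‖B s t‖ ≤ c) :
    luxNorm b (Icc 0 (T - h)) (fun r => L (A r (r + θ * h)) (B (r + θ * h) (r + h))) ≤
      ‖L‖₊ * c * modulus2 b T A τ := by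
  have t0 : 0 ≤ θ * h := mul_nonneg hθ.1 h0
  have t1 : θ * h ≤ h := mul_le_of_le_one_left h0 hθ.2
  have l1 := (luxNorm_shift_le_secNorm (T := T) hb A (c := 0) (h := θ * h) (H := h) le_rfl
    (by linarith)).trans (secNorm_le_modulus2 A t0 (t1.trans hτ))
  simp only [add_zero] at l1
  refine (luxNorm_mono hb (f := fun r => A r (r + θ * h)) (‖L‖₊ * c) ?_).trans ?_
  · refine (ae_restrict_iff' measurableSet_Icc).2 (ae_of_all _ fun r hr => ?_)
    have h1 := L.le_opNorm₂ (A r (r + θ * h)) (B (r + θ * h) (r + h))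
    have h2 := hB (r + θ * h) (r + h) (by linarith [hr.1]) (by linarith) (by linarith [hr.2])
      (by linarith)
    refine h1.trans ?_
    push_cast
    rw [mul_right_comm]
    gcongr
  · push_cast
    gcongr

theorem luxNorm_bilin_le_right (L : E →L[ℝ] F →L[ℝ] G) {b T : ℝ} (hb : 0 < b) {A : ℝ → ℝ → E}
    {B : ℝ → ℝ → F} {θ h τ : ℝ} (hθ : θ ∈ Icc (0 : ℝ) 1) (h0 : 0 ≤ h) (hτ : h ≤ τ) (c : ℝ≥0)
    (hA : ∀ s t, 0 ≤ s → s ≤ t → t ≤ T → t - s ≤ τ → ‖A s t‖ ≤ c) :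
    luxNorm b (Icc 0 (T - h)) (fun r => L (A r (r + θ * h)) (B (r + θ * h) (r + h))) ≤
      ‖L‖₊ * c * modulus2 b T B τ := by
  have t0 : 0 ≤ θ * h := mul_nonneg hθ.1 h0
  have t1 : θ * h ≤ h := mul_le_of_le_one_left h0 hθ.2
  have l2 := (luxNorm_shift_le_secNorm (T := T) hb B (c := θ * h) (h := h - θ * h) (H := h) t0
    (by linarith)).trans (secNorm_le_modulus2 B (by linarith) (τ := τ) (by linarith))
  have e : ∀ r, r + θ * h + (h - θ * h) = r + h := fun r => by ring
  simp only [e] at l2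
  refine (luxNorm_mono hb (f := fun r => B (r + θ * h) (r + h)) (‖L‖₊ * c) ?_).trans ?_
  · refine (ae_restrict_iff' measurableSet_Icc).2 (ae_of_all _ fun r hr => ?_)
    have h1 := L.le_opNorm₂ (A r (r + θ * h)) (B (r + θ * h) (r + h))
    have h2 := hA r (r + θ * h) hr.1 (by linarith) (by linarith [hr.2]) (by linarith)
    refine h1.trans ?_
    push_cast
    gcongr
  · push_cast
    gcongr

end Products

/-! ### Hölder bounds in terms of the Besov–Orlicz seminorm -/

theorem exists_holder_boSemi (V : Type*) [NormedAddCommGroup V] [NormedSpace ℝ V] [CompleteSpace V]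
    {a b p : ℝ} {r : ℝ≥0∞} (hr : r ≠ 0) (hb : 0 < b) (hp : 1 ≤ p) (hbp : b ≤ p)
    (hap : 1 / p < a) :
    ∃ C : ℝ≥0, ∀ (T : ℝ) (f : ℝ → V), ContinuousOn f (Icc 0 T) → boSemi a b r T f ≠ ⊤ →
      ∀ s t, 0 ≤ s → s ≤ t → t ≤ T →
        ‖f t - f s‖ ≤ C * (boSemi a b r T f).toReal * (t - s) ^ (a - 1 / p) := by
  have ha : 0 ≤ a := le_trans (by positivity) hap.le
  obtain ⟨C, hC0, hC⟩ := exists_holder V hb hp hbp hap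
  refine ⟨C.toNNReal * supConst a r, fun T f hf hN s t hs hst ht => ?_⟩
  refine (hC T (supConst a r * (boSemi a b r T f).toReal) f (by positivity) hf
    (fun h h0 h2 => secNorm_le_boNorm2_real ha hr (del f) hN h0 h2) s t hs hst ht).trans
    (le_of_eq ?_)
  rw [NNReal.coe_mul, Real.coe_toNNReal C hC0]
  ring

/-! ### The bilinear maps of the rough integral -/

section Algebra

variable {m n : ℕ}

theorem matOp_apply (A : Mat m n) (v : Vec n) (i : Fin m) :
    matOp A v i = ∑ j, A (i, j) * v j := by
  simp [matOp, Matrix.toLpLin_apply, Matrix.mulVec, dotProduct]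

theorem tensorAct_apply (A : Vec n →L[ℝ] Mat m n) (M : Mat n n) (i : Fin m) :
    tensorAct A M i = ∑ k, ∑ j, A (EuclideanSpace.single k 1) (i, j) * M (k, j) := rfl

theorem outer_apply (a : Vec m) (b : Vec n) (ij : Fin m × Fin n) :
    outer a b ij = a ij.1 * b ij.2 := rfl

/-- `matOp` as a continuous linear map. -/
def matOpL (m n : ℕ) : Mat m n →L[ℝ] Vec n →L[ℝ] Vec m :=
  LinearMap.toContinuousLinearMap
    { toFun := matOp
      map_add' := fun A B => by
        ext v i
        simp [matOp_apply, add_mul, Finset.sum_add_distrib]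
      map_smul' := fun c A => by
        ext v i
        simp [matOp_apply, Finset.mul_sum, mul_assoc] }

@[simp] theorem matOpL_apply (A : Mat m n) : matOpL m n A = matOp A := rfl

/-- `tensorAct` as a continuous bilinear map. -/
def tensorActL (m n : ℕ) : (Vec n →L[ℝ] Mat m n) →L[ℝ] Mat n n →L[ℝ] Vec m :=
  LinearMap.toContinuousLinearMap
    { toFun := fun A => LinearMap.toContinuousLinearMap
        { toFun := tensorAct A
          map_add' := fun M N => by
            ext i
            simp [tensorAct_apply, mul_add, Finset.sum_add_distrib]
          map_smul' := fun c M => by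
            ext i
            simp [tensorAct_apply, Finset.mul_sum, mul_left_comm] }
      map_add' := fun A B => by
        ext M i
        simp [tensorAct_apply, add_mul, Finset.sum_add_distrib]
      map_smul' := fun c A => by
        ext M i
        simp [tensorAct_apply, Finset.mul_sum, mul_assoc] }

theorem tensorAct_outer (A : Vec n →L[ℝ] Mat m n) (a b : Vec n) :
    tensorAct A (outer a b) = matOp (A a) b := by
  ext i
  have ha : A a = ∑ k, a k • A (EuclideanSpace.single k 1) := by
    conv_lhs => rw [← (EuclideanSpace.basisFun (Fin n) ℝ).sum_repr a]
    simp
  rw [tensorAct_apply, matOp_apply, ha, Finset.sum_comm]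
  refine Finset.sum_congr rfl fun j _ => ?_
  simp only [outer_apply, WithLp.ofLp_sum, WithLp.ofLp_smul, Finset.sum_apply, Pi.smul_apply,
    smul_eq_mul, Finset.sum_mul]
  exact Finset.sum_congr rfl fun k _ => by ring

theorem roughXi_eq (X : ℝ → Vec n) (XX : ℝ → ℝ → Mat n n) (Y : ℝ → Mat m n)
    (Y' : ℝ → Vec n →L[ℝ] Mat m n) (s t : ℝ) :
    roughXi X XX Y Y' s t = matOpL m n (Y s) (del X s t) + tensorActL m n (Y' s) (XX s t) := rfl

/-- The defect of additivity of the local approximation. -/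
theorem del2_roughXi {X : ℝ → Vec n} {XX : ℝ → ℝ → Mat n n} {s u t : ℝ}
    (hc : XX s t - XX s u - XX u t = outer (del X s u) (del X u t)) (Y : ℝ → Mat m n)
    (Y' : ℝ → Vec n →L[ℝ] Mat m n) :
    del2 (roughXi X XX Y Y') s u t =
      -(matOpL m n (remainder X Y Y' s u) (del X u t)) -
        tensorActL m n (del Y' s u) (XX u t) := by
  have hW : XX s t = XX s u + XX u t + outer (del X s u) (del X u t) := by rw [← hc]; abel
  have hX : del X s t = del X s u + del X u t := by simp [del]
  -- Chen's relation contributes this term; together with `δY` it forms the remainder of `Y`, which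
  -- raises the order of the defect to `3α`.
  have hout : tensorActL m n (Y' s) (outer (del X s u) (del X u t)) =
      matOpL m n (Y' s (del X s u)) (del X u t) := tensorAct_outer _ _ _
  simp only [del2, roughXi_eq, hW, hX, map_add, hout]
  have hR : remainder X Y Y' s u = Y u - Y s - Y' s (del X s u) := rfl
  have hY' : del Y' s u = Y' u - Y' s := rfl
  rw [hR, hY']
  simp only [map_sub, sub_apply]
  abel

end Algebra

/-! ### Products of sections -/

theorem luxNorm_congr {V : Type*} [NormedAddCommGroup V] {b : ℝ} {D : Set ℝ} (hD : MeasurableSet D) {f g : ℝ → V}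
    (h : ∀ r ∈ D, f r = g r) : luxNorm b D f = luxNorm b D g := by
  unfold luxNorm
  have : ∀ l : ℝ, ∫⁻ r in D, ENNReal.ofReal (Phi b (‖f r‖ / l)) =
      ∫⁻ r in D, ENNReal.ofReal (Phi b (‖g r‖ / l)) := fun l =>
    setLIntegral_congr_fun hD fun r hr => by rw [h r hr]
  simp only [this]

section Products

variable {E F E' F' G : Type*} [NormedAddCommGroup E] [NormedSpace ℝ E] [NormedAddCommGroup F]
  [NormedSpace ℝ F] [NormedAddCommGroup E'] [NormedSpace ℝ E'] [NormedAddCommGroup F']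
  [NormedSpace ℝ F'] [NormedAddCommGroup G] [NormedSpace ℝ G]

variable {L : E →L[ℝ] F →L[ℝ] G} {L' : E' →L[ℝ] F' →L[ℝ] G} {T : ℝ} {A : ℝ → ℝ → ℝ → G}
  {R : ℝ → ℝ → E} {x : ℝ → ℝ → F} {y : ℝ → ℝ → E'} {W : ℝ → ℝ → F'}

/-- The Orlicz modulus of `-(R x) - y W` in terms of those of the factors. -/
theorem modulus3_le_of_products
    (hA : ∀ s u t, 0 ≤ s → s ≤ u → u ≤ t → t ≤ T →
      A s u t = -(L (R s u) (x u t)) - L' (y s u) (W u t)) (hR : SecMeas T R) (hx : SecMeas T x)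
    {b τ : ℝ} (hb : 0 < b) (hT : τ ≤ T) {c c' : ℝ≥0∞}
    (h₁ : ∀ θ ∈ Icc (0 : ℝ) 1, ∀ h, 0 ≤ h → h ≤ τ → luxNorm b (Icc 0 (T - h))
      (fun r => L (R r (r + θ * h)) (x (r + θ * h) (r + h))) ≤ c)
    (h₂ : ∀ θ ∈ Icc (0 : ℝ) 1, ∀ h, 0 ≤ h → h ≤ τ → luxNorm b (Icc 0 (T - h))
      (fun r => L' (y r (r + θ * h)) (W (r + θ * h) (r + h))) ≤ c') :
    modulus3 b T A τ ≤ c + c' := by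
  refine modulus3_le fun θ hθ h h0 hh => ?_
  have t0 : 0 ≤ θ * h := mul_nonneg hθ.1 h0
  have t1 : θ * h ≤ h := mul_le_of_le_one_left h0 hθ.2
  rw [luxNorm_congr measurableSet_Icc (g := fun r =>
    -(L (R r (r + θ * h)) (x (r + θ * h) (r + h))) - L' (y r (r + θ * h)) (W (r + θ * h) (r + h)))
    fun r hr => hA _ _ _ hr.1 (by linarith) (by linarith) (by linarith [hr.2])]
  refine (luxNorm_sub_le hb
    (aestronglyMeasurable_bilin L hR hx hθ h0 (hh.trans hT)).neg).trans ?_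
  refine add_le_add ?_ (h₂ θ hθ h h0 hh)
  rw [show (-fun r => L (R r (r + θ * h)) (x (r + θ * h) (r + h))) =
    fun r => -(L (R r (r + θ * h)) (x (r + θ * h) (r + h))) from rfl, luxNorm_neg]
  exact h₁ θ hθ h h0 hh

/-- Hölder bound for the three-parameter norm of a sum of two products. -/
theorem boNorm3_le_of_products
    (hA : ∀ s u t, 0 ≤ s → s ≤ u → u ≤ t → t ≤ T →
      A s u t = -(L (R s u) (x u t)) - L' (y s u) (W u t)) (hR : SecMeas T R) (hx : SecMeas T x)
    (hy : SecMeas T y)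
    {α β : ℝ} {q : ℝ≥0∞} (hβ : 0 < β) (hq : q ≠ 0)
    (fR : boNorm2 (2 * α) (β / 2) (q / 2) T R < ⊤) (fx : boNorm2 α β q T x < ⊤)
    (fy : boNorm2 α β q T y < ⊤) (fW : boNorm2 (2 * α) (β / 2) (q / 2) T W < ⊤) :
    boNorm3 (3 * α) (β / 3) (q / 3) T A ≤
      (2 * lpAddConst (q / 3) * (‖L‖₊ + ‖L'‖₊) : ℝ≥0) *
        (boNorm2 (2 * α) (β / 2) (q / 2) T R * boNorm2 α β q T x +
          boNorm2 α β q T y * boNorm2 (2 * α) (β / 2) (q / 2) T W) := by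
  have hq2 : q / 2 ≠ 0 := by simp [hq]
  have mR := modulus2_mono (β / 2) T R
  have mx := modulus2_mono β T x
  have my := modulus2_mono β T y
  have mW := modulus2_mono (β / 2) T W
  have key : ∀ τ, 0 < τ → τ < T → modulus3 (β / 3) T A τ ≤
      (2 * (‖L‖₊ + ‖L'‖₊) : ℝ≥0) * (modulus2 (β / 2) T R τ * modulus2 β T x τ +
        modulus2 (β / 2) T W τ * modulus2 β T y τ) := by
    intro τ h0 hτ
    -- Hölder's inequality for Luxemburg norms requires finite factors, to exclude `0 * ⊤`; at `τ <
    -- T` all four moduli are finite.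
    have gR := (lt_top_of_scaleNorm_lt_top hq2 mR h0 hτ fR).ne
    have gx := (lt_top_of_scaleNorm_lt_top hq mx h0 hτ fx).ne
    have gy := (lt_top_of_scaleNorm_lt_top hq my h0 hτ fy).ne
    have gW := (lt_top_of_scaleNorm_lt_top hq2 mW h0 hτ fW).ne
    refine (modulus3_le_of_products hA hR hx (by positivity) hτ.le
      (fun θ hθ h hh0 hh => luxNorm_bilin_le L (b₁ := β / 2) (b₂ := β) (by positivity) hβ
        (by positivity) (by field_simp; norm_num) hR hθ hh0 hh (hh.trans hτ.le) gR gx)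
      (fun θ hθ h hh0 hh => luxNorm_bilin_le L' (b₁ := β) (b₂ := β / 2) hβ (by positivity)
        (by positivity) (by field_simp; norm_num) hy hθ hh0 hh (hh.trans hτ.le) gy gW)).trans ?_
    rw [mul_add, mul_comm (modulus2 β T y τ)]
    push_cast
    gcongr
    · exact le_self_add
    · exact le_add_self
  refine (scaleNorm_le_mul _ key).trans ?_
  have h3 : (3 : ℝ) * α = 2 * α + α := by ring
  calc ((2 * (‖L‖₊ + ‖L'‖₊) : ℝ≥0) : ℝ≥0∞) * scaleNorm (3 * α) (q / 3) T
        (fun τ => modulus2 (β / 2) T R τ * modulus2 β T x τ +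
          modulus2 (β / 2) T W τ * modulus2 β T y τ)
      ≤ (2 * (‖L‖₊ + ‖L'‖₊) : ℝ≥0) * (lpAddConst (q / 3) *
        (scaleNorm (3 * α) (q / 3) T (fun τ => modulus2 (β / 2) T R τ * modulus2 β T x τ) +
          scaleNorm (3 * α) (q / 3) T (fun τ => modulus2 (β / 2) T W τ * modulus2 β T y τ))) := by
        gcongr
        exact scaleNorm_add_le (mR.measurable.mul mx.measurable) (mW.measurable.mul my.measurable)
    _ ≤ (2 * (‖L‖₊ + ‖L'‖₊) : ℝ≥0) * (lpAddConst (q / 3) *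
        (boNorm2 (2 * α) (β / 2) (q / 2) T R * boNorm2 α β q T x +
          boNorm2 (2 * α) (β / 2) (q / 2) T W * boNorm2 α β q T y)) := by
        rw [h3]
        gcongr
        · exact scaleNorm_mul_le hq mR.measurable mx.measurable
        · exact scaleNorm_mul_le hq mW.measurable my.measurable
    _ = _ := by push_cast; ring

/-- Bound on the Orlicz modulus of `-(R x) - y W` for uniformly bounded `x` and `y`. -/
theorem modulus3_le_of_products_of_bound
    (hA : ∀ s u t, 0 ≤ s → s ≤ u → u ≤ t → t ≤ T →
      A s u t = -(L (R s u) (x u t)) - L' (y s u) (W u t)) (hR : SecMeas T R) (hx : SecMeas T x)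
    {b τ : ℝ} (hb : 0 < b) (hT : τ ≤ T) (c c' : ℝ≥0)
    (cx : ∀ s t, 0 ≤ s → s ≤ t → t ≤ T → t - s ≤ τ → ‖x s t‖ ≤ c)
    (cy : ∀ s t, 0 ≤ s → s ≤ t → t ≤ T → t - s ≤ τ → ‖y s t‖ ≤ c') :
    modulus3 b T A τ ≤
      ‖L‖₊ * c * modulus2 b T R τ + ‖L'‖₊ * c' * modulus2 b T W τ :=
  modulus3_le_of_products hA hR hx hb hT
    (fun _ hθ _ h0 hh => luxNorm_bilin_le_left L hb hθ h0 hh c cx)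
    (fun _ hθ _ h0 hh => luxNorm_bilin_le_right L' hb hθ h0 hh c' cy)

end Products

/-! ### Consequences of superlinear decay -/

section Decay

variable {V : Type*} [NormedAddCommGroup V]

/-- The quantity is at most `M * h ^ a * (2 ^ (1 - a)) ^ k`. Taking `k ≥ 1` brings every `h ≤ T`
into the range `2 * h ≤ T` of the hypothesis. -/
theorem tendsto_two_pow_mul_of_decay {b T a M : ℝ} (ha : 1 < a) {A : ℝ → ℝ → V}
    (H : ∀ h, 0 < h → 2 * h ≤ T → secNorm b T A h ≤ ENNReal.ofReal (M * h ^ a)) {h : ℝ}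
    (h0 : 0 < h) (hT : h ≤ T) :
    Tendsto (fun k : ℕ => 2 ^ k * secNorm b T A (h / 2 ^ k)) atTop (𝓝 0) := by
  have h2 : (0 : ℝ) < 2 ^ (1 - a) := by positivity
  have h21 : (2 : ℝ) ^ (1 - a) < 1 :=
    Real.rpow_lt_one_of_one_lt_of_neg one_lt_two (by linarith)
  have hlim : Tendsto (fun k : ℕ => ENNReal.ofReal (M * h ^ a * ((2 : ℝ) ^ (1 - a)) ^ k)) atTop
      (𝓝 0) := by
    rw [← ENNReal.ofReal_zero]
    refine ENNReal.tendsto_ofReal ?_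
    simpa using (tendsto_pow_atTop_nhds_zero_of_lt_one h2.le h21).const_mul (M * h ^ a)
  refine tendsto_of_tendsto_of_tendsto_of_le_of_le' tendsto_const_nhds hlim
    (Eventually.of_forall fun _ => zero_le) ?_
  filter_upwards [eventually_ge_atTop 1] with k hk
  have hk2 : (2 : ℝ) ≤ 2 ^ k := by
    simpa using pow_le_pow_right₀ (one_le_two (α := ℝ)) hk
  have hle : 2 * (h / 2 ^ k) ≤ T := by
    refine le_trans ?_ hT
    rw [← mul_div_assoc, div_le_iff₀ (by positivity)]
    nlinarith
  refine (mul_le_mul_right (H _ (by positivity) hle) _).trans (le_of_eq ?_)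
  rw [show (2 : ℝ≥0∞) ^ k = ENNReal.ofReal (2 ^ k) by
    rw [ENNReal.ofReal_pow (by norm_num)]; norm_num, ← ENNReal.ofReal_mul (by positivity)]
  congr 1
  have e1 : ((2 : ℝ) ^ k) ^ a = (2 ^ a) ^ k := by
    rw [← Real.rpow_natCast, ← Real.rpow_natCast, ← Real.rpow_mul (by norm_num),
      ← Real.rpow_mul (by norm_num), mul_comm]
  rw [Real.div_rpow h0.le (by positivity), e1, Real.rpow_sub (by norm_num), Real.rpow_one, div_pow]
  field_simp

/-- A continuous path with superlinear increments is constant. -/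
theorem eq_of_decay [NormedSpace ℝ V] [CompleteSpace V] {b T a M : ℝ} (hb : 0 < b) (ha : 1 < a)
    {f : ℝ → V} (hf : ContinuousOn f (Icc 0 T))
    (H : ∀ h, 0 < h → 2 * h ≤ T → secNorm b T (del f) h ≤ ENNReal.ofReal (M * h ^ a)) {t : ℝ}
    (ht : t ∈ Icc 0 T) : f t = f 0 := by
  -- The zero map has no defect, so the dyadic series vanishes and with it all section norms. The
  -- Hölder estimate is then applied with `M = 0`; the order `2` only has to exceed `1 / p`.
  have hz : ∀ h, 0 < h → 2 * h ≤ T → secNorm b T (del f) h ≤ ENNReal.ofReal (0 * h ^ (2 : ℝ)) := by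
    intro h h0 h2
    have hm : SecMeas T (0 : ℝ → ℝ → V) := fun _ _ => aestronglyMeasurable_const
    have := secNorm_le_tsum hb hm hf (ω := fun _ => 0)
      (fun h _ _ => by simp [del2, luxNorm_zero hb]) h0 (by linarith)
      (by simpa using tendsto_two_pow_mul_of_decay ha H h0 (by linarith))
    simpa using this
  obtain ⟨C, -, hC⟩ := exists_holder V (a := 2) hb (le_max_left 1 b) (le_max_right 1 b)
    (lt_of_le_of_lt ((div_le_one (by positivity)).2 (le_max_left 1 b)) one_lt_two)
  have := hC T 0 f le_rfl hf hz 0 t le_rfl ht.1 ht.2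
  rw [mul_zero, zero_mul] at this
  exact sub_eq_zero.1 (norm_le_zero_iff.1 this)

/-- The sewing bound on Orlicz moduli. -/
theorem modulus2_del_sub_le_tsum {b T a M : ℝ} (hb : 0 < b) (ha : 1 < a)
    {A : ℝ → ℝ → V} (hA : SecMeas T A) (hA0 : ∀ s, 0 ≤ s → s ≤ T → A s s = 0) {f : ℝ → V}
    (hf : ContinuousOn f (Icc 0 T))
    (H : ∀ h, 0 < h → 2 * h ≤ T → secNorm b T (del f - A) h ≤ ENNReal.ofReal (M * h ^ a)) {τ : ℝ}
    (hτ : τ ≤ T) :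
    modulus2 b T (del f - A) τ ≤ ∑' j : ℕ, 2 ^ j * modulus3 b T (del2 A) (τ / 2 ^ j) := by
  refine modulus2_le fun h h0 hh => ?_
  rcases h0.eq_or_lt with rfl | h0
  · have : secNorm b T (del f - A) 0 = luxNorm b (Icc 0 (T - 0)) (fun _ => (0 : V)) :=
      luxNorm_congr measurableSet_Icc fun r hr => by
        simp [del, hA0 r hr.1 (by simpa using hr.2)]
    rw [this, luxNorm_zero hb]
    exact zero_le
  · refine (secNorm_le_tsum hb hA hf (ω := modulus3 b T (del2 A)) (fun u u0 _ => ?_) h0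
      (hh.trans hτ) (tendsto_two_pow_mul_of_decay ha H h0 (hh.trans hτ))).trans ?_
    · have := luxNorm_le_modulus3 (b := b) (T := T) (del2 A) (θ := 1 / 2) ⟨by norm_num, by norm_num⟩
        u0.le le_rfl
      simpa [div_eq_inv_mul] using this
    · refine ENNReal.tsum_le_tsum fun j => ?_
      gcongr
      exact modulus3_mono b T _ (by gcongr)

/-- The sewing bound on norms. -/
theorem exists_boNorm2_del_sub_le (V : Type*) [NormedAddCommGroup V] {a γ : ℝ} {r : ℝ≥0∞}
    (hr : r ≠ 0) (hγ : 0 ≤ γ) (haγ : 1 < a + γ) :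
    ∃ C : ℝ≥0, ∀ {b T a' M : ℝ}, 0 < b → 0 < T → 1 < a' → ∀ {A : ℝ → ℝ → V}, SecMeas T A →
      (∀ s, 0 ≤ s → s ≤ T → A s s = 0) → ∀ {f : ℝ → V}, ContinuousOn f (Icc 0 T) →
      (∀ h, 0 < h → 2 * h ≤ T → secNorm b T (del f - A) h ≤ ENNReal.ofReal (M * h ^ a')) →
      ∀ {g : ℝ → ℝ≥0∞}, Measurable g →
      (∀ τ, 0 < τ → τ < T → modulus3 b T (del2 A) τ ≤ ENNReal.ofReal (τ ^ γ) * g τ) →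
      boNorm2 a b r T (del f - A) ≤ C * (ENNReal.ofReal (T ^ γ) * scaleNorm a r T g) := by
  -- From `2 ^ j * (τ / 2 ^ j) ^ γ = τ ^ γ * w ^ j`. The series is summable in the scale norm when
  -- `w < 2 ^ a`, that is, `1 < a + γ`. The constant does not depend on `T`.
  set w : ℝ≥0 := (2 : ℝ≥0) ^ (1 - γ) with hw
  have hw0 : 0 < w := by positivity
  have hwa : (w : ℝ) < 2 ^ a := by
    rw [hw, NNReal.coe_rpow, NNReal.coe_ofNat]
    exact Real.rpow_lt_rpow_of_exponent_lt one_lt_two (by linarith)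
  obtain ⟨C, hC⟩ := exists_scaleNorm_dyadic_le hr hw0 hwa
  refine ⟨C, fun {b T a' M} hb hT ha' {A} hA hA0 {f} hf H {g} hg hg' => ?_⟩
  have key : ∀ τ, 0 < τ → τ < T → modulus2 b T (del f - A) τ ≤
      (T ^ γ).toNNReal * ∑' j : ℕ, (w : ℝ≥0∞) ^ j * g (τ / 2 ^ j) := by
    intro τ h0 hτ
    refine (modulus2_del_sub_le_tsum hb ha' hA hA0 hf H hτ.le).trans ?_
    rw [← ENNReal.tsum_mul_left]
    refine ENNReal.tsum_le_tsum fun j => ?_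
    have hj : τ / 2 ^ j ≤ τ := div_le_self h0.le (one_le_pow₀ one_le_two)
    refine (mul_le_mul_right (hg' _ (by positivity) (hj.trans_lt hτ)) _).trans ?_
    rw [← mul_assoc, ← mul_assoc]
    refine mul_le_mul_left ?_ _
    change _ ≤ ENNReal.ofReal (T ^ γ) * (w : ℝ≥0∞) ^ j
    rw [show (2 : ℝ≥0∞) ^ j = ENNReal.ofReal (2 ^ j) by
      rw [ENNReal.ofReal_pow (by norm_num)]; norm_num,
      show (w : ℝ≥0∞) ^ j = ENNReal.ofReal ((2 ^ (1 - γ)) ^ j) by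
        rw [← ENNReal.ofReal_coe_nnreal, ← ENNReal.ofReal_pow (by positivity), hw,
          NNReal.coe_rpow, NNReal.coe_ofNat],
      ← ENNReal.ofReal_mul (by positivity), ← ENNReal.ofReal_mul (by positivity)]
    refine ENNReal.ofReal_le_ofReal ?_
    have e1 : ((2 : ℝ) ^ j) ^ γ = (2 ^ γ) ^ j := by
      rw [← Real.rpow_natCast, ← Real.rpow_natCast, ← Real.rpow_mul (by norm_num),
        ← Real.rpow_mul (by norm_num), mul_comm]
    rw [Real.div_rpow h0.le (by positivity), e1, Real.rpow_sub (by norm_num), Real.rpow_one,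
      div_pow]
    have : τ ^ γ ≤ T ^ γ := Real.rpow_le_rpow h0.le hτ.le hγ
    calc (2 : ℝ) ^ j * (τ ^ γ / (2 ^ γ) ^ j) = τ ^ γ * (2 ^ j / (2 ^ γ) ^ j) := by ring
      _ ≤ T ^ γ * (2 ^ j / (2 ^ γ) ^ j) := by gcongr
  refine (scaleNorm_le_mul _ key).trans ?_
  calc _ ≤ ((T ^ γ).toNNReal : ℝ≥0∞) * (C * scaleNorm a r T g) := by
        gcongr
        exact hC T g hT hg
    _ = _ := by
        rw [mul_left_comm]
        rfl

end Decay

/-! ### Measurability -/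

section Measurability

variable {V : Type*} [NormedAddCommGroup V] {T : ℝ}

theorem measurableSet_simplex2 (T : ℝ) : MeasurableSet (simplex2 T) :=
  (measurableSet_le measurable_const measurable_fst).inter
    ((measurableSet_le measurable_fst measurable_snd).inter
      (measurableSet_le measurable_snd measurable_const))

theorem aestronglyMeasurable_fst_simplex2 {f : ℝ → V} (hf : ContinuousOn f (Icc 0 T)) :
    AEStronglyMeasurable (fun x : ℝ × ℝ => f x.1) (volume.restrict (simplex2 T)) :=
  (hf.comp continuous_fst.continuousOn fun _ hx =>
    ⟨hx.1, hx.2.1.trans hx.2.2⟩).aestronglyMeasurable (measurableSet_simplex2 T)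

theorem aestronglyMeasurable_snd_simplex2 {f : ℝ → V} (hf : ContinuousOn f (Icc 0 T)) :
    AEStronglyMeasurable (fun x : ℝ × ℝ => f x.2) (volume.restrict (simplex2 T)) :=
  (hf.comp continuous_snd.continuousOn fun _ hx =>
    ⟨hx.1.trans hx.2.1, hx.2.2⟩).aestronglyMeasurable (measurableSet_simplex2 T)

theorem aestronglyMeasurable_del_simplex2 {f : ℝ → V} (hf : ContinuousOn f (Icc 0 T)) :
    AEStronglyMeasurable (fun x : ℝ × ℝ => del f x.1 x.2) (volume.restrict (simplex2 T)) :=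
  (aestronglyMeasurable_snd_simplex2 hf).sub (aestronglyMeasurable_fst_simplex2 hf)

theorem aestronglyMeasurable_section {f : ℝ → V} (hf : ContinuousOn f (Icc 0 T)) {h : ℝ}
    (h0 : 0 ≤ h) : AEStronglyMeasurable f (volume.restrict (Icc 0 (T - h))) :=
  (hf.mono (Icc_subset_Icc_right (by linarith))).aestronglyMeasurable measurableSet_Icc

variable {E F G : Type*} [NormedAddCommGroup E] [NormedSpace ℝ E] [NormedAddCommGroup F]
  [NormedSpace ℝ F] [NormedAddCommGroup G] [NormedSpace ℝ G]

theorem secMeas_bilin (L : E →L[ℝ] F →L[ℝ] G) {f : ℝ → E} (hf : ContinuousOn f (Icc 0 T))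
    {A : ℝ → ℝ → F} (hA : SecMeas T A) : SecMeas T (fun s t => L (f s) (A s t)) := fun h hh =>
  L.aestronglyMeasurable_comp₂ (aestronglyMeasurable_section hf hh.1) (hA h hh)

theorem aestronglyMeasurable_bilin_simplex2 (L : E →L[ℝ] F →L[ℝ] G) {f : ℝ → E}
    (hf : ContinuousOn f (Icc 0 T)) {A : ℝ → ℝ → F}
    (hA : AEStronglyMeasurable (fun x : ℝ × ℝ => A x.1 x.2) (volume.restrict (simplex2 T))) :
    AEStronglyMeasurable (fun x : ℝ × ℝ => L (f x.1) (A x.1 x.2)) (volume.restrict (simplex2 T)) :=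
  L.aestronglyMeasurable_comp₂ (aestronglyMeasurable_fst_simplex2 hf) hA

theorem secNorm_bilin_le (L : E →L[ℝ] F →L[ℝ] G) {b : ℝ} (hb : 0 < b) {f : ℝ → E} (c : ℝ≥0)
    (hf : ∀ s ∈ Icc 0 T, ‖f s‖ ≤ c) (A : ℝ → ℝ → F) {u : ℝ} (u0 : 0 ≤ u) :
    secNorm b T (fun s t => L (f s) (A s t)) u ≤ (‖L‖₊ * c : ℝ≥0) * secNorm b T A u := by
  refine secNorm_le_mul hb _ (fun s t hs hst ht => ?_) u0
  refine (L.le_opNorm₂ _ _).trans ?_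
  push_cast
  gcongr
  exact hf s ⟨hs, hst.trans ht⟩

theorem boNorm2_bilin_le (L : E →L[ℝ] F →L[ℝ] G) {a b : ℝ} {r : ℝ≥0∞} (hb : 0 < b) {f : ℝ → E}
    (c : ℝ≥0) (hf : ∀ s ∈ Icc 0 T, ‖f s‖ ≤ c) (A : ℝ → ℝ → F) :
    boNorm2 a b r T (fun s t => L (f s) (A s t)) ≤ (‖L‖₊ * c : ℝ≥0) * boNorm2 a b r T A :=
  scaleNorm_le_mul _ fun _ _ _ => modulus2_le fun _ u0 u1 =>
    (secNorm_bilin_le L hb c hf A u0).trans (by gcongr; exact secNorm_le_modulus2 A u0 u1)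

theorem exists_nnreal_bound {f : ℝ → V} (hf : ContinuousOn f (Icc 0 T)) :
    ∃ c : ℝ≥0, ∀ s ∈ Icc 0 T, ‖f s‖ ≤ c := by
  obtain ⟨C, hC⟩ := isCompact_Icc.exists_bound_of_continuousOn hf
  exact ⟨C.toNNReal, fun s hs => (hC s hs).trans (Real.le_coe_toNNReal C)⟩

end Measurability

/-! ### The local approximation of the rough integral -/

section RoughXi

variable {m n : ℕ} {α β T p : ℝ} {q : ℝ≥0∞} {X : ℝ → Vec n} {XX : ℝ → ℝ → Mat n n}
  {Y : ℝ → Mat m n} {Y' : ℝ → Vec n →L[ℝ] Mat m n}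

theorem IsRoughPath.secMeas (hX : IsRoughPath α β q T X XX) : SecMeas T XX :=
  hX.mem_snd.meas_section

theorem IsRoughPath.apply_self (hX : IsRoughPath α β q T X XX) {s : ℝ} (h0 : 0 ≤ s) (hT : s ≤ T) :
    XX s s = 0 := by
  have h := hX.chen s s s h0 le_rfl le_rfl hT
  have ho : outer (del X s s) (del X s s) = 0 := by
    ext ij
    simp [outer_apply, del]
  rw [ho, sub_self, zero_sub, neg_eq_zero] at h
  exact h

theorem roughXi_self (hX : IsRoughPath α β q T X XX) {s : ℝ} (h0 : 0 ≤ s) (hT : s ≤ T) :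
    roughXi X XX Y Y' s s = 0 := by
  rw [roughXi_eq, hX.apply_self h0 hT, show del X s s = 0 from sub_self _, map_zero, map_zero,
    add_zero]

theorem secMeas_roughXi (hX : IsRoughPath α β q T X XX) (hY : IsControlled α β q T X Y Y') :
    SecMeas T (roughXi X XX Y Y') :=
  (secMeas_bilin (matOpL m n) hY.mem_path.cont (secMeas_del hX.mem_fst.cont)).add
    (secMeas_bilin (tensorActL m n) hY.mem_deriv.cont hX.secMeas)

theorem aestronglyMeasurable_roughXi (hX : IsRoughPath α β q T X XX)
    (hY : IsControlled α β q T X Y Y') :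
    AEStronglyMeasurable (fun x : ℝ × ℝ => roughXi X XX Y Y' x.1 x.2)
      (volume.restrict (simplex2 T)) :=
  (aestronglyMeasurable_bilin_simplex2 (matOpL m n) hY.mem_path.cont
    (aestronglyMeasurable_del_simplex2 hX.mem_fst.cont)).add
    (aestronglyMeasurable_bilin_simplex2 (tensorActL m n) hY.mem_deriv.cont hX.mem_snd.meas)

theorem boNorm3_del2_roughXi_le (hβ : 0 < β) (hq : q ≠ 0) (hX : IsRoughPath α β q T X XX)
    (hY : IsControlled α β q T X Y Y') :
    boNorm3 (3 * α) (β / 3) (q / 3) T (del2 (roughXi X XX Y Y')) ≤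
      (2 * lpAddConst (q / 3) * (‖matOpL m n‖₊ + ‖tensorActL m n‖₊) : ℝ≥0) *
        (boNorm2 (2 * α) (β / 2) (q / 2) T (remainder X Y Y') * boSemi α β q T X +
          boSemi α β q T Y' * boNorm2 (2 * α) (β / 2) (q / 2) T XX) :=
  boNorm3_le_of_products
    (fun s u t h0 h1 h2 h3 => del2_roughXi (hX.chen s u t h0 h1 h2 h3) Y Y')
    hY.mem_remainder.meas_section (secMeas_del hX.mem_fst.cont) (secMeas_del hY.mem_deriv.cont)
    hβ hq hY.mem_remainder.norm_lt_top hX.mem_fst.semi_lt_top hY.mem_deriv.semi_lt_top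
    hX.mem_snd.norm_lt_top

/-- The modulus of `δΞ` in the Orlicz space of exponent `β / 2`. -/
theorem exists_modulus3_roughXi_le (m n : ℕ) (hβ : 0 < β) (hq : q ≠ 0) (hp : 1 ≤ p) (hβp : β ≤ p)
    (hαp : 1 / p < α) :
    ∃ C : ℝ≥0, ∀ {T : ℝ} {X : ℝ → Vec n} {XX : ℝ → ℝ → Mat n n}
      {Y : ℝ → Mat m n} {Y' : ℝ → Vec n →L[ℝ] Mat m n}, IsRoughPath α β q T X XX →
      IsControlled α β q T X Y Y' → ∀ τ, 0 < τ → τ ≤ T →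
      modulus3 (β / 2) T (del2 (roughXi X XX Y Y')) τ ≤ ENNReal.ofReal (τ ^ (α - 1 / p)) *
        (C * (boSemi α β q T X * modulus2 (β / 2) T (remainder X Y Y') τ +
          boSemi α β q T Y' * modulus2 (β / 2) T XX τ)) := by
  obtain ⟨C₁, hC₁⟩ := exists_holder_boSemi (Vec n) hq hβ hp hβp hαp
  obtain ⟨C₂, hC₂⟩ := exists_holder_boSemi (Vec n →L[ℝ] Mat m n) hq hβ hp hβp hαp
  refine ⟨‖matOpL m n‖₊ * C₁ + ‖tensorActL m n‖₊ * C₂,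
    fun {T X XX Y Y'} hX hY τ h0 hτ => ?_⟩
  have hγ : 0 ≤ α - 1 / p := by linarith
  have fX := hX.mem_fst.semi_lt_top.ne
  have fY := hY.mem_deriv.semi_lt_top.ne
  -- In each product the first-level factor is estimated uniformly by its Hölder bound, of order `τ
  -- ^ (α - 1 / p)`, and the second-level factor keeps its norm in `Φ_{β/2}`.
  have key := modulus3_le_of_products_of_bound (b := β / 2) (τ := τ)
    (fun s u t h0 h1 h2 h3 => del2_roughXi (hX.chen s u t h0 h1 h2 h3) Y Y')
    hY.mem_remainder.meas_section (secMeas_del hX.mem_fst.cont) (by positivity) hτ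
    (C₁ * (boSemi α β q T X).toNNReal * (τ ^ (α - 1 / p)).toNNReal)
    (C₂ * (boSemi α β q T Y').toNNReal * (τ ^ (α - 1 / p)).toNNReal)
    (fun s t hs hst ht hts => by
      refine (hC₁ T X hX.mem_fst.cont fX s t hs hst ht).trans ?_
      rw [NNReal.coe_mul, NNReal.coe_mul, Real.coe_toNNReal _ (by positivity)]
      exact mul_le_mul_of_nonneg_left (Real.rpow_le_rpow (by linarith) hts hγ) (by positivity))
    (fun s t hs hst ht hts => by
      refine (hC₂ T Y' hY.mem_deriv.cont fY s t hs hst ht).trans ?_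
      rw [NNReal.coe_mul, NNReal.coe_mul, Real.coe_toNNReal _ (by positivity)]
      exact mul_le_mul_of_nonneg_left (Real.rpow_le_rpow (by linarith) hts hγ) (by positivity))
  refine key.trans ?_
  push_cast
  rw [ENNReal.coe_toNNReal fX, ENNReal.coe_toNNReal fY]
  set a := modulus2 (β / 2) T (remainder X Y Y') τ
  set b := modulus2 (β / 2) T XX τ
  change (‖matOpL m n‖₊ : ℝ≥0∞) * (C₁ * boSemi α β q T X * ENNReal.ofReal (τ ^ (α - 1 / p))) * a +
    ‖tensorActL m n‖₊ * (C₂ * boSemi α β q T Y' * ENNReal.ofReal (τ ^ (α - 1 / p))) * b ≤ _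
  set c := ENNReal.ofReal (τ ^ (α - 1 / p))
  calc _ = c * ((‖matOpL m n‖₊ * C₁ : ℝ≥0∞) * (boSemi α β q T X * a) +
        (‖tensorActL m n‖₊ * C₂ : ℝ≥0∞) * (boSemi α β q T Y' * b)) := by ring
    _ ≤ _ := by
      rw [mul_add (_ + _ : ℝ≥0∞)]
      gcongr
      · exact le_self_add
      · exact le_add_self

/-- The first-order smallness that the sewing lemma asks of `Ξ`. The increment of `X` is embedded
into `Φ_{β/2}`, and the order `2α` of the second level is lowered to `α` at the price of `T ^ α`. -/
theorem secNorm_roughXi_le (hα : 0 < α) (hβ : 0 < β) (hq : q ≠ 0)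
    (hX : IsRoughPath α β q T X XX) (hY : IsControlled α β q T X Y Y') :
    ∃ M : ℝ, 0 ≤ M ∧ ∀ h, 0 < h → 2 * h ≤ T →
      secNorm (β / 2) T (roughXi X XX Y Y') h ≤ ENNReal.ofReal (M * h ^ α) := by
  obtain ⟨c, hc⟩ := exists_nnreal_bound hY.mem_path.cont
  obtain ⟨c', hc'⟩ := exists_nnreal_bound hY.mem_deriv.cont
  have hq2 : q / 2 ≠ 0 := by simp [hq]
  have hβ2 : 0 < β / 2 := by positivity
  set D : ℝ≥0∞ := (‖matOpL m n‖₊ * c : ℝ≥0) * (2 * luxOne β T *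
      (supConst α q * boSemi α β q T X)) +
    (‖tensorActL m n‖₊ * c' : ℝ≥0) * (supConst (2 * α) (q / 2) *
      boNorm2 (2 * α) (β / 2) (q / 2) T XX * ENNReal.ofReal (T ^ α)) with hD
  have hDt : D ≠ ⊤ := by
    have h1 := hX.mem_fst.semi_lt_top.ne
    have h2 := hX.mem_snd.norm_lt_top.ne
    have h3 : (2 : ℝ≥0∞) * luxOne β T ≠ ⊤ := by finiteness
    exact ENNReal.add_ne_top.2 ⟨ENNReal.mul_ne_top ENNReal.coe_ne_top (ENNReal.mul_ne_top h3
      (ENNReal.mul_ne_top ENNReal.coe_ne_top h1)), ENNReal.mul_ne_top ENNReal.coe_ne_top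
      (ENNReal.mul_ne_top (ENNReal.mul_ne_top ENNReal.coe_ne_top h2) ENNReal.ofReal_ne_top)⟩
  refine ⟨D.toReal, by positivity, fun h h0 h2 => ?_⟩
  rw [ENNReal.ofReal_mul (by positivity), ENNReal.ofReal_toReal hDt]
  have hT : h ≤ T := by linarith
  have e1 : secNorm (β / 2) T (del X) h ≤
      2 * luxOne β T * (supConst α q * ENNReal.ofReal (h ^ α) * boSemi α β q T X) :=
    (secNorm_embed hβ hβ hβ2 (by field_simp; norm_num) (secMeas_del hX.mem_fst.cont) h0.le
      hT).trans (mul_le_mul_right (secNorm_le_boNorm2 hα.le hq (del X) h0 h2) _)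
  have e2 : secNorm (β / 2) T XX h ≤ supConst (2 * α) (q / 2) *
      (ENNReal.ofReal (T ^ α) * ENNReal.ofReal (h ^ α)) *
        boNorm2 (2 * α) (β / 2) (q / 2) T XX := by
    refine (secNorm_le_boNorm2 (a := 2 * α) (by positivity) hq2 XX h0 h2).trans ?_
    refine mul_le_mul_left ?_ _
    refine mul_le_mul_right ?_ _
    have hT0 := h0.trans_le hT
    rw [← ENNReal.ofReal_mul (by positivity), two_mul, Real.rpow_add h0]
    refine ENNReal.ofReal_le_ofReal ?_
    gcongr
  calc secNorm (β / 2) T (roughXi X XX Y Y') h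
      ≤ (‖matOpL m n‖₊ * c : ℝ≥0) * secNorm (β / 2) T (del X) h +
        (‖tensorActL m n‖₊ * c' : ℝ≥0) * secNorm (β / 2) T XX h :=
        (secNorm_add_le hβ2
          (secMeas_bilin (matOpL m n) hY.mem_path.cont (secMeas_del hX.mem_fst.cont)) h0.le
          hT).trans (add_le_add (secNorm_bilin_le (matOpL m n) hβ2 c hc (del X) h0.le)
            (secNorm_bilin_le (tensorActL m n) hβ2 c' hc' XX h0.le))
    _ ≤ _ := add_le_add (mul_le_mul_right e1 _) (mul_le_mul_right e2 _)
    _ = _ := by rw [hD]; ring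

/-- Existence of the sewing of `Ξ`, with a bound in the Orlicz space of exponent `β / 2`. -/
theorem exists_roughXi_sewing (hα : 0 < α) (hβ : 0 < β) (hq : q ≠ 0) (hT : 0 < T) (hp : 1 ≤ p)
    (hβp : β ≤ p) (hαp : 1 / p < α) (hαp' : 1 < 3 * α - 1 / p)
    (hX : IsRoughPath α β q T X XX) (hY : IsControlled α β q T X Y Y') :
    ∃ J : ℝ → Vec m, ContinuousOn J (Icc 0 T) ∧ J 0 = 0 ∧ ∃ M : ℝ, 0 ≤ M ∧
      ∀ h, 0 < h → 2 * h ≤ T → secNorm (β / 2) T (del J - roughXi X XX Y Y') h ≤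
        ENNReal.ofReal (M * h ^ (3 * α - 1 / p)) := by
  obtain ⟨M₁, hM₁, H₁⟩ := secNorm_roughXi_le hα hβ hq hX hY
  obtain ⟨C, hC⟩ := exists_modulus3_roughXi_le m n hβ hq hp hβp hαp
  have hq2 : q / 2 ≠ 0 := by simp [hq]
  set D : ℝ≥0∞ := C * (boSemi α β q T X *
      (supConst (2 * α) (q / 2) * boNorm2 (2 * α) (β / 2) (q / 2) T (remainder X Y Y')) +
    boSemi α β q T Y' *
      (supConst (2 * α) (q / 2) * boNorm2 (2 * α) (β / 2) (q / 2) T XX)) with hD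
  have hDt : D ≠ ⊤ := by
    have h1 := hX.mem_fst.semi_lt_top.ne
    have h2 := hX.mem_snd.norm_lt_top.ne
    have h3 := hY.mem_deriv.semi_lt_top.ne
    have h4 := hY.mem_remainder.norm_lt_top.ne
    exact ENNReal.mul_ne_top ENNReal.coe_ne_top (ENNReal.add_ne_top.2
      ⟨ENNReal.mul_ne_top h1 (ENNReal.mul_ne_top ENNReal.coe_ne_top h4),
        ENNReal.mul_ne_top h3 (ENNReal.mul_ne_top ENNReal.coe_ne_top h2)⟩)
  -- The order `3 * α - 1 / p > 1` is made of `α - 1 / p` from the Hölder bound and `2 * α` from the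
  -- second level.
  refine exists_sewing (α := α) (by positivity) hT hα hαp' hM₁ (ENNReal.toReal_nonneg (a := D))
    (secMeas_roughXi hX hY) H₁ fun h h0 h2 θ hθ => ?_
  refine (luxNorm_le_modulus3 (del2 (roughXi X XX Y Y')) hθ h0.le le_rfl).trans ?_
  refine (hC hX hY h h0 (by linarith)).trans ?_
  rw [ENNReal.ofReal_mul (by positivity), ENNReal.ofReal_toReal hDt,
    show 3 * α - 1 / p = (α - 1 / p) + 2 * α by ring, Real.rpow_add h0,
    ENNReal.ofReal_mul (by positivity)]
  calc _ ≤ ENNReal.ofReal (h ^ (α - 1 / p)) * (C * (boSemi α β q T X *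
      (supConst (2 * α) (q / 2) * ENNReal.ofReal (h ^ (2 * α)) *
        boNorm2 (2 * α) (β / 2) (q / 2) T (remainder X Y Y')) +
      boSemi α β q T Y' * (supConst (2 * α) (q / 2) * ENNReal.ofReal (h ^ (2 * α)) *
        boNorm2 (2 * α) (β / 2) (q / 2) T XX))) := by
        gcongr
        · exact modulus2_le_boNorm2 (by positivity) hq2 _ h0 h2
        · exact modulus2_le_boNorm2 (by positivity) hq2 _ h0 h2
    _ = _ := by rw [hD]; ring

end RoughXi

/-! ### Uniqueness and existence of the rough integral -/

section Integral

variable {m n : ℕ} {α β T p : ℝ} {q : ℝ≥0∞} {X : ℝ → Vec n} {XX : ℝ → ℝ → Mat n n}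
  {Y : ℝ → Mat m n} {Y' : ℝ → Vec n →L[ℝ] Mat m n} {J J₁ J₂ : ℝ → Vec m}

theorem IsRoughIntegral.secNorm_le (hα : 0 < α) (hq : q ≠ 0)
    (hJ : IsRoughIntegral α β q T X XX Y Y' J) :
    ∃ M : ℝ, 0 ≤ M ∧ ∀ h, 0 < h → 2 * h ≤ T →
      secNorm (β / 3) T (del J - roughXi X XX Y Y') h ≤ ENNReal.ofReal (M * h ^ (3 * α)) := by
  have hq3 : q / 3 ≠ 0 := by simp [hq]
  exact ⟨_, by positivity, fun h h0 h2 => secNorm_le_boNorm2_real (by positivity) hq3 _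
    hJ.sewing.norm_lt_top.ne h0 h2⟩

theorem IsRoughIntegral.eqOn (hα : 1 / 3 < α) (hβ : 0 < β) (hq : q ≠ 0)
    (h₁ : IsRoughIntegral α β q T X XX Y Y' J₁) (h₂ : IsRoughIntegral α β q T X XX Y Y' J₂) :
    EqOn J₁ J₂ (Icc 0 T) := by
  have hα0 : 0 < α := by linarith
  obtain ⟨M₁, hM₁, H₁⟩ := h₁.secNorm_le hα0 hq
  obtain ⟨M₂, hM₂, H₂⟩ := h₂.secNorm_le hα0 hq
  -- The local approximation cancels in the difference, whose increments are therefore of order `3 *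
  -- α > 1`.
  have hd : del (J₁ - J₂) = (del J₁ - roughXi X XX Y Y') - (del J₂ - roughXi X XX Y Y') := by
    funext s t
    simp only [del, Pi.sub_apply]
    abel
  intro t ht
  have := eq_of_decay (b := β / 3) (a := 3 * α) (M := M₁ + M₂) (by positivity) (by linarith)
    (h₁.cont.sub h₂.cont) (fun h h0 h2 => by
      rw [hd, add_mul, ENNReal.ofReal_add (by positivity) (by positivity)]
      exact (secNorm_sub_le (by positivity) h₁.sewing.meas_section h0.le (by linarith)).trans
        (add_le_add (H₁ h h0 h2) (H₂ h h0 h2))) ht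
  rw [Pi.sub_apply, Pi.sub_apply, h₁.zero, h₂.zero, sub_self] at this
  exact sub_eq_zero.1 this

theorem exists_isRoughIntegral (hα : 0 < α) (hβ : 0 < β) (hq : q ≠ 0) (hT : 0 < T) (hp : 1 ≤ p)
    (hβp : β ≤ p) (hαp : 1 / p < α) (hαp' : 1 < 3 * α - 1 / p)
    (hX : IsRoughPath α β q T X XX) (hY : IsControlled α β q T X Y Y') :
    ∃ J : ℝ → Vec m, IsRoughIntegral α β q T X XX Y Y' J ∧ ∃ M : ℝ, 0 ≤ M ∧
      ∀ h, 0 < h → 2 * h ≤ T → secNorm (β / 2) T (del J - roughXi X XX Y Y') h ≤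
        ENNReal.ofReal (M * h ^ (3 * α - 1 / p)) := by
  obtain ⟨J, hJc, hJ0, M, hM, H⟩ := exists_roughXi_sewing hα hβ hq hT hp hβp hαp hαp' hX hY
  have hq3 : q / 3 ≠ 0 := by simp [hq]
  have hp0 : 0 < 1 / p := by positivity
  have hmeas : SecMeas T (del J - roughXi X XX Y Y') :=
    (secMeas_del hJc).sub (secMeas_roughXi hX hY)
  refine ⟨J, ⟨hJc, hJ0, ⟨?_, hmeas, ?_⟩⟩, M, hM, H⟩
  · exact (aestronglyMeasurable_del_simplex2 hJc).sub (aestronglyMeasurable_roughXi hX hY)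
  -- The embedding of `Φ_{β/2}` into `Φ_{β/3}` only supplies the superlinear decay that justifies
  -- the dyadic series; the norm bound itself comes from the defect, with `γ = 0`.
  · obtain ⟨C, hC⟩ := exists_boNorm2_del_sub_le (Vec m) (a := 3 * α) (γ := 0) hq3 le_rfl
      (by linarith)
    have key := hC (b := β / 3) (T := T) (a' := 3 * α - 1 / p) (M := 2 * luxOne β T * M)
      (by positivity) hT hαp' (secMeas_roughXi hX hY) (fun s h0 h1 => roughXi_self hX h0 h1) hJc
      (fun h h0 h2 => by
        refine (secNorm_embed (b₁ := β / 2) (b₂ := β) (by positivity) hβ (by positivity)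
          (by field_simp; norm_num) hmeas h0.le (by linarith)).trans ?_
        refine (mul_le_mul_right (H h h0 h2) _).trans (le_of_eq ?_)
        rw [mul_assoc (2 * (luxOne β T : ℝ)), ENNReal.ofReal_mul (p := 2 * _) (by positivity),
          ENNReal.ofReal_mul zero_le_two, ENNReal.ofReal_coe_nnreal, ENNReal.ofReal_ofNat])
      (modulus3_mono (β / 3) T (del2 (roughXi X XX Y Y'))).measurable
      (fun τ _ _ => by simp)
    refine key.trans_lt ?_
    have h1 := hX.mem_fst.semi_lt_top
    have h2 := hX.mem_snd.norm_lt_top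
    have h3 := hY.mem_deriv.semi_lt_top
    have h4 := hY.mem_remainder.norm_lt_top
    have h5 : boNorm3 (3 * α) (β / 3) (q / 3) T (del2 (roughXi X XX Y Y')) < ⊤ :=
      (boNorm3_del2_roughXi_le hβ hq hX hY).trans_lt
        (ENNReal.mul_lt_top ENNReal.coe_lt_top (ENNReal.add_lt_top.2
          ⟨ENNReal.mul_lt_top h4 h1, ENNReal.mul_lt_top h3 h2⟩))
    exact ENNReal.mul_lt_top ENNReal.coe_lt_top (ENNReal.mul_lt_top ENNReal.ofReal_lt_top h5)

theorem secNorm_congr {V : Type*} [NormedAddCommGroup V] {b T h : ℝ} {A B : ℝ → ℝ → V}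
    (h0 : 0 ≤ h) (hAB : ∀ s t, 0 ≤ s → s ≤ t → t ≤ T → A s t = B s t) :
    secNorm b T A h = secNorm b T B h :=
  luxNorm_congr measurableSet_Icc fun r hr =>
    hAB r (r + h) hr.1 (by linarith) (by linarith [hr.2])

/-- The definition provides decay only in `Φ_{β/3}`. By uniqueness the integral agrees with the
constructed path, which decays in the smaller space `Φ_{β/2}`. -/
theorem IsRoughIntegral.exists_decay (hα : 1 / 3 < α) (hβ : 0 < β) (hq : q ≠ 0) (hT : 0 < T)
    (hp : 1 ≤ p) (hβp : β ≤ p) (hαp : 1 / p < α) (hαp' : 1 < 3 * α - 1 / p)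
    (hX : IsRoughPath α β q T X XX) (hY : IsControlled α β q T X Y Y')
    (hJ : IsRoughIntegral α β q T X XX Y Y' J) :
    ∃ M : ℝ, ∀ h, 0 < h → 2 * h ≤ T → secNorm (β / 2) T (del J - roughXi X XX Y Y') h ≤
      ENNReal.ofReal (M * h ^ (3 * α - 1 / p)) := by
  obtain ⟨I, hI, M, hM, H⟩ :=
    exists_isRoughIntegral (by linarith) hβ hq hT hp hβp hαp hαp' hX hY
  refine ⟨M, fun h h0 h2 => ?_⟩
  rw [secNorm_congr (B := del I - roughXi X XX Y Y') h0.le fun s t hs hst ht => ?_]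
  · exact H h h0 h2
  · have he := hJ.eqOn hα hβ hq hI
    simp only [Pi.sub_apply, del, he (⟨hs, hst.trans ht⟩ : s ∈ Icc 0 T),
      he (⟨hs.trans hst, ht⟩ : t ∈ Icc 0 T)]

/-- The sewing bound for the rough integral. -/
theorem exists_boNorm2_del_sub_roughXi_le (m n : ℕ) (hα : 1 / 3 < α) (hβ : 0 < β) (hq : q ≠ 0) :
    ∃ C : ℝ≥0, ∀ {T : ℝ} {X : ℝ → Vec n} {XX : ℝ → ℝ → Mat n n} {Y : ℝ → Mat m n}
      {Y' : ℝ → Vec n →L[ℝ] Mat m n} {J : ℝ → Vec m}, 0 < T → IsRoughPath α β q T X XX →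
      IsControlled α β q T X Y Y' → IsRoughIntegral α β q T X XX Y Y' J →
      boNorm2 (3 * α) (β / 3) (q / 3) T (del J - roughXi X XX Y Y') ≤
        C * boNorm3 (3 * α) (β / 3) (q / 3) T (del2 (roughXi X XX Y Y')) := by
  have hq3 : q / 3 ≠ 0 := by simp [hq]
  obtain ⟨C, hC⟩ := exists_boNorm2_del_sub_le (Vec m) (a := 3 * α) (γ := 0) hq3 le_rfl
    (by linarith)
  refine ⟨C, fun {T X XX Y Y' J} hT hX hY hJ => ?_⟩
  obtain ⟨M, -, H⟩ := hJ.secNorm_le (by linarith) hq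
  have key := hC (b := β / 3) (by positivity) hT (a' := 3 * α) (by linarith)
    (secMeas_roughXi hX hY) (fun s h0 h1 => roughXi_self hX h0 h1) hJ.cont H
    (modulus3_mono (β / 3) T (del2 (roughXi X XX Y Y'))).measurable
    (fun τ _ _ => by simp)
  rwa [Real.rpow_zero, ENNReal.ofReal_one, one_mul] at key

/-- The sewing bound for the rough integral in the Orlicz space of exponent `β / 2`. -/
theorem exists_boNorm2_half_del_sub_roughXi_le (m n : ℕ) (hα : 1 / 3 < α) (hβ : 0 < β)
    (hq : q ≠ 0) (hp : 1 ≤ p) (hβp : β ≤ p) (hαp : 1 / p < α) (hαp' : 1 < 3 * α - 1 / p) :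
    ∃ C : ℝ≥0, ∀ {T : ℝ} {X : ℝ → Vec n} {XX : ℝ → ℝ → Mat n n} {Y : ℝ → Mat m n}
      {Y' : ℝ → Vec n →L[ℝ] Mat m n} {J : ℝ → Vec m}, 0 < T → IsRoughPath α β q T X XX →
      IsControlled α β q T X Y Y' → IsRoughIntegral α β q T X XX Y Y' J →
      boNorm2 (2 * α) (β / 2) (q / 2) T (del J - roughXi X XX Y Y') ≤
        C * (ENNReal.ofReal (T ^ (α - 1 / p)) *
          (boSemi α β q T X * boNorm2 (2 * α) (β / 2) (q / 2) T (remainder X Y Y') +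
            boSemi α β q T Y' * boNorm2 (2 * α) (β / 2) (q / 2) T XX)) := by
  have hq2 : q / 2 ≠ 0 := by simp [hq]
  obtain ⟨C, hC⟩ := exists_boNorm2_del_sub_le (Vec m) (a := 2 * α) (γ := α - 1 / p) hq2
    (by linarith) (by linarith)
  obtain ⟨D, hD⟩ := exists_modulus3_roughXi_le m n hβ hq hp hβp hαp
  refine ⟨C * (D * lpAddConst (q / 2)), fun {T X XX Y Y' J} hT hX hY hJ => ?_⟩
  obtain ⟨M, H⟩ := hJ.exists_decay hα hβ hq hT hp hβp hαp hαp' hX hY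
  have m1 := (modulus2_mono (β / 2) T (remainder X Y Y')).measurable
  have m2 := (modulus2_mono (β / 2) T XX).measurable
  have fX := hX.mem_fst.semi_lt_top.ne
  have fY := hY.mem_deriv.semi_lt_top.ne
  refine (hC (b := β / 2) (by positivity) hT hαp' (secMeas_roughXi hX hY)
    (fun s h0 h1 => roughXi_self hX h0 h1) hJ.cont H
    (((m1.const_mul (boSemi α β q T X)).add (m2.const_mul (boSemi α β q T Y'))).const_mul
      (D : ℝ≥0∞)) (fun τ h0 h1 => hD hX hY τ h0 h1.le)).trans ?_
  have e : scaleNorm (2 * α) (q / 2) T (fun τ => D *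
      (boSemi α β q T X * modulus2 (β / 2) T (remainder X Y Y') τ +
        boSemi α β q T Y' * modulus2 (β / 2) T XX τ)) ≤ D * (lpAddConst (q / 2) *
      (boSemi α β q T X * boNorm2 (2 * α) (β / 2) (q / 2) T (remainder X Y Y') +
            boSemi α β q T Y' * boNorm2 (2 * α) (β / 2) (q / 2) T XX)) := by
    refine (scaleNorm_le_mul D fun _ _ _ => le_rfl).trans (mul_le_mul_right ?_ _)
    refine (scaleNorm_add_le (m1.const_mul _) (m2.const_mul _)).trans (mul_le_mul_right ?_ _)
    rw [← ENNReal.coe_toNNReal fX, ← ENNReal.coe_toNNReal fY]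
    exact add_le_add (scaleNorm_le_mul _ fun _ _ _ => le_rfl)
      (scaleNorm_le_mul _ fun _ _ _ => le_rfl)
  refine (mul_le_mul_right (mul_le_mul_right e _) _).trans (le_of_eq ?_)
  push_cast
  ring

end Integral

/-! ### Paths that are locally described by another path -/

section Described

theorem nnnorm_le_of_boSemi {V : Type*} [NormedAddCommGroup V] {a b p : ℝ} {r : ℝ≥0∞} {C : ℝ≥0}
    {T : ℝ} {f : ℝ → V} (hap : 1 / p < a) (hf : ∀ s t, 0 ≤ s → s ≤ t → t ≤ T →
        ‖f t - f s‖ ≤ C * (boSemi a b r T f).toReal * (t - s) ^ (a - 1 / p)) :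
    ∀ s ∈ Icc 0 T, ‖f s‖ ≤
      (‖f 0‖₊ + C * (boSemi a b r T f).toNNReal * (T ^ (a - 1 / p)).toNNReal : ℝ≥0) := by
  intro s hs
  have hT : 0 ≤ T := hs.1.trans hs.2
  have h1 : ‖f s‖ ≤ ‖f 0‖ + ‖f s - f 0‖ := by
    simpa using norm_add_le (f 0) (f s - f 0)
  refine h1.trans ?_
  push_cast
  rw [Real.coe_toNNReal _ (by positivity)]
  gcongr
  refine (hf 0 s le_rfl hs.1 hs.2).trans ?_
  refine mul_le_mul_of_nonneg_left (Real.rpow_le_rpow ?_ ?_ ?_) (by positivity)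
  · linarith [hs.1]
  · linarith [hs.2]
  · linarith

/-- Interpolation with a uniform bound, carried from sections to the scale norm by `scaleNorm_sqrt`.
-/
theorem boNorm2_le_sqrt {V : Type*} [NormedAddCommGroup V] {a b T : ℝ} {q : ℝ≥0∞} {C M : ℝ≥0}
    (hC : ∀ (D : Set ℝ) (f : ℝ → V) (M : ℝ≥0), volume D ≤ ENNReal.ofReal T →
      (∀ᵐ r ∂volume.restrict D, ‖f r‖ ≤ M) →
        luxNorm b D f ≤ C * (M * luxNorm (b / 2) D f) ^ (1 / 2 : ℝ)) {R : ℝ → ℝ → V}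
    (hR : ∀ s t, 0 ≤ s → s ≤ t → t ≤ T → ‖R s t‖ ≤ M) :
    boNorm2 a b q T R ≤ C * (M * boNorm2 (2 * a) (b / 2) (q / 2) T R) ^ (1 / 2 : ℝ) := by
  have key : ∀ τ, 0 < τ → τ < T → modulus2 b T R τ ≤
      C * (M * modulus2 (b / 2) T R τ) ^ (1 / 2 : ℝ) := by
    intro τ _ _
    refine modulus2_le fun u u0 u1 => (hC (Icc 0 (T - u)) (fun r => R r (r + u)) M ?_ ?_).trans ?_
    · rw [Real.volume_Icc]
      exact ENNReal.ofReal_le_ofReal (by linarith)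
    · refine (ae_restrict_iff' measurableSet_Icc).2 (ae_of_all _ fun s hs => ?_)
      exact hR s (s + u) hs.1 (by linarith) (by linarith [hs.2])
    · gcongr
      exact secNorm_le_modulus2 R u0 u1
  refine (scaleNorm_le_mul C key).trans (mul_le_mul_right ?_ _)
  refine scaleNorm_sqrt.trans ?_
  gcongr
  exact scaleNorm_le_mul M fun _ _ _ => le_rfl

variable {E F G : Type*} [NormedAddCommGroup E] [NormedSpace ℝ E] [CompleteSpace E]
  [NormedAddCommGroup F] [NormedSpace ℝ F] [CompleteSpace F] [NormedAddCommGroup G]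
  [NormedSpace ℝ G] [CompleteSpace G]

/-- The seminorm of a path `J` with increments `y δx + R` in terms of the data. -/
theorem exists_boSemi_le_of_remainder (L : E →L[ℝ] F →L[ℝ] G) {α β p : ℝ} {q : ℝ≥0∞}
    (hβ : 0 < β) (hq : q ≠ 0) (hp : 1 ≤ p) (hβp : β ≤ p) (hαp : 1 / p < α) {T : ℝ} (hT : 0 < T) :
    ∃ C : ℝ≥0, ∀ {x : ℝ → F} {y : ℝ → E} {J : ℝ → G}, ContinuousOn x (Icc 0 T) →
      ContinuousOn y (Icc 0 T) → ContinuousOn J (Icc 0 T) → boSemi α β q T x ≠ ⊤ →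
      boSemi α β q T y ≠ ⊤ →
      boNorm2 (2 * α) (β / 2) (q / 2) T (fun s t => del J s t - L (y s) (del x s t)) ≠ ⊤ →
      boSemi α β q T J ≤ C * ((‖y 0‖ₑ + boSemi α β q T y) * boSemi α β q T x +
        boNorm2 (2 * α) (β / 2) (q / 2) T (fun s t => del J s t - L (y s) (del x s t))) := by
  have hα : 0 < α := lt_trans (by positivity) hαp
  have hβ2 : 0 < β / 2 := by positivity
  have hq2 : q / 2 ≠ 0 := by simp [hq]
  -- The remainder is given only in `Φ_{β/2}`. It is also bounded, by Hölder estimates for `x` and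
  -- for `J`, and the square-root interpolation then places it in `Φ_β` with order `α`.
  obtain ⟨C₁, hC₁⟩ := exists_holder_boSemi F hq hβ hp hβp hαp
  obtain ⟨C₂, hC₂⟩ := exists_holder_boSemi E hq hβ hp hβp hαp
  obtain ⟨C₃, hC₃0, hC₃⟩ := exists_holder G hβ2 hp (by linarith) hαp
  obtain ⟨Cs, hCs⟩ := exists_luxNorm_le_sqrt (V := G) hβ T
  set t : ℝ≥0 := (T ^ (α - 1 / p)).toNNReal with ht
  have htr : (t : ℝ) = T ^ (α - 1 / p) := Real.coe_toNNReal _ (by positivity)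
  set k₁ : ℝ≥0 := 1 + C₂ * t with hk₁
  set k₂ : ℝ≥0 := ‖L‖₊ * k₁ * (2 * luxOne β T * supConst α q) +
    supConst (2 * α) (q / 2) * (T ^ α).toNNReal with hk₂
  set k₃ : ℝ≥0 := C₃.toNNReal * k₂ * t + ‖L‖₊ * k₁ * C₁ * t with hk₃
  refine ⟨lpAddConst q * (‖L‖₊ * k₁ + Cs * (k₃ + 1)), fun {x y J} hx hy hJ fx fy fR => ?_⟩
  set R : ℝ → ℝ → G := fun s t => del J s t - L (y s) (del x s t) with hR
  set P : ℝ → ℝ → G := fun s t => L (y s) (del x s t) with hP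
  have hJPR : del J = P + R := by
    funext s t
    simp [hP, hR]
  set B : ℝ≥0∞ := (‖y 0‖ₑ + boSemi α β q T y) * boSemi α β q T x +
    boNorm2 (2 * α) (β / 2) (q / 2) T R with hB
  have fB : B ≠ ⊤ := ENNReal.add_ne_top.2
    ⟨ENNReal.mul_ne_top (ENNReal.add_ne_top.2 ⟨enorm_ne_top, fy⟩) fx, fR⟩
  have hBt : (B.toNNReal : ℝ≥0∞) = B := ENNReal.coe_toNNReal fB
  set c : ℝ≥0 := ‖y 0‖₊ + C₂ * (boSemi α β q T y).toNNReal * t with hc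
  have hyc : ∀ s ∈ Icc 0 T, ‖y s‖ ≤ c := nnnorm_le_of_boSemi hαp (hC₂ T y hy fy)
  have hcx : (c : ℝ≥0∞) * boSemi α β q T x ≤ k₁ * B := by
    have h1 : (c : ℝ≥0∞) ≤ k₁ * (‖y 0‖ₑ + boSemi α β q T y) := by
      rw [hc, hk₁]
      push_cast
      rw [ENNReal.coe_toNNReal fy, add_mul, one_mul]
      refine add_le_add le_self_add ?_
      rw [mul_right_comm]
      gcongr
      exact le_add_self
    calc (c : ℝ≥0∞) * boSemi α β q T x
        ≤ k₁ * (‖y 0‖ₑ + boSemi α β q T y) * boSemi α β q T x := by gcongr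
      _ ≤ k₁ * B := by
        rw [mul_assoc]
        gcongr
        exact le_self_add
  have hRB : boNorm2 (2 * α) (β / 2) (q / 2) T R ≤ B := le_add_self
  have mP : SecMeas T P := secMeas_bilin L hy (secMeas_del hx)
  -- `J` is first estimated at the weaker exponent `β / 2`, where both summands of its increment are
  -- under control; this suffices for a Hölder bound on `J`.
  have hsec : ∀ h, 0 < h → 2 * h ≤ T →
      secNorm (β / 2) T (del J) h ≤ ENNReal.ofReal ((k₂ * B.toNNReal : ℝ≥0) * h ^ α) := by
    intro h h0 h2
    have hhT : h ≤ T := by linarith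
    have e1 : secNorm (β / 2) T (del x) h ≤
        2 * luxOne β T * (supConst α q * ENNReal.ofReal (h ^ α) * boSemi α β q T x) :=
      (secNorm_embed hβ hβ hβ2 (by field_simp; norm_num) (secMeas_del hx) h0.le
        hhT).trans (mul_le_mul_right (secNorm_le_boNorm2 hα.le hq (del x) h0 h2) _)
    have e2 : secNorm (β / 2) T R h ≤ supConst (2 * α) (q / 2) *
        (ENNReal.ofReal (T ^ α) * ENNReal.ofReal (h ^ α)) * B := by
      refine (secNorm_le_boNorm2 (a := 2 * α) (by positivity) hq2 R h0 h2).trans ?_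
      gcongr
      rw [← ENNReal.ofReal_mul (by positivity), two_mul, Real.rpow_add h0]
      refine ENNReal.ofReal_le_ofReal ?_
      gcongr
    rw [hJPR, ENNReal.ofReal_mul (by positivity), ENNReal.ofReal_coe_nnreal, ENNReal.coe_mul, hBt]
    calc secNorm (β / 2) T (P + R) h
        ≤ secNorm (β / 2) T P h + secNorm (β / 2) T R h := secNorm_add_le hβ2 mP h0.le hhT
      _ ≤ (‖L‖₊ * c : ℝ≥0) * (2 * luxOne β T *
          (supConst α q * ENNReal.ofReal (h ^ α) * boSemi α β q T x)) +
          supConst (2 * α) (q / 2) * (ENNReal.ofReal (T ^ α) * ENNReal.ofReal (h ^ α)) * B :=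
        add_le_add ((secNorm_bilin_le L hβ2 c hyc (del x) h0.le).trans
          (mul_le_mul_right e1 _)) e2
      _ = ‖L‖₊ * (c * boSemi α β q T x) * (2 * luxOne β T * supConst α q) *
          ENNReal.ofReal (h ^ α) +
          supConst (2 * α) (q / 2) * (ENNReal.ofReal (T ^ α) * ENNReal.ofReal (h ^ α)) * B := by
        push_cast
        ring
      _ ≤ ‖L‖₊ * (k₁ * B) * (2 * luxOne β T * supConst α q) * ENNReal.ofReal (h ^ α) +
          supConst (2 * α) (q / 2) * (ENNReal.ofReal (T ^ α) * ENNReal.ofReal (h ^ α)) * B := by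
        gcongr
      _ = _ := by
        rw [hk₂]
        push_cast
        change _ = (_ + _ * ENNReal.ofReal (T ^ α)) * B * _
        ring
  have hpow : ∀ s t', 0 ≤ s → s ≤ t' → t' ≤ T → (t' - s) ^ (α - 1 / p) ≤ t :=
    fun s t' h0 h1 h2 => by
      rw [htr]
      exact Real.rpow_le_rpow (by linarith) (by linarith) (by linarith)
  have hcx' : c * (boSemi α β q T x).toNNReal ≤ k₁ * B.toNNReal := by
    rw [← ENNReal.coe_le_coe]
    push_cast
    rwa [hBt, ENNReal.coe_toNNReal fx]
  have hRb : ∀ s t', 0 ≤ s → s ≤ t' → t' ≤ T → ‖R s t'‖ ≤ (k₃ * B.toNNReal : ℝ≥0) := by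
    intro s t' h0 h1 h2
    have n1 : ‖J t' - J s‖ ≤ (C₃.toNNReal * k₂ * t * B.toNNReal : ℝ≥0) := by
      refine (hC₃ T _ J (NNReal.coe_nonneg _) hJ hsec s t' h0 h1 h2).trans ?_
      simp only [NNReal.coe_mul, Real.coe_toNNReal C₃ hC₃0]
      calc _ ≤ C₃ * (k₂ * B.toNNReal) * t := by
            gcongr
            exact hpow s t' h0 h1 h2
        _ = _ := by ring
    have n2 : ‖L (y s) (x t' - x s)‖ ≤ (‖L‖₊ * k₁ * C₁ * t * B.toNNReal : ℝ≥0) := by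
      calc ‖L (y s) (x t' - x s)‖ ≤ ‖L‖ * ‖y s‖ * ‖x t' - x s‖ := L.le_opNorm₂ _ _
        _ ≤ ‖L‖ * c * (C₁ * (boSemi α β q T x).toReal * t) := by
          gcongr
          · exact hyc s ⟨h0, h1.trans h2⟩
          · refine (hC₁ T x hx fx s t' h0 h1 h2).trans ?_
            gcongr
            exact hpow s t' h0 h1 h2
        _ = ((‖L‖₊ * C₁ * t) * (c * (boSemi α β q T x).toNNReal) : ℝ≥0) := by
          push_cast
          change _ = ‖L‖ * C₁ * t * (c * (boSemi α β q T x).toReal)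
          ring
        _ ≤ ((‖L‖₊ * C₁ * t) * (k₁ * B.toNNReal) : ℝ≥0) := by
          exact_mod_cast mul_le_mul_right hcx' _
        _ = _ := by push_cast; ring
    calc ‖R s t'‖ ≤ ‖J t' - J s‖ + ‖L (y s) (x t' - x s)‖ := norm_sub_le _ _
      _ ≤ _ := add_le_add n1 n2
      _ = _ := by rw [hk₃]; push_cast; ring
  -- Both the uniform bound and the norm of the remainder are linear in `B`, so the root of their
  -- product is linear in `B` again.
  have hsq : boNorm2 α β q T R ≤ Cs * ((k₃ + 1) * B) := by
    refine (boNorm2_le_sqrt hCs hRb).trans (mul_le_mul_right ?_ _)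
    calc (((k₃ * B.toNNReal : ℝ≥0) : ℝ≥0∞) *
          boNorm2 (2 * α) (β / 2) (q / 2) T R) ^ (1 / 2 : ℝ)
        ≤ (((k₃ + 1) * B) ^ (2 : ℝ)) ^ (1 / 2 : ℝ) := by
          gcongr
          rw [ENNReal.rpow_two, sq, ENNReal.coe_mul, hBt]
          gcongr
          · exact le_self_add
          · exact hRB.trans (le_mul_of_one_le_left zero_le le_add_self)
      _ = (k₃ + 1) * B := by rw [← ENNReal.rpow_mul]; norm_num
  calc boSemi α β q T J = boNorm2 α β q T (P + R) := by rw [boSemi, hJPR]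
    _ ≤ lpAddConst q * (boNorm2 α β q T P + boNorm2 α β q T R) := boNorm2_add_le hβ mP
    _ ≤ lpAddConst q * ((‖L‖₊ * c : ℝ≥0) * boSemi α β q T x + Cs * ((k₃ + 1) * B)) := by
        gcongr
        exact boNorm2_bilin_le L hβ c hyc (del x)
    _ = lpAddConst q * (‖L‖₊ * (c * boSemi α β q T x) + Cs * ((k₃ + 1) * B)) := by
        push_cast
        ring
    _ ≤ lpAddConst q * (‖L‖₊ * (k₁ * B) + Cs * ((k₃ + 1) * B)) := by gcongr
    _ = _ := by
        push_cast
        ring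

end Described

/-! ### The remainder of the rough integral -/

section Remainder

variable {m n : ℕ} {α β T p : ℝ} {q : ℝ≥0∞} {X : ℝ → Vec n} {XX : ℝ → ℝ → Mat n n}
  {Y : ℝ → Mat m n} {Y' : ℝ → Vec n →L[ℝ] Mat m n} {J : ℝ → Vec m}

/-- The remainder of the integral is the sewing error plus the second-level term of `Ξ`. -/
theorem remainder_matOp_eq :
    remainder X J (fun s => matOp (Y s)) =
      (del J - roughXi X XX Y Y') + fun s t => tensorActL m n (Y' s) (XX s t) := by
  funext s t
  simp only [remainder, Pi.add_apply, Pi.sub_apply, roughXi_eq, matOpL_apply]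
  abel

/-- The second-level term needs the supremum of `Y'`, bounded by its initial value plus a multiple
of `T ^ (α - 1 / p)` times its seminorm. Hence only the initial value appears without a power of
`T`. -/
theorem exists_boNorm2_remainder_le (m n : ℕ) (hα : 1 / 3 < α) (hβ : 0 < β)
    (hq : q ≠ 0) (hp : 1 ≤ p) (hβp : β ≤ p) (hαp : 1 / p < α) (hαp' : 1 < 3 * α - 1 / p) :
    ∃ C : ℝ≥0, ∀ {T : ℝ} {X : ℝ → Vec n} {XX : ℝ → ℝ → Mat n n} {Y : ℝ → Mat m n}
      {Y' : ℝ → Vec n →L[ℝ] Mat m n} {J : ℝ → Vec m}, 0 < T → IsRoughPath α β q T X XX →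
      IsControlled α β q T X Y Y' → IsRoughIntegral α β q T X XX Y Y' J →
      boNorm2 (2 * α) (β / 2) (q / 2) T (remainder X J (fun s => matOp (Y s))) ≤
        C * (‖Y' 0‖ₑ * boNorm2 (2 * α) (β / 2) (q / 2) T XX +
          ENNReal.ofReal (T ^ (α - 1 / p)) *
          (boSemi α β q T X * boNorm2 (2 * α) (β / 2) (q / 2) T (remainder X Y Y') +
            boSemi α β q T Y' * boNorm2 (2 * α) (β / 2) (q / 2) T XX)) := by
  obtain ⟨C, hC⟩ := exists_boNorm2_half_del_sub_roughXi_le m n hα hβ hq hp hβp hαp hαp'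
  obtain ⟨D, hD⟩ := exists_holder_boSemi (Vec n →L[ℝ] Mat m n) hq hβ hp hβp hαp
  refine ⟨lpAddConst (q / 2) * (C + ‖tensorActL m n‖₊ * (1 + D)),
    fun {T X XX Y Y' J} hT hX hY hJ => ?_⟩
  have fY := hY.mem_deriv.semi_lt_top.ne
  have hβ2 : 0 < β / 2 := by positivity
  have hb := nnnorm_le_of_boSemi hαp (hD T Y' hY.mem_deriv.cont fY)
  set t : ℝ≥0∞ := ENNReal.ofReal (T ^ (α - 1 / p)) with ht
  set N : ℝ≥0∞ := boNorm2 (2 * α) (β / 2) (q / 2) T XX with hN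
  set A : ℝ≥0∞ := boSemi α β q T X *
    boNorm2 (2 * α) (β / 2) (q / 2) T (remainder X Y Y') with hA
  set y : ℝ≥0∞ := boSemi α β q T Y' with hy
  have h1 := hC hT hX hY hJ
  have h2 := boNorm2_bilin_le (a := 2 * α) (r := q / 2) (tensorActL m n) hβ2 _ hb XX
  rw [remainder_matOp_eq (Y' := Y') (XX := XX)]
  refine (boNorm2_add_le hβ2 hJ.sewing.meas_section).trans ?_
  rw [ENNReal.coe_mul, mul_assoc]
  refine mul_le_mul_right ?_ _
  refine (add_le_add h1 h2).trans ?_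
  rw [ENNReal.coe_mul, ENNReal.coe_add, ENNReal.coe_mul, ENNReal.coe_mul, ENNReal.coe_toNNReal fY]
  change C * (t * (A + y * N)) + ‖tensorActL m n‖₊ * (‖Y' 0‖ₑ + D * y * t) * N ≤ _
  rw [ENNReal.coe_add, ENNReal.coe_mul, ENNReal.coe_add, ENNReal.coe_one, add_mul (C : ℝ≥0∞)]
  refine add_le_add (mul_le_mul_right le_add_self _) ?_
  rw [mul_assoc (‖tensorActL m n‖₊ : ℝ≥0∞), mul_assoc (‖tensorActL m n‖₊ : ℝ≥0∞)]
  refine mul_le_mul_right ?_ _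
  calc (‖Y' 0‖ₑ + D * y * t) * N = ‖Y' 0‖ₑ * N + D * (t * (y * N)) := by ring
    _ ≤ (‖Y' 0‖ₑ * N + t * (A + y * N)) + D * (‖Y' 0‖ₑ * N + t * (A + y * N)) := by
      refine add_le_add le_self_add (mul_le_mul_right ?_ _)
      refine le_trans ?_ le_add_self
      exact mul_le_mul_right le_add_self _
    _ = _ := by ring

theorem luxNorm_lt_top_of_continuousOn {V : Type*} [NormedAddCommGroup V] {b : ℝ} (hb : 0 < b)
    {f : ℝ → V} (hf : ContinuousOn f (Icc 0 T)) : luxNorm b (Icc 0 T) f < ⊤ := by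
  obtain ⟨c, hc⟩ := exists_nnreal_bound hf
  refine (luxNorm_le_of_bound (T := T) hb c (by simp [Real.volume_Icc])
    ((ae_restrict_iff' measurableSet_Icc).2 (ae_of_all _ hc))).trans_lt ?_
  exact ENNReal.mul_lt_top ENNReal.coe_lt_top ENNReal.coe_lt_top

theorem boSemi_matOp_le (hβ : 0 < β) (Y : ℝ → Mat m n) :
    boSemi α β q T (fun s => matOp (Y s)) ≤ ‖matOpL m n‖₊ * boSemi α β q T Y :=
  boNorm2_le_mul hβ _ fun s t _ _ _ => by
    change ‖matOpL m n (Y t) - matOpL m n (Y s)‖ ≤ _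
    rw [← map_sub]
    exact (matOpL m n).le_opNorm _

theorem memBO_matOp (hβ : 0 < β) (hY : MemBO α β q T Y) :
    MemBO α β q T (fun s => matOp (Y s)) where
  cont := (matOpL m n).continuous.comp_continuousOn hY.cont
  orlicz := luxNorm_lt_top_of_continuousOn hβ ((matOpL m n).continuous.comp_continuousOn hY.cont)
  semi_lt_top := (boSemi_matOp_le hβ Y).trans_lt
    (ENNReal.mul_lt_top ENNReal.coe_lt_top hY.semi_lt_top)

theorem boNorm2_remainder_lt_top (hα : 1 / 3 < α) (hβ : 0 < β)
    (hq : q ≠ 0) (hp : 1 ≤ p) (hβp : β ≤ p) (hαp : 1 / p < α) (hαp' : 1 < 3 * α - 1 / p)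
    (hT : 0 < T) (hX : IsRoughPath α β q T X XX) (hY : IsControlled α β q T X Y Y')
    (hJ : IsRoughIntegral α β q T X XX Y Y' J) :
    boNorm2 (2 * α) (β / 2) (q / 2) T (remainder X J (fun s => matOp (Y s))) < ⊤ := by
  obtain ⟨C, hC⟩ := exists_boNorm2_remainder_le m n hα hβ hq hp hβp hαp hαp'
  have h1 := hX.mem_fst.semi_lt_top
  have h2 := hX.mem_snd.norm_lt_top
  have h3 := hY.mem_deriv.semi_lt_top
  have h4 := hY.mem_remainder.norm_lt_top
  exact (hC hT hX hY hJ).trans_lt (ENNReal.mul_lt_top ENNReal.coe_lt_top (ENNReal.add_lt_top.2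
    ⟨ENNReal.mul_lt_top enorm_lt_top h2, ENNReal.mul_lt_top ENNReal.ofReal_lt_top
      (ENNReal.add_lt_top.2 ⟨ENNReal.mul_lt_top h1 h4, ENNReal.mul_lt_top h3 h2⟩)⟩))

theorem boNorm2_le_roughNorm_sq :
    boNorm2 (2 * α) (β / 2) (q / 2) T XX ≤ roughNorm α β q T X XX ^ 2 := by
  calc boNorm2 (2 * α) (β / 2) (q / 2) T XX
      = (boNorm2 (2 * α) (β / 2) (q / 2) T XX ^ (1 / 2 : ℝ)) ^ 2 := by
        rw [← ENNReal.rpow_two, ← ENNReal.rpow_mul]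
        norm_num
    _ ≤ _ := by
        gcongr
        exact le_add_self

theorem boSemi_le_roughNorm : boSemi α β q T X ≤ roughNorm α β q T X XX := le_self_add

/-- The bound on the seminorm of the rough integral. -/
theorem exists_boSemi_integral_le (m n : ℕ) (hα : 1 / 3 < α) (hβ : 0 < β)
    (hq : q ≠ 0) (hp : 1 ≤ p) (hβp : β ≤ p) (hαp : 1 / p < α) (hαp' : 1 < 3 * α - 1 / p)
    (hT : 0 < T) :
    ∃ C : ℝ≥0, ∀ {X : ℝ → Vec n} {XX : ℝ → ℝ → Mat n n} {Y : ℝ → Mat m n}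
      {Y' : ℝ → Vec n →L[ℝ] Mat m n} {J : ℝ → Vec m}, IsRoughPath α β q T X XX →
      IsControlled α β q T X Y Y' → IsRoughIntegral α β q T X XX Y Y' J →
      boSemi α β q T J ≤
          C * ((‖Y 0‖ₑ + boSemi α β q T Y +
              boNorm2 (2 * α) (β / 2) (q / 2) T (remainder X Y Y')) * boSemi α β q T X +
            (‖Y' 0‖ₑ + boSemi α β q T Y') * roughNorm α β q T X XX ^ 2) := by
  obtain ⟨C, hC⟩ := exists_boNorm2_remainder_le m n hα hβ hq hp hβp hαp hαp'
  obtain ⟨D, hD⟩ := exists_boSemi_le_of_remainder (matOpL m n) hβ hq hp hβp hαp hT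
  refine ⟨D * (1 + C * (1 + (T ^ (α - 1 / p)).toNNReal)), fun {X XX Y Y' J} hX hY hJ => ?_⟩
  have fR := boNorm2_remainder_lt_top hα hβ hq hp hβp hαp hαp' hT hX hY hJ
  refine (hD hX.mem_fst.cont hY.mem_path.cont hJ.cont hX.mem_fst.semi_lt_top.ne
    hY.mem_path.semi_lt_top.ne fR.ne).trans ?_
  rw [ENNReal.coe_mul, mul_assoc]
  refine mul_le_mul_right ?_ _
  have h1 := hC hT hX hY hJ
  have hN : boNorm2 (2 * α) (β / 2) (q / 2) T XX ≤ roughNorm α β q T X XX ^ 2 :=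
    boNorm2_le_roughNorm_sq
  set N := roughNorm α β q T X XX ^ 2
  set W := boNorm2 (2 * α) (β / 2) (q / 2) T XX
  set R := boNorm2 (2 * α) (β / 2) (q / 2) T (remainder X Y Y')
  set x := boSemi α β q T X
  set y' := boSemi α β q T Y'
  set y := boSemi α β q T Y
  set t := (T ^ (α - 1 / p)).toNNReal with ht
  set S := (‖Y 0‖ₑ + y + R) * x + (‖Y' 0‖ₑ + y') * N with hS
  change boNorm2 (2 * α) (β / 2) (q / 2) T (remainder X J (fun s => matOp (Y s))) ≤
    C * (‖Y' 0‖ₑ * W + t * (x * R + y' * W)) at h1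
  change (‖Y 0‖ₑ + y) * x +
    boNorm2 (2 * α) (β / 2) (q / 2) T (remainder X J (fun s => matOp (Y s))) ≤ _
  have e1 : (‖Y 0‖ₑ + y) * x ≤ S := (mul_le_mul_left le_self_add _).trans le_self_add
  have e2 : ‖Y' 0‖ₑ * W ≤ S := by
    refine le_trans ?_ le_add_self
    gcongr
    exact le_self_add
  have e3 : x * R + y' * W ≤ S := by
    rw [mul_comm x]
    refine add_le_add ?_ ?_
    · gcongr
      exact le_add_self
    · gcongr
      exact le_add_self
  calc _ ≤ S + C * (S + t * S) := by
        refine add_le_add e1 (h1.trans ?_)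
        gcongr
    _ = _ := by push_cast; ring

theorem isControlled_integral (hα : 1 / 3 < α) (hβ : 0 < β)
    (hq : q ≠ 0) (hp : 1 ≤ p) (hβp : β ≤ p) (hαp : 1 / p < α) (hαp' : 1 < 3 * α - 1 / p)
    (hT : 0 < T) (hX : IsRoughPath α β q T X XX) (hY : IsControlled α β q T X Y Y')
    (hJ : IsRoughIntegral α β q T X XX Y Y' J) :
    IsControlled α β q T X J (fun s => matOp (Y s)) where
  mem_path :=
    { cont := hJ.cont
      orlicz := luxNorm_lt_top_of_continuousOn hβ hJ.cont
      semi_lt_top := by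
        obtain ⟨D, hD⟩ := exists_boSemi_le_of_remainder (matOpL m n) hβ hq hp hβp hαp hT
        have fR := boNorm2_remainder_lt_top hα hβ hq hp hβp hαp hαp' hT hX hY hJ
        refine (hD hX.mem_fst.cont hY.mem_path.cont hJ.cont hX.mem_fst.semi_lt_top.ne
          hY.mem_path.semi_lt_top.ne fR.ne).trans_lt ?_
        exact ENNReal.mul_lt_top ENNReal.coe_lt_top (ENNReal.add_lt_top.2
          ⟨ENNReal.mul_lt_top (ENNReal.add_lt_top.2 ⟨enorm_lt_top, hY.mem_path.semi_lt_top⟩)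
            hX.mem_fst.semi_lt_top, fR⟩) }
  mem_deriv := memBO_matOp hβ hY.mem_path
  mem_remainder :=
    { meas := (aestronglyMeasurable_del_simplex2 hJ.cont).sub
        (aestronglyMeasurable_bilin_simplex2 (matOpL m n) hY.mem_path.cont
          (aestronglyMeasurable_del_simplex2 hX.mem_fst.cont))
      meas_section := (secMeas_del hJ.cont).sub
        (secMeas_bilin (matOpL m n) hY.mem_path.cont (secMeas_del hX.mem_fst.cont))
      norm_lt_top := boNorm2_remainder_lt_top hα hβ hq hp hβp hαp hαp' hT hX hY hJ }

end Remainder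

/-! ### Linear combinations -/

section Linear

variable {V : Type*} [NormedAddCommGroup V] [NormedSpace ℝ V] {a b T : ℝ} {r : ℝ≥0∞}

theorem boNorm2_smul_le (hb : 0 < b) (c : ℝ) (A : ℝ → ℝ → V) :
    boNorm2 a b r T (c • A) ≤ ‖c‖₊ * boNorm2 a b r T A :=
  boNorm2_le_mul hb _ fun s t _ _ _ => by simp [norm_smul]

theorem MemBO2.lincomb (hb : 0 < b) {A B : ℝ → ℝ → V} (hA : MemBO2 a b r T A)
    (hB : MemBO2 a b r T B) (c d : ℝ) : MemBO2 a b r T (c • A + d • B) where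
  meas := (hA.meas.const_smul c).add (hB.meas.const_smul d)
  meas_section := fun h hh =>
    ((hA.meas_section h hh).const_smul c).add ((hB.meas_section h hh).const_smul d)
  norm_lt_top := by
    have hcA : SecMeas T (c • A) := fun h hh => (hA.meas_section h hh).const_smul c
    refine (boNorm2_add_le hb hcA).trans_lt ?_
    refine ENNReal.mul_lt_top ENNReal.coe_lt_top (ENNReal.add_lt_top.2 ⟨?_, ?_⟩)
    · exact (boNorm2_smul_le hb c A).trans_lt
        (ENNReal.mul_lt_top ENNReal.coe_lt_top hA.norm_lt_top)
    · exact (boNorm2_smul_le hb d B).trans_lt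
        (ENNReal.mul_lt_top ENNReal.coe_lt_top hB.norm_lt_top)

theorem MemBO.memBO2_del {W : Type*} [NormedAddCommGroup W] {f : ℝ → W} (hf : MemBO a b r T f) :
    MemBO2 a b r T (del f) where
  meas := aestronglyMeasurable_del_simplex2 hf.cont
  meas_section := secMeas_del hf.cont
  norm_lt_top := hf.semi_lt_top

theorem del_lincomb (f g : ℝ → V) (c d : ℝ) :
    del (c • f + d • g) = c • del f + d • del g := by
  funext s t
  simp only [del, Pi.add_apply, Pi.smul_apply]
  module

theorem MemBO.lincomb (hb : 0 < b) {f g : ℝ → V} (hf : MemBO a b r T f)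
    (hg : MemBO a b r T g) (c d : ℝ) : MemBO a b r T (c • f + d • g) where
  cont := (hf.cont.const_smul c).add (hg.cont.const_smul d)
  orlicz := luxNorm_lt_top_of_continuousOn hb ((hf.cont.const_smul c).add (hg.cont.const_smul d))
  semi_lt_top := by
    rw [boSemi, del_lincomb]
    exact (hf.memBO2_del.lincomb hb hg.memBO2_del c d).norm_lt_top

variable {m n : ℕ} {α β : ℝ} {q : ℝ≥0∞} {X : ℝ → Vec n} {XX : ℝ → ℝ → Mat n n}

theorem IsControlled.lincomb (hβ : 0 < β) {Y Z : ℝ → V} {Y' Z' : ℝ → Vec n →L[ℝ] V}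
    (hY : IsControlled α β q T X Y Y') (hZ : IsControlled α β q T X Z Z') (c d : ℝ) :
    IsControlled α β q T X (c • Y + d • Z) (c • Y' + d • Z') where
  mem_path := hY.mem_path.lincomb hβ hZ.mem_path c d
  mem_deriv := hY.mem_deriv.lincomb hβ hZ.mem_deriv c d
  mem_remainder := by
    have : remainder X (c • Y + d • Z) (c • Y' + d • Z') =
        c • remainder X Y Y' + d • remainder X Z Z' := by
      funext s t
      simp only [remainder, del_lincomb, Pi.add_apply, Pi.smul_apply, add_apply, smul_apply]
      module
    rw [this]
    exact hY.mem_remainder.lincomb (by positivity) hZ.mem_remainder c d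

theorem IsRoughIntegral.lincomb (hβ : 0 < β) {Y Z : ℝ → Mat m n}
    {Y' Z' : ℝ → Vec n →L[ℝ] Mat m n} {J K : ℝ → Vec m}
    (hJ : IsRoughIntegral α β q T X XX Y Y' J) (hK : IsRoughIntegral α β q T X XX Z Z' K)
    (c d : ℝ) :
    IsRoughIntegral α β q T X XX (c • Y + d • Z) (c • Y' + d • Z') (c • J + d • K) where
  cont := (hJ.cont.const_smul c).add (hK.cont.const_smul d)
  zero := by simp [hJ.zero, hK.zero]
  sewing := by
    have : del (c • J + d • K) - roughXi X XX (c • Y + d • Z) (c • Y' + d • Z') =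
        c • (del J - roughXi X XX Y Y') + d • (del K - roughXi X XX Z Z') := by
      funext s t
      simp only [del_lincomb, roughXi_eq, Pi.add_apply, Pi.smul_apply, Pi.sub_apply, map_add,
        map_smul, add_apply, smul_apply]
      module
    rw [this]
    exact hJ.sewing.lincomb (by positivity) hK.sewing c d

end Linear

/-! ### Convergence of partial sums -/

section Partition

/-- The power `ρ = min 1 r` of the quasinorm is subadditive without a constant depending on the
number of summands. The assumption `1 / a < r` is exactly what keeps `a * ρ > 1`. -/
theorem exists_scaleNorm_sum_rpow_le {a : ℝ} (ha : 1 < a) {r : ℝ≥0∞}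
    (hr : ENNReal.ofReal (1 / a) < r) :
    ∃ ρ : ℝ, 0 < ρ ∧ 1 < a * ρ ∧ ∀ (T : ℝ) {ι : Type} (s : Finset ι) (ω : ι → ℝ → ℝ≥0∞),
      (∀ i, Measurable (ω i)) →
      scaleNorm a r T (fun τ => ∑ i ∈ s, ω i τ) ^ ρ ≤ ∑ i ∈ s, scaleNorm a r T (ω i) ^ ρ := by
  have ha0 : 0 < a := by linarith
  have hr0 : r ≠ 0 := (zero_le.trans_lt hr).ne'
  suffices h : ∃ ρ : ℝ, 0 < ρ ∧ 1 < a * ρ ∧ ∀ (T : ℝ) (ω ω' : ℝ → ℝ≥0∞), Measurable ω →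
      Measurable ω' → scaleNorm a r T (fun τ => ω τ + ω' τ) ^ ρ ≤
        scaleNorm a r T ω ^ ρ + scaleNorm a r T ω' ^ ρ by
    obtain ⟨ρ, h0, h1, h⟩ := h
    refine ⟨ρ, h0, h1, fun T ι s ω hω => ?_⟩
    classical
    induction s using Finset.induction_on with
    | empty =>
      have : scaleNorm a r T (fun _ => 0) = 0 := by simp [scaleNorm]
      simp [this, h0]
    | insert i s hi ih =>
      simp only [Finset.sum_insert hi]
      exact (h T _ _ (hω i) (Finset.measurable_fun_sum s fun i _ => hω i)).trans
        (add_le_add le_rfl ih)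
  rcases le_or_gt 1 r with h1 | h1
  · refine ⟨1, one_pos, by linarith, fun T ω ω' hω hω' => ?_⟩
    simp only [ENNReal.rpow_one]
    refine le_trans (le_of_eq ?_) (eLpNorm_add_le (measurable_scale hω).aestronglyMeasurable
      (measurable_scale hω').aestronglyMeasurable h1)
    unfold scaleNorm
    congr 1
    ext τ
    simp only [Pi.add_apply]
    rw [ENNReal.add_div]
  · have hrt : r ≠ ⊤ := (h1.trans ENNReal.one_lt_top).ne
    have hρ0 : 0 < r.toReal := ENNReal.toReal_pos hr0 hrt
    have hρ1 : r.toReal ≤ 1 := by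
      simpa using ENNReal.toReal_mono ENNReal.one_ne_top h1.le
    refine ⟨r.toReal, hρ0, ?_, fun T ω ω' hω hω' => ?_⟩
    · have := (ENNReal.ofReal_lt_iff_lt_toReal (by positivity) hrt).1 hr
      rwa [div_lt_iff₀ ha0, mul_comm] at this
    · simp only [scaleNorm, eLpNorm_ennreal hr0 hrt, ← ENNReal.rpow_mul]
      rw [one_div, inv_mul_cancel₀ hρ0.ne']
      simp only [ENNReal.rpow_one]
      rw [← lintegral_add_left ((measurable_scale hω).pow_const _)]
      refine lintegral_mono fun τ => ?_
      change ((ω τ + ω' τ) / _) ^ _ ≤ (ω τ / _) ^ _ + (ω' τ / _) ^ _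
      rw [ENNReal.add_div]
      exact ENNReal.rpow_add_le_add_rpow _ _ hρ0.le hρ1

theorem sum_succ_sub_castSucc {V : Type*} [AddCommGroup V] (N : ℕ) (g : Fin (N + 1) → V) :
    ∑ i : Fin N, (g i.succ - g i.castSucc) = g (Fin.last N) - g 0 := by
  induction N with
  | zero => simp
  | succ N ih =>
    rw [Fin.sum_univ_castSucc]
    have := ih (fun i => g i.castSucc)
    simp only [Fin.succ_castSucc, Fin.succ_last] at this ⊢
    rw [this, Fin.castSucc_zero]
    abel

variable (π : UnitPartition)

/-- The length of the `i`-th interval of a partition. -/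
def UnitPartition.len (i : Fin π.N) : ℝ := π.pt i.succ - π.pt i.castSucc

theorem UnitPartition.len_pos (i : Fin π.N) : 0 < π.len i :=
  sub_pos.2 (π.strictMono Fin.castSucc_lt_succ)

theorem UnitPartition.len_le_mesh (i : Fin π.N) : π.len i ≤ π.mesh :=
  le_ciSup (f := fun i : Fin π.N => π.pt i.succ - π.pt i.castSucc)
    (Set.finite_range _).bddAbove i

theorem UnitPartition.sum_len : ∑ i, π.len i = 1 := by
  have := sum_succ_sub_castSucc π.N π.pt
  rw [π.pt_zero, π.pt_last, sub_zero] at this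
  exact this

theorem UnitPartition.pt_nonneg (i : Fin (π.N + 1)) : 0 ≤ π.pt i := by
  rw [← π.pt_zero]
  exact π.strictMono.monotone (Fin.zero_le i)

theorem UnitPartition.pt_le_one (i : Fin (π.N + 1)) : π.pt i ≤ 1 := by
  rw [← π.pt_last]
  exact π.strictMono.monotone (Fin.le_last i)

theorem UnitPartition.sum_len_rpow_le {e : ℝ} (he : 1 < e) :
    ∑ i, π.len i ^ e ≤ π.mesh ^ (e - 1) := by
  calc ∑ i, π.len i ^ e ≤ ∑ i, π.mesh ^ (e - 1) * π.len i := by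
        refine Finset.sum_le_sum fun i _ => ?_
        have h0 := π.len_pos i
        calc π.len i ^ e = π.len i ^ (e - 1) * π.len i := by
              rw [Real.rpow_sub_one h0.ne', div_mul_cancel₀ _ h0.ne']
          _ ≤ _ := mul_le_mul_of_nonneg_right
              (Real.rpow_le_rpow h0.le (π.len_le_mesh i) (by linarith)) h0.le
    _ = _ := by rw [← Finset.mul_sum, π.sum_len, mul_one]

variable {V : Type*} [NormedAddCommGroup V]

/-- Increments telescope, so the convergence of partial sums becomes a statement about the sewing
error alone. -/
theorem UnitPartition.del_sub_partialSum (f : ℝ → V) (A : ℝ → ℝ → V) :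
    del f - π.partialSum A = π.partialSum (del f - A) := by
  funext s t
  have := sum_succ_sub_castSucc π.N (fun i => f (s + π.pt i * (t - s)))
  rw [π.pt_zero, π.pt_last] at this
  simp only [zero_mul, add_zero, one_mul, add_sub_cancel] at this
  simp only [Pi.sub_apply, UnitPartition.partialSum, Finset.sum_sub_distrib]
  congr 1
  exact this.symm

theorem UnitPartition.modulus2_partialSum_le {b T : ℝ} (hb : 0 < b) {A : ℝ → ℝ → V}
    (hA : SecMeas T A) {τ : ℝ} (hτ : τ ≤ T) :
    modulus2 b T (π.partialSum A) τ ≤ ∑ i, modulus2 b T A (π.len i * τ) := by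
  refine modulus2_le fun h h0 hh => ?_
  have hle : ∀ i : Fin π.N, π.pt i.castSucc * h + π.len i * h ≤ h := fun i => by
    rw [← add_mul, show π.pt i.castSucc + π.len i = π.pt i.succ by simp [UnitPartition.len]]
    exact mul_le_of_le_one_left h0 (π.pt_le_one _)
  have e : (fun r => π.partialSum A r (r + h)) = fun r => ∑ i : Fin π.N,
      A (r + π.pt i.castSucc * h) (r + π.pt i.castSucc * h + π.len i * h) := by
    funext r
    simp only [UnitPartition.partialSum, UnitPartition.len, add_sub_cancel_left]
    refine Finset.sum_congr rfl fun i _ => ?_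
    congr 1
    ring
  have c0 : ∀ i : Fin π.N, 0 ≤ π.pt i.castSucc * h := fun i => mul_nonneg (π.pt_nonneg _) h0
  have l0 : ∀ i : Fin π.N, 0 ≤ π.len i * h := fun i => mul_nonneg (π.len_pos i).le h0
  rw [secNorm, e]
  refine (luxNorm_sum_le hb Finset.univ fun i _ => hA.shift (c0 i) (l0 i) (hle i)
    (by linarith [hle i, c0 i])).trans (Finset.sum_le_sum fun i _ => ?_)
  refine (luxNorm_shift_le_secNorm hb A (c0 i) (hle i)).trans
    (secNorm_le_modulus2 A (l0 i) ?_)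
  exact mul_le_mul_of_nonneg_left hh (π.len_pos i).le

/-- Riemann-type sums of a remainder of order larger than one tend to zero. -/
theorem tendsto_boNorm2_partialSum {a b T : ℝ} (ha : 1 < a) (hb : 0 < b) (hT : 0 < T)
    {r₀ r : ℝ≥0∞} (hr₀ : r₀ ≠ 0) (hr₀r : r₀ ≤ r) (hr : ENNReal.ofReal (1 / a) < r)
    {A : ℝ → ℝ → V} (hA : SecMeas T A) (hfin : boNorm2 a b r₀ T A < ⊤) {π : ℕ → UnitPartition}
    (hπ : Tendsto (fun N => (π N).mesh) atTop (𝓝 0)) :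
    Tendsto (fun N => boNorm2 a b r T ((π N).partialSum A)) atTop (𝓝 0) := by
  obtain ⟨ρ, hρ0, hρ1, hρ⟩ := exists_scaleNorm_sum_rpow_le ha hr
  have hmono := modulus2_mono b T A
  have hN : scaleNorm a r (T / 2) (modulus2 b T A) < ⊤ :=
    scaleNorm_lt_top_of_le (by linarith) hr₀ hr₀r hmono hfin
  set M : ℝ≥0∞ := scaleNorm a r (T / 2) (modulus2 b T A) with hM
  -- Once the mesh is at most `1 / 2`, every dilation maps the scales into `(0, T / 2]`, where the
  -- norm with the larger exponent `r` is finite.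
  have bound : ∀ᶠ N in atTop, boNorm2 a b r T ((π N).partialSum A) ≤
      (M ^ ρ * ENNReal.ofReal ((π N).mesh ^ (a * ρ - 1))) ^ (1 / ρ) := by
    filter_upwards [hπ.eventually (eventually_le_nhds (show (0 : ℝ) < 1 / 2 by norm_num))]
      with N hmesh
    rw [one_div, ← ENNReal.rpow_le_rpow_iff hρ0, ← ENNReal.rpow_mul, inv_mul_cancel₀ hρ0.ne',
      ENNReal.rpow_one]
    calc boNorm2 a b r T ((π N).partialSum A) ^ ρ
        ≤ scaleNorm a r T (fun τ => ∑ i, modulus2 b T A ((π N).len i * τ)) ^ ρ := by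
          gcongr
          exact scaleNorm_mono fun τ _ hτ => (π N).modulus2_partialSum_le hb hA hτ.le
      _ ≤ ∑ i, scaleNorm a r T (fun τ => modulus2 b T A ((π N).len i * τ)) ^ ρ :=
          hρ T Finset.univ _ fun i => hmono.measurable.comp (measurable_const_mul _)
      _ ≤ ∑ i, M ^ ρ * ENNReal.ofReal ((π N).len i ^ (a * ρ)) := by
          refine Finset.sum_le_sum fun i _ => ?_
          have hl := (π N).len_pos i
          have h1 : scaleNorm a r T (fun τ => modulus2 b T A ((π N).len i * τ)) ≤
              ENNReal.ofReal ((π N).len i ^ a) * M := by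
            refine (scaleNorm_dilate hl hmono.measurable).trans (mul_le_mul_right ?_ _)
            refine scaleNorm_mono_time ?_
            have := (π N).len_le_mesh i
            nlinarith
          refine (ENNReal.rpow_le_rpow h1 hρ0.le).trans (le_of_eq ?_)
          rw [ENNReal.mul_rpow_of_nonneg _ _ hρ0.le, mul_comm,
            ENNReal.ofReal_rpow_of_nonneg (by positivity) hρ0.le, ← Real.rpow_mul hl.le]
      _ = M ^ ρ * ENNReal.ofReal (∑ i, (π N).len i ^ (a * ρ)) := by
          rw [← Finset.mul_sum, ENNReal.ofReal_sum_of_nonneg fun i _ => by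
            have := (π N).len_pos i
            positivity]
      _ ≤ _ := by
          gcongr
          exact (π N).sum_len_rpow_le hρ1
  have hlim : Tendsto (fun N => (M ^ ρ * ENNReal.ofReal ((π N).mesh ^ (a * ρ - 1))) ^ (1 / ρ))
      atTop (𝓝 0) := by
    have h1 : Tendsto (fun N => (π N).mesh ^ (a * ρ - 1)) atTop (𝓝 0) := by
      have := hπ.rpow_const (p := a * ρ - 1) (Or.inr (by linarith))
      rwa [Real.zero_rpow (by linarith)] at this
    have h2 := ENNReal.tendsto_ofReal h1
    rw [ENNReal.ofReal_zero] at h2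
    have h3 := ENNReal.Tendsto.const_mul (a := M ^ ρ) h2
      (Or.inr (ENNReal.rpow_ne_top_of_nonneg hρ0.le hN.ne))
    rw [mul_zero] at h3
    have h4 := h3.ennrpow_const (1 / ρ)
    rwa [ENNReal.zero_rpow_of_pos (by positivity)] at h4
  exact tendsto_of_tendsto_of_tendsto_of_le_of_le' tendsto_const_nhds hlim
    (Eventually.of_forall fun _ => zero_le) bound

end Partition

/-! ### Admissible integrability exponents -/

/-- An integrability exponent that is large enough for the rough sewing. -/
def sewExp (α β : ℝ) : ℝ := max (max 1 β) (max (2 / α) (2 / (3 * α - 1)))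

theorem sewExp_spec {α β p : ℝ} (hα : 1 / 3 < α) (hp : sewExp α β ≤ p) :
    1 ≤ p ∧ β ≤ p ∧ 1 / p < α ∧ 1 < 3 * α - 1 / p := by
  have hα0 : 0 < α := by linarith
  have h3 : 0 < 3 * α - 1 := by linarith
  have h1 : 1 ≤ p := ((le_max_left 1 β).trans (le_max_left _ _)).trans hp
  have hp0 : 0 < p := by linarith
  have a1 : 2 / α ≤ p := ((le_max_left _ _).trans (le_max_right _ _)).trans hp
  have a2 : 2 / (3 * α - 1) ≤ p := ((le_max_right _ _).trans (le_max_right _ _)).trans hp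
  rw [div_le_iff₀ hα0] at a1
  rw [div_le_iff₀ h3] at a2
  refine ⟨h1, ((le_max_right 1 β).trans (le_max_left _ _)).trans hp, ?_, ?_⟩
  · rw [div_lt_iff₀ hp0]
    linarith
  · have : 1 / p < 3 * α - 1 := by
      rw [div_lt_iff₀ hp0]
      linarith
    linarith

/-- The remainder is paired with the first power of the rough path norm and the seminorm of `Y'`
with its square; the maximum covers both. -/
theorem products_le_max_mul_controlledSemi {n : ℕ} {V : Type*} [NormedAddCommGroup V]
    [NormedSpace ℝ V] {α β T : ℝ} {q : ℝ≥0∞} {X : ℝ → Vec n} {XX : ℝ → ℝ → Mat n n} {Y : ℝ → V}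
    {Y' : ℝ → Vec n →L[ℝ] V} :
    boSemi α β q T X * boNorm2 (2 * α) (β / 2) (q / 2) T (remainder X Y Y') +
        boSemi α β q T Y' * boNorm2 (2 * α) (β / 2) (q / 2) T XX ≤
      max (roughNorm α β q T X XX) (roughNorm α β q T X XX ^ 2) *
        controlledSemi α β q T X Y Y' := by
  rw [controlledSemi, mul_add, add_comm, mul_comm (boSemi α β q T Y')]
  gcongr
  · exact boNorm2_le_roughNorm_sq.trans (le_max_right _ _)
  · exact boSemi_le_roughNorm.trans (le_max_left _ _)

end

end BesovOrlicz

/-! ### Assembly: the constants and the integral map. -/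

theorem theorem4p14 (m n : ℕ) (q : ℝ≥0∞) (hq : 0 < q) :
    ∃ C₂ : ℝ → ℝ≥0, MonotoneOn C₂ (Ioi 0) ∧
    ∀ α β : ℝ, 1 / 3 < α → α ≤ 1 / 2 → 0 < β →
    ∃ (C₁ C₃ : ℝ → ℝ≥0) (C₄ : ℝ → ℝ → ℝ≥0),
      MonotoneOn C₁ (Ioi 0) ∧ (∀ p : ℝ, 3 / α < p → MonotoneOn (C₄ p) (Ioi 0)) ∧
    ∀ T : ℝ, 0 < T → ∀ (X : ℝ → Vec n) (XX : ℝ → ℝ → Mat n n), IsRoughPath α β q T X XX →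
    ∃ I : (ℝ → Mat m n) → (ℝ → Vec n →L[ℝ] Mat m n) → ℝ → Vec m,
      -- linearity of `(Y, Y') ↦ (I(Y, Y'), Y)` on the vector space of controlled paths
      (∀ (Y Z : ℝ → Mat m n) (Y' Z' : ℝ → Vec n →L[ℝ] Mat m n),
        IsControlled α β q T X Y Y' → IsControlled α β q T X Z Z' → ∀ a b : ℝ,
          IsControlled α β q T X (a • Y + b • Z) (a • Y' + b • Z') ∧
          EqOn (I (a • Y + b • Z) (a • Y' + b • Z')) (a • I Y Y' + b • I Z Z') (Icc 0 T)) ∧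
      ∀ (Y : ℝ → Mat m n) (Y' : ℝ → Vec n →L[ℝ] Mat m n), IsControlled α β q T X Y Y' →
        -- existence and uniqueness of the sewing
        IsRoughIntegral α β q T X XX Y Y' (I Y Y') ∧
        (∀ J : ℝ → Vec m, IsRoughIntegral α β q T X XX Y Y' J → EqOn J (I Y Y') (Icc 0 T)) ∧
        -- the integral is a controlled path with derivative `Y`
        IsControlled α β q T X (I Y Y') (fun s => matOp (Y s)) ∧
        -- convergence of the partial sums
        (∀ r : ℝ≥0∞, ENNReal.ofReal (1 / (3 * α)) < r → q / 3 ≤ r →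
          ∀ π : ℕ → UnitPartition, Tendsto (fun N => (π N).mesh) atTop (𝓝 0) →
            Tendsto (fun N => boNorm2 (3 * α) (β / 3) r T
              (del (I Y Y') - (π N).partialSum (roughXi X XX Y Y'))) atTop (𝓝 0)) ∧
        -- bounds on `δI - Ξ`
        boNorm2 (3 * α) (β / 3) (q / 3) T (del (I Y Y') - roughXi X XX Y Y') ≤
          C₁ T * boNorm3 (3 * α) (β / 3) (q / 3) T (del2 (roughXi X XX Y Y')) ∧
        boNorm3 (3 * α) (β / 3) (q / 3) T (del2 (roughXi X XX Y Y')) ≤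
          C₂ T * (boNorm2 (2 * α) (β / 2) (q / 2) T (remainder X Y Y') * boSemi α β q T X +
            boSemi α β q T Y' * boNorm2 (2 * α) (β / 2) (q / 2) T XX) ∧
        -- bound on the seminorm of the integral
        boSemi α β q T (I Y Y') ≤
          C₃ T * ((‖Y 0‖ₑ + boSemi α β q T Y +
              boNorm2 (2 * α) (β / 2) (q / 2) T (remainder X Y Y')) * boSemi α β q T X +
            (‖Y' 0‖ₑ + boSemi α β q T Y') * roughNorm α β q T X XX ^ 2) ∧
        -- bound on the remainder of the integral
        (∀ p : ℝ, 3 / α < p →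
          boNorm2 (2 * α) (β / 2) (q / 2) T (remainder X (I Y Y') (fun s => matOp (Y s))) ≤
            C₄ p T * (‖Y' 0‖ₑ * boNorm2 (2 * α) (β / 2) (q / 2) T XX +
              ENNReal.ofReal (T ^ (α - 1 / p)) *
                max (roughNorm α β q T X XX) (roughNorm α β q T X XX ^ 2) *
                controlledSemi α β q T X Y Y')) := by
  have hq0 : q ≠ 0 := hq.ne'
  -- The factor `2` is the Hölder constant common to all Orlicz exponents, so this choice can
  -- precede `α` and `β`.
  refine ⟨fun _ => 2 * lpAddConst (q / 3) * (‖matOpL m n‖₊ + ‖tensorActL m n‖₊),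
    monotoneOn_const, fun α β hα _ hβ => ?_⟩
  have hα0 : 0 < α := by linarith
  obtain ⟨C₁, hC₁⟩ := exists_boNorm2_del_sub_roughXi_le m n (q := q) hα hβ hq0
  obtain ⟨e1, e2, e3, e4⟩ := sewExp_spec (β := β) hα le_rfl
  have h₃ : ∀ T : ℝ, ∃ C : ℝ≥0, 0 < T → ∀ {X : ℝ → Vec n} {XX : ℝ → ℝ → Mat n n}
      {Y : ℝ → Mat m n} {Y' : ℝ → Vec n →L[ℝ] Mat m n} {J : ℝ → Vec m},
      IsRoughPath α β q T X XX → IsControlled α β q T X Y Y' →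
      IsRoughIntegral α β q T X XX Y Y' J → boSemi α β q T J ≤
          C * ((‖Y 0‖ₑ + boSemi α β q T Y +
              boNorm2 (2 * α) (β / 2) (q / 2) T (remainder X Y Y')) * boSemi α β q T X +
            (‖Y' 0‖ₑ + boSemi α β q T Y') * roughNorm α β q T X XX ^ 2) := by
    intro T
    by_cases hT : 0 < T
    · obtain ⟨C, hC⟩ := exists_boSemi_integral_le m n hα hβ hq0 e1 e2 e3 e4 hT
      exact ⟨C, fun _ => hC⟩
    · exact ⟨0, fun h => absurd h hT⟩
  choose C₃ hC₃ using h₃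
  -- The sewing estimate needs `p` at least `sewExp α β`; for smaller `p` it is applied at the
  -- maximum of the two.
  have h₄ : ∀ p : ℝ, ∃ C : ℝ≥0, ∀ {T : ℝ} {X : ℝ → Vec n} {XX : ℝ → ℝ → Mat n n}
      {Y : ℝ → Mat m n} {Y' : ℝ → Vec n →L[ℝ] Mat m n} {J : ℝ → Vec m}, 0 < T →
      IsRoughPath α β q T X XX → IsControlled α β q T X Y Y' →
      IsRoughIntegral α β q T X XX Y Y' J →
      boNorm2 (2 * α) (β / 2) (q / 2) T (remainder X J (fun s => matOp (Y s))) ≤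
        C * (‖Y' 0‖ₑ * boNorm2 (2 * α) (β / 2) (q / 2) T XX +
          ENNReal.ofReal (T ^ (α - 1 / max p (sewExp α β))) *
          (boSemi α β q T X * boNorm2 (2 * α) (β / 2) (q / 2) T (remainder X Y Y') +
            boSemi α β q T Y' * boNorm2 (2 * α) (β / 2) (q / 2) T XX)) := fun p => by
    obtain ⟨f1, f2, f3, f4⟩ := sewExp_spec (β := β) hα (le_max_right p _)
    exact exists_boNorm2_remainder_le m n hα hβ hq0 f1 f2 f3 f4
  choose C₄ hC₄ using h₄
  have hgap : ∀ p, 3 / α < p → 0 ≤ 1 / p - 1 / max p (sewExp α β) := fun p hp => by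
    have hp0 : 0 < p := lt_trans (by positivity) hp
    exact sub_nonneg.2 (one_div_le_one_div_of_le hp0 (le_max_left _ _))
  -- The change of exponent costs a power of `T`, which is moved into the last constant. The power
  -- is nonnegative, so the constant remains nondecreasing.
  refine ⟨fun _ => C₁, C₃,
    fun p T => C₄ p * max 1 (T ^ (1 / p - 1 / max p (sewExp α β))).toNNReal, monotoneOn_const,
    fun p hp T hT S _ hTS => ?_, fun T hT X XX hX => ?_⟩
  · have := hgap p hp
    have hT0 : (0 : ℝ) ≤ T := le_of_lt hT
    dsimp only
    gcongr
  classical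
  -- Outside the controlled paths the integral is set to zero, so that one total map can be chosen
  -- before `Y`.
  have hex : ∀ (Y : ℝ → Mat m n) (Y' : ℝ → Vec n →L[ℝ] Mat m n), ∃ J : ℝ → Vec m,
      IsControlled α β q T X Y Y' → IsRoughIntegral α β q T X XX Y Y' J := fun Y Y' => by
    by_cases hY : IsControlled α β q T X Y Y'
    · obtain ⟨J, hJ, -⟩ := exists_isRoughIntegral hα0 hβ hq0 hT e1 e2 e3 e4 hX hY
      exact ⟨J, fun _ => hJ⟩
    · exact ⟨0, fun h => absurd h hY⟩
  choose I hI using hex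
  refine ⟨I, fun Y Z Y' Z' hY hZ a b => ?_, fun Y Y' hY => ?_⟩
  -- Linearity follows from uniqueness: the combination of the two integrals is a sewing of the
  -- combined approximation.
  · have hc := hY.lincomb hβ hZ a b
    exact ⟨hc, (hI _ _ hc).eqOn hα hβ hq0 ((hI Y Y' hY).lincomb hβ (hI Z Z' hZ) a b)⟩
  have hJ := hI Y Y' hY
  refine ⟨hJ, fun J hJ' => hJ'.eqOn hα hβ hq0 hJ,
    isControlled_integral hα hβ hq0 e1 e2 e3 e4 hT hX hY hJ, fun r hr hqr π hπ => ?_,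
    hC₁ hT hX hY hJ, boNorm3_del2_roughXi_le hβ hq0 hX hY, hC₃ T hT hX hY hJ, fun p hp => ?_⟩
  · simp only [UnitPartition.del_sub_partialSum]
    exact tendsto_boNorm2_partialSum (by linarith) (by positivity) hT (by simp [hq0]) hqr hr
      hJ.sewing.meas_section hJ.sewing.norm_lt_top hπ
  · refine (hC₄ p hT hX hY hJ).trans ?_
    have hpow : ENNReal.ofReal (T ^ (α - 1 / max p (sewExp α β))) =
        ENNReal.ofReal (T ^ (α - 1 / p)) *
          (T ^ (1 / p - 1 / max p (sewExp α β))).toNNReal := by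
      change _ = _ * ENNReal.ofReal _
      rw [← ENNReal.ofReal_mul (by positivity), ← Real.rpow_add hT]
      congr 2
      ring
    rw [hpow, ENNReal.coe_mul, mul_assoc (C₄ p : ℝ≥0∞)]
    refine mul_le_mul_right ?_ _
    set k : ℝ≥0 := (T ^ (1 / p - 1 / max p (sewExp α β))).toNNReal
    have hP := products_le_max_mul_controlledSemi (α := α) (β := β) (T := T) (q := q) (X := X)
      (XX := XX) (Y := Y) (Y' := Y')
    have hk : (1 : ℝ≥0∞) ≤ (max 1 k : ℝ≥0) := ENNReal.coe_le_coe.2 (le_max_left 1 k)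
    rw [mul_add ((max 1 k : ℝ≥0) : ℝ≥0∞)]
    refine add_le_add (le_mul_of_one_le_left zero_le hk) ?_
    calc _ ≤ ENNReal.ofReal (T ^ (α - 1 / p)) * (max 1 k : ℝ≥0) *
        (max (roughNorm α β q T X XX) (roughNorm α β q T X XX ^ 2) *
          controlledSemi α β q T X Y Y') := by
          gcongr
          exact le_max_right 1 k
      _ = _ := by ring
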